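/- Let $(M,g)=(\mathbb{R}\times\Sigma,\;V^2dt^2-h)$ be a standard static spacetime: $(\Sigma,h)$ is a smooth (Hausdorff, second countable, finite-dimensional, not necessarily connected) Riemannian manifold, $V\in C^\infty(\Sigma)$, $V>0$, and $\partial_t$ is the time orientation. Put $\Sigma_t=\{t\}\times\Sigma$. Let $d$ be the distance on $\Sigma$ induced by the Riemannian metric $V^{-2}h$ ($d=\infty$ between different components); "$\Sigma$ is complete" means complete for $d$, and $C(A,t)=\{p\in\Sigma: d(p,A)\le t\}$. For $A\subseteq M$ let $J^{\pm}(A)$ be the causal future/past of $A$ (the points of $A$ and those reached from $A$ by smooth future- /past-pointing causal curves), $J(A)=J^+(A)\cup J^-(A)$. Let $D^+(A)$ (resp. $D^-(A)$) be the set of $p\in M$ such that every past- (resp. future-) inextendible future-pointing smooth causal curve through $p$ meets $A$, and $D(A)=D^+(A)\cup D^-(A)$. For a compact set $K\subseteq\Sigma_0$ define $$t^\infty(K)=\sup\{t\ge 0: J^+(K)\cap\Sigma_t\text{ is compact}\}\in[0,\infty],$$ $t_0(K)=0$ and $t_{n+1}(K)=\sup\{t\ge 0: J^+(K)\cap\Sigma_t\subseteq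 D(\Sigma_{t_n(K)})\}$, where $t_{n+1}(K):=\infty$ if $t_n(K)=\infty$. Then, for every compact $K\subseteq\Sigma_0$: 1. If $J(K)\cap\Sigma_t$ is compact, then $J(K)\cap\Sigma_{t'}$ is compact whenever $|t'|\le|t|$. 2. $t^\infty(K)\in(0,\infty]$. 3. For $t\in\mathbb{R}$, $J(K)\cap\Sigma_t$ is compact if and only if $|t|<t^\infty(K)$. 4. If $\Sigma$ is complete, then $C(\pi(K),t)$ is compact for all $t\ge 0$, where $\pi(t,x)=x$, and $t^\infty(K)=\infty$. 5. If $\Sigma$ is connected, $K\neq\emptyset$ and $t^\infty(K)=\infty$, then $\Sigma$ is complete. 6. For $t\ge 0$, $J(K)\cap\Sigma_t\subseteq D(\Sigma_0)$ if and only if $t<t^\infty(K)/2$; and $t_1(K)=t^\infty(K)/2$. 7. For $n\ge 0$ and real $t\ge t_n(K)$, $J(K)\cap\Sigma_t\subseteq D(\Sigma_{t_n(K)})$ if and only if $t<(1-2^{-(n+1)})\,t^\infty(K)$. 8. $t_n(K)=(1-2^{-n})\,t^\infty(K)$ for all $n\ge 0$ (with $0\cdot\infty=0$); this sequence is nondecreasing,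 strictly increasing if $t^\infty(K)<\infty$, and converges to $t^\infty(K)$. Moreover, without connectedness: if $t^\infty(K)=\infty$ for every non-empty compact $K\subseteq\Sigma_0$, then $\Sigma$ is complete. -/

import Mathlib

open Set Filter Bundle Manifold
open scoped ContDiff ENNReal Topology

/-- A standard static spacetime `(ℝ × S, V² dt² - h)`: here `(S, h)` is a smooth Riemannian manifold
modelled on the finite-dimensional space `E` and `V` is a smooth positive function on `S`. -/
structure StandardStaticSpacetime
    (E : Type*) [NormedAddCommGroup E] [NormedSpace ℝ E]
    (S : Type*) [TopologicalSpace S] [ChartedSpace E S] [IsManifold 𝓘(ℝ, E) ∞ S] where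
  /-- The Riemannian metric on `S`. -/
  h : ContMDiffRiemannianMetric 𝓘(ℝ, E) ∞ E (fun x : S => TangentSpace 𝓘(ℝ, E) x)
  /-- The lapse function. -/
  V : S → ℝ
  V_smooth : ContMDiff 𝓘(ℝ, E) 𝓘(ℝ, ℝ) ∞ V
  V_pos : ∀ x, 0 < V x

namespace StandardStaticSpacetime

noncomputable section

variable {E : Type*} [NormedAddCommGroup E] [NormedSpace ℝ E]
  {S : Type*} [TopologicalSpace S] [ChartedSpace E S] [IsManifold 𝓘(ℝ, E) ∞ S]

/-! ### The distance on `S` -/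

/-- The smooth Riemannian metric `V⁻² h` on `S`. -/
def conformalMetric (M : StandardStaticSpacetime E S) :
    ContMDiffRiemannianMetric 𝓘(ℝ, E) ∞ E (fun x : S => TangentSpace 𝓘(ℝ, E) x) where
  inner x := (M.V x ^ 2)⁻¹ • M.h.inner x
  symm x v w := by
    simp [M.h.symm x v w]
  pos x v hv := by
    have h1 := M.h.pos x v hv
    have h2 := M.V_pos x
    simp only [smul_apply, smul_eq_mul]
    positivity
  isVonNBounded x := by
    have hV := M.V_pos x
    have hb := M.h.isVonNBounded x
    refine (hb.image (M.V x • ContinuousLinearMap.id ℝ (TangentSpace 𝓘(ℝ, E) x))).subset ?_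
    intro v hv
    refine ⟨(M.V x)⁻¹ • v, ?_, ?_⟩
    · have hv' : (M.V x ^ 2)⁻¹ * M.h.inner x v v < 1 := by simpa using hv
      have : M.h.inner x ((M.V x)⁻¹ • v) ((M.V x)⁻¹ • v) = (M.V x ^ 2)⁻¹ * M.h.inner x v v := by
        simp only [map_smul, smul_apply, smul_eq_mul]
        ring
      change M.h.inner x ((M.V x)⁻¹ • v) ((M.V x)⁻¹ • v) < 1
      rw [this]
      exact hv'
    · simp [smul_smul, hV.ne']
  contMDiff := by
    have hV : ContMDiff 𝓘(ℝ, E) 𝓘(ℝ, ℝ) ∞ (fun x => (M.V x ^ 2)⁻¹) :=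
      (M.V_smooth.pow 2).inv₀ (fun x => (pow_pos (M.V_pos x) 2).ne')
    exact hV.smul_section M.h.contMDiff

/-- The (extended) distance on `S` induced by the Riemannian metric `V⁻² h`: the infimum of the
lengths of the curves joining the two points (it is `∞` between different components). -/
def dist (M : StandardStaticSpacetime E S) (p q : S) : ℝ≥0∞ :=
  letI : RiemannianBundle (fun x : S => TangentSpace 𝓘(ℝ, E) x) :=
    ⟨M.conformalMetric.toRiemannianMetric⟩
  riemannianEDist 𝓘(ℝ, E) p q

/-- `C(A, t) = {p | d(p, A) ≤ t}`. -/
def closedThickening (M : StandardStaticSpacetime E S) (A : Set S) (t : ℝ) : Set S :=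
  {p | ⨅ q ∈ A, M.dist p q ≤ ENNReal.ofReal t}

/-- `S` is complete for the distance induced by `V⁻² h`: every Cauchy sequence converges. -/
def IsComplete (M : StandardStaticSpacetime E S) : Prop :=
  ∀ u : ℕ → S,
    (∀ ε : ℝ≥0∞, 0 < ε → ∃ N : ℕ, ∀ m ≥ N, ∀ n ≥ N, M.dist (u m) (u n) < ε) →
      ∃ p : S, Tendsto (fun n => M.dist (u n) p) atTop (𝓝 0)

/-! ### The Lorentzian metric and causal curves -/

/-- The tangent space of `ℝ × S` at `p`. -/
abbrev Tangent (E : Type*) [NormedAddCommGroup E] [NormedSpace ℝ E]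
    {S : Type*} [TopologicalSpace S] [ChartedSpace E S] (p : ℝ × S) : Type _ :=
  TangentSpace (𝓘(ℝ, ℝ).prod 𝓘(ℝ, E)) p

/-- The component `dt(v)` of a tangent vector of `ℝ × S`. -/
def dtime {p : ℝ × S} (v : Tangent E p) : ℝ :=
  mfderiv (𝓘(ℝ, ℝ).prod 𝓘(ℝ, E)) 𝓘(ℝ, ℝ) (Prod.fst : ℝ × S → ℝ) p v

/-- The component of a tangent vector of `ℝ × S` along `S`. -/
def dspace {p : ℝ × S} (v : Tangent E p) : TangentSpace 𝓘(ℝ, E) p.2 :=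
  mfderiv (𝓘(ℝ, ℝ).prod 𝓘(ℝ, E)) 𝓘(ℝ, E) (Prod.snd : ℝ × S → S) p v

/-- The Lorentzian metric `g = V² dt² - h`. -/
def g (M : StandardStaticSpacetime E S) (p : ℝ × S) (v w : Tangent E p) : ℝ :=
  M.V p.2 ^ 2 * (dtime v * dtime w) - M.h.inner p.2 (dspace v) (dspace w)

/-- The vector field `∂/∂t`, the velocity of `t ↦ (t, x)`, which gives the time orientation. -/
def timeField (E : Type*) [NormedAddCommGroup E] [NormedSpace ℝ E]
    {S : Type*} [TopologicalSpace S] [ChartedSpace E S] (p : ℝ × S) : Tangent E p :=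
  mfderiv 𝓘(ℝ, ℝ) (𝓘(ℝ, ℝ).prod 𝓘(ℝ, E)) (fun t : ℝ => (t, p.2)) p.1 (1 : ℝ)

/-- The velocity at parameter `s` of a curve with parameter domain `I`
(one-sided if `s` is an endpoint of `I`). -/
def velocity (E : Type*) [NormedAddCommGroup E] [NormedSpace ℝ E]
    {S : Type*} [TopologicalSpace S] [ChartedSpace E S]
    (γ : ℝ → ℝ × S) (I : Set ℝ) (s : ℝ) : Tangent E (γ s) :=
  mfderivWithin 𝓘(ℝ, ℝ) (𝓘(ℝ, ℝ).prod 𝓘(ℝ, E)) γ I s (1 : ℝ)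

/-- Future-pointing causal vectors: nonzero, `g(v, v) ≥ 0` and `g(v, ∂/∂t) > 0`. -/
def IsFutureCausal (M : StandardStaticSpacetime E S) {p : ℝ × S} (v : Tangent E p) : Prop :=
  v ≠ 0 ∧ 0 ≤ M.g p v v ∧ 0 < M.g p v (timeField E p)

/-- `γ`, restricted to the interval `I`, is a smooth future-pointing causal curve. -/
def IsFutureCausalCurveOn (M : StandardStaticSpacetime E S) (γ : ℝ → ℝ × S) (I : Set ℝ) : Prop :=
  I.OrdConnected ∧ ContMDiffOn 𝓘(ℝ, ℝ) (𝓘(ℝ, ℝ).prod 𝓘(ℝ, E)) ∞ γ I ∧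
    ∀ s ∈ I, M.IsFutureCausal (velocity E γ I s)

/-! ### Causal future and past, Cauchy developments -/

/-- The hypersurface `Σ_t = {t} × S`. -/
def slice (S : Type*) (t : ℝ) : Set (ℝ × S) := {p | p.1 = t}

/-- The causal future `J⁺(A)`: the points of `A` and the endpoints of smooth future-pointing causal
curves that start in `A`. -/
def Jplus (M : StandardStaticSpacetime E S) (A : Set (ℝ × S)) : Set (ℝ × S) :=
  {q | q ∈ A ∨ ∃ (a b : ℝ) (γ : ℝ → ℝ × S), a < b ∧
    M.IsFutureCausalCurveOn γ (Icc a b) ∧ γ a ∈ A ∧ γ b = q}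

/-- The causal past `J⁻(A)`. -/
def Jminus (M : StandardStaticSpacetime E S) (A : Set (ℝ × S)) : Set (ℝ × S) :=
  {q | q ∈ A ∨ ∃ (a b : ℝ) (γ : ℝ → ℝ × S), a < b ∧
    M.IsFutureCausalCurveOn γ (Icc a b) ∧ γ b ∈ A ∧ γ a = q}

/-- `J(A) = J⁺(A) ∪ J⁻(A)`. -/
def J (M : StandardStaticSpacetime E S) (A : Set (ℝ × S)) : Set (ℝ × S) :=
  M.Jplus A ∪ M.Jminus A

/-- The curve `γ` with parameter interval `I` has no past endpoint: `γ(s)` has no limit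
as `s` decreases through `I` to the lower end of `I`. -/
def PastInextendible {X : Type*} [TopologicalSpace X] (γ : ℝ → X) (I : Set ℝ) : Prop :=
  ¬ ∃ q : X, ∀ U ∈ 𝓝 q, ∃ s ∈ I, ∀ s' ∈ I, s' ≤ s → γ s' ∈ U

/-- The curve `γ` with parameter interval `I` has no future endpoint. -/
def FutureInextendible {X : Type*} [TopologicalSpace X] (γ : ℝ → X) (I : Set ℝ) : Prop :=
  ¬ ∃ q : X, ∀ U ∈ 𝓝 q, ∃ s ∈ I, ∀ s' ∈ I, s ≤ s' → γ s' ∈ U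

/-- The future Cauchy development `D⁺(A)`: the points `p` such that every past-inextendible
future-pointing smooth causal curve through `p` meets `A`. -/
def Dplus (M : StandardStaticSpacetime E S) (A : Set (ℝ × S)) : Set (ℝ × S) :=
  {p | ∀ (γ : ℝ → ℝ × S) (I : Set ℝ), M.IsFutureCausalCurveOn γ I → PastInextendible γ I →
    (∃ s ∈ I, γ s = p) → ∃ s ∈ I, γ s ∈ A}

/-- The past Cauchy development `D⁻(A)`. -/
def Dminus (M : StandardStaticSpacetime E S) (A : Set (ℝ × S)) : Set (ℝ × S) :=
  {p | ∀ (γ : ℝ → ℝ × S) (I : Set ℝ), M.IsFutureCausalCurveOn γ I → FutureInextendible γ I →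
    (∃ s ∈ I, γ s = p) → ∃ s ∈ I, γ s ∈ A}

/-- The Cauchy development `D(A) = D⁺(A) ∪ D⁻(A)`. -/
def D (M : StandardStaticSpacetime E S) (A : Set (ℝ × S)) : Set (ℝ × S) :=
  M.Dplus A ∪ M.Dminus A

/-! ### The times attached to `K` -/

/-- `t^∞(K) = sup {t ≥ 0 | J⁺(K) ∩ Σ_t is compact}`, an element of `[0, ∞]`. -/
def tInfty (M : StandardStaticSpacetime E S) (K : Set (ℝ × S)) : ℝ≥0∞ :=
  sSup (ENNReal.ofReal '' {t : ℝ | 0 ≤ t ∧ IsCompact (M.Jplus K ∩ slice S t)})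

open Classical in
/-- The iterated times `t_0(K) = 0`, `t_{n+1}(K) = sup {t ≥ 0 | J⁺(K) ∩ Σ_t ⊆ D(Σ_{t_n(K)})}`,
elements of `[0, ∞]`; once the value `∞` is reached it is kept. -/
def tSeq (M : StandardStaticSpacetime E S) (K : Set (ℝ × S)) : ℕ → ℝ≥0∞
  | 0 => 0
  | n + 1 =>
    if M.tSeq K n = ⊤ then ⊤
    else sSup (ENNReal.ofReal ''
      {t : ℝ | 0 ≤ t ∧ M.Jplus K ∩ slice S t ⊆ M.D (slice S (M.tSeq K n).toReal)})

end

end StandardStaticSpacetime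

/-!
Let `d` be the distance of `V⁻² h`. Parametrised by time, a causal curve is a curve in `S` that is
`1`-Lipschitz for `d`, so `J(K) ∩ Σ_t` lies between `{d(·, K) < |t|}` and `C(K, |t|)`. A point at
distance exactly `|t|` from `K` is reached as soon as `C(K, |t|)` is compact: there is a minimising
curve, and it is smooth because it locally minimises the energy. Hence `J(K) ∩ Σ_t` is compact if
and only if `C(K, |t|)` is, which happens for `|t| < t^∞(K)` as compactness of closed balls is an
open condition on the radius.

A point `(t, x)` with `t > τ` lies in `D(Σ_τ)` if and only if the ball `C(x, t - τ)` is compact: if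
it is, causal curves through `(t, x)` have a limit before leaving `C(x, t - τ)`; otherwise, at the
first radius for which balls fail to be compact, there is a minimising ray without endpoint, which
gives an inextendible causal curve that misses `Σ_τ`. As balls of radius `t - τ` about the points of
`C(K, t)` fill `C(K, 2t - τ)`, we get `J(K) ∩ Σ_t ⊆ D(Σ_τ)` if and only if `2t - τ < t^∞(K)`.
Therefore `t_{n+1} = (t_n + t^∞) / 2`.
-/

section ChartMetric

variable {E : Type*} [NormedAddCommGroup E] [NormedSpace ℝ E]
  {S : Type*} [TopologicalSpace S] [ChartedSpace E S]

lemma contMDiffOn_mfderiv_extChartAt_symm [IsManifold 𝓘(ℝ, E) ∞ S] (x₀ : S) (v : E) :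
    ContMDiffOn 𝓘(ℝ, E) (𝓘(ℝ, E).prod 𝓘(ℝ, E)) ∞
      (fun y => (⟨(extChartAt 𝓘(ℝ, E) x₀).symm y,
        mfderiv 𝓘(ℝ, E) 𝓘(ℝ, E) (extChartAt 𝓘(ℝ, E) x₀).symm y v⟩ : TangentBundle 𝓘(ℝ, E) S))
      (extChartAt 𝓘(ℝ, E) x₀).target := by
  have hopen := isOpen_extChartAt_target (I := 𝓘(ℝ, E)) x₀
  have hconst : ContMDiffOn 𝓘(ℝ, E) (𝓘(ℝ, E).prod 𝓘(ℝ, E)) ∞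
      (fun y : E => (⟨y, v⟩ : TangentBundle 𝓘(ℝ, E) E)) (extChartAt 𝓘(ℝ, E) x₀).target :=
    fun y _ => contMDiffWithinAt_vectorSpace_iff_contDiffWithinAt.2 contDiffWithinAt_const
  refine (((contMDiffOn_extChartAt_symm (n := ∞) x₀).contMDiffOn_tangentMapWithin (m := ∞) (by simp)
    hopen.uniqueMDiffOn).comp hconst fun y hy => hy).congr fun y hy => ?_
  simp only [Function.comp_apply, tangentMapWithin, mfderivWithin_of_isOpen hopen hy]

variable [RiemannianBundle (fun x : S => TangentSpace 𝓘(ℝ, E) x)]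

/-- The Riemannian metric of `S` in the chart at `x₀`, as a field of bilinear forms on the target
of this chart (with junk values elsewhere). -/
noncomputable def chartMetric (x₀ : S) (y : E) : E →L[ℝ] E →L[ℝ] ℝ :=
  (isBoundedBilinearMap_inner (𝕜 := ℝ)).toContinuousLinearMap.bilinearComp
    (mfderiv 𝓘(ℝ, E) 𝓘(ℝ, E) (extChartAt 𝓘(ℝ, E) x₀).symm y)
    (mfderiv 𝓘(ℝ, E) 𝓘(ℝ, E) (extChartAt 𝓘(ℝ, E) x₀).symm y)

lemma chartMetric_apply (x₀ : S) (y v w : E) :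
    chartMetric x₀ y v w =
      inner ℝ (mfderiv 𝓘(ℝ, E) 𝓘(ℝ, E) (extChartAt 𝓘(ℝ, E) x₀).symm y v)
        (mfderiv 𝓘(ℝ, E) 𝓘(ℝ, E) (extChartAt 𝓘(ℝ, E) x₀).symm y w) :=
  rfl

lemma chartMetric_nonneg (x₀ : S) (y v : E) : 0 ≤ chartMetric x₀ y v v :=
  (chartMetric_apply x₀ y v v).symm ▸ real_inner_self_nonneg

lemma chartMetric_symm (x₀ : S) (y v w : E) : chartMetric x₀ y v w = chartMetric x₀ y w v := by
  simp only [chartMetric_apply, real_inner_comm]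

lemma sqrt_chartMetric_smul (x₀ : S) (y v : E) (r : ℝ) :
    √(chartMetric x₀ y (r • v) (r • v)) = |r| * √(chartMetric x₀ y v v) := by
  simp only [map_smul, smul_apply, smul_eq_mul]
  rw [← mul_assoc, Real.sqrt_mul (mul_self_nonneg r), Real.sqrt_mul_self_eq_abs]

variable [IsManifold 𝓘(ℝ, E) ∞ S]

lemma chartMetric_pos {x₀ : S} {y v : E} (hy : y ∈ (extChartAt 𝓘(ℝ, E) x₀).target)
    (hv : v ≠ 0) : 0 < chartMetric x₀ y v v := by
  have := IsManifold.of_le (I := 𝓘(ℝ, E)) (M := S) (m := 1) (n := ∞) (by simp)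
  have hinv := isInvertible_mfderivWithin_extChartAt_symm hy
  rw [modelWithCornersSelf_coe, range_id, mfderivWithin_univ] at hinv
  rw [chartMetric_apply, real_inner_self_pos]
  exact (map_ne_zero_iff _ hinv.injective).2 hv

lemma contDiffOn_chartMetric [FiniteDimensional ℝ E]
    [IsContMDiffRiemannianBundle 𝓘(ℝ, E) ∞ E (fun x : S => TangentSpace 𝓘(ℝ, E) x)] (x₀ : S) :
    ContDiffOn ℝ ∞ (chartMetric x₀) (extChartAt 𝓘(ℝ, E) x₀).target := by
  refine contDiffOn_clm_apply.2 fun v => contDiffOn_clm_apply.2 fun w => ?_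
  rw [← contMDiffOn_iff_contDiffOn]
  exact ContMDiffOn.inner_bundle (E := fun x : S => TangentSpace 𝓘(ℝ, E) x)
    (b := (extChartAt 𝓘(ℝ, E) x₀).symm) (contMDiffOn_mfderiv_extChartAt_symm x₀ v)
    (contMDiffOn_mfderiv_extChartAt_symm x₀ w)

end ChartMetric

section CurveSpeed

variable (E : Type*) [NormedAddCommGroup E] [NormedSpace ℝ E]
  {S : Type*} [TopologicalSpace S] [ChartedSpace E S]
  [RiemannianBundle (fun x : S => TangentSpace 𝓘(ℝ, E) x)]

/-- The speed at parameter `s` of a curve with parameter domain `I` in a Riemannian manifold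
modelled on `E` (one-sided if `s` is an endpoint of `I`). -/
noncomputable def curveSpeed (c : ℝ → S) (I : Set ℝ) (s : ℝ) : ℝ :=
  ‖mfderivWithin 𝓘(ℝ, ℝ) 𝓘(ℝ, E) c I s (1 : ℝ)‖

variable {E}

lemma norm_tangentSpace_congr {p q : S} {v : TangentSpace 𝓘(ℝ, E) p} {w : TangentSpace 𝓘(ℝ, E) q}
    (hpq : p = q) (hvw : (v : E) = (w : E)) : ‖v‖ = ‖w‖ := by
  subst hpq hvw
  rfl

lemma curveSpeed_nonneg (c : ℝ → S) (I : Set ℝ) (s : ℝ) : 0 ≤ curveSpeed E c I s :=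
  norm_nonneg _

lemma curveSpeed_congr {c c' : ℝ → S} {I : Set ℝ} {s : ℝ} (h : c =ᶠ[𝓝[I] s] c')
    (hs : c s = c' s) : curveSpeed E c I s = curveSpeed E c' I s := by
  have hderiv : (mfderivWithin 𝓘(ℝ, ℝ) 𝓘(ℝ, E) c I s (1 : ℝ) : E) =
      (mfderivWithin 𝓘(ℝ, ℝ) 𝓘(ℝ, E) c' I s (1 : ℝ) : E) :=
    congrArg (fun L : ℝ →L[ℝ] E => L 1) (h.mfderivWithin_eq hs)
  exact norm_tangentSpace_congr hs hderiv

lemma curveSpeed_subset {c : ℝ → S} {I J : Set ℝ} {s : ℝ} (hJI : J ⊆ I)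
    (hc : MDifferentiableWithinAt 𝓘(ℝ, ℝ) 𝓘(ℝ, E) c I s) (hJ : UniqueDiffWithinAt ℝ J s) :
    curveSpeed E c J s = curveSpeed E c I s := by
  rw [curveSpeed, curveSpeed, mfderivWithin_subset hJI hJ.uniqueMDiffWithinAt hc]

lemma curveSpeed_extChartAt_symm [IsManifold 𝓘(ℝ, E) ∞ S] {x₀ : S} {w : ℝ → E} {v : E}
    {I : Set ℝ} {s : ℝ}
    (hw : HasDerivWithinAt w v I s) (hI : UniqueDiffWithinAt ℝ I s)
    (hs : w s ∈ (extChartAt 𝓘(ℝ, E) x₀).target) :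
    curveSpeed E (fun t => (extChartAt 𝓘(ℝ, E) x₀).symm (w t)) I s =
      √(chartMetric x₀ (w s) v v) := by
  have hsymm : MDifferentiableAt 𝓘(ℝ, E) 𝓘(ℝ, E) (extChartAt 𝓘(ℝ, E) x₀).symm (w s) :=
    ((contMDiffOn_extChartAt_symm (n := ∞) x₀).contMDiffAt
      ((isOpen_extChartAt_target x₀).mem_nhds hs)).mdifferentiableAt (by simp)
  have hcomp := hsymm.hasMFDerivAt.comp_hasMFDerivWithinAt s
    hw.hasFDerivWithinAt.hasMFDerivWithinAt
  have hderiv : (mfderivWithin 𝓘(ℝ, ℝ) 𝓘(ℝ, E) (fun t => (extChartAt 𝓘(ℝ, E) x₀).symm (w t)) I s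
      (1 : ℝ) : E) = mfderiv 𝓘(ℝ, E) 𝓘(ℝ, E) (extChartAt 𝓘(ℝ, E) x₀).symm (w s) ((1 : ℝ) • v) :=
    congrArg (fun L : ℝ →L[ℝ] E => L 1) (hcomp.mfderivWithin hI.uniqueMDiffWithinAt)
  rw [one_smul] at hderiv
  rw [chartMetric_apply, real_inner_self_eq_norm_sq, Real.sqrt_sq (norm_nonneg _)]
  exact norm_tangentSpace_congr rfl hderiv

lemma curveSpeed_eq_sqrt_chartMetric [IsManifold 𝓘(ℝ, E) ∞ S] {x₀ : S} {c : ℝ → S} {v : E}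
    {I : Set ℝ} {s : ℝ}
    (hc : ContinuousWithinAt c I s)
    (hv : HasDerivWithinAt (fun t => extChartAt 𝓘(ℝ, E) x₀ (c t)) v I s)
    (hI : UniqueDiffWithinAt ℝ I s) (hs : c s ∈ (extChartAt 𝓘(ℝ, E) x₀).source) :
    curveSpeed E c I s = √(chartMetric x₀ (extChartAt 𝓘(ℝ, E) x₀ (c s)) v v) := by
  rw [← curveSpeed_extChartAt_symm hv hI ((extChartAt 𝓘(ℝ, E) x₀).map_source hs)]
  refine curveSpeed_congr ?_ ((extChartAt 𝓘(ℝ, E) x₀).left_inv hs).symm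
  filter_upwards [hc.preimage_mem_nhdsWithin ((isOpen_extChartAt_source x₀).mem_nhds hs)]
    with t ht
  exact ((extChartAt 𝓘(ℝ, E) x₀).left_inv ht).symm

lemma pathELength_eq_lintegral_curveSpeed (c : ℝ → S) (a b : ℝ) :
    pathELength 𝓘(ℝ, E) c a b =
      ∫⁻ s in Icc a b, ENNReal.ofReal (curveSpeed E c (Icc a b) s) := by
  rw [pathELength_eq_lintegral_mfderivWithin_Icc]
  exact MeasureTheory.lintegral_congr fun s => (ofReal_norm _).symm

lemma riemannianEDist_le_of_curveSpeed_le_deriv {c : ℝ → S} {a b : ℝ} (hab : a ≤ b)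
    (hc : ContMDiffOn 𝓘(ℝ, ℝ) 𝓘(ℝ, E) 1 c (Icc a b)) {τ τ' : ℝ → ℝ}
    (hτ : ∀ s ∈ Icc a b, HasDerivWithinAt τ (τ' s) (Icc a b) s)
    (hspeed : ∀ s ∈ Icc a b, curveSpeed E c (Icc a b) s ≤ τ' s) :
    riemannianEDist 𝓘(ℝ, E) (c a) (c b) ≤ ENNReal.ofReal (τ b - τ a) := by
  have hnonneg : ∀ s ∈ Icc a b, 0 ≤ τ' s := fun s hs =>
    (curveSpeed_nonneg _ _ _).trans (hspeed s hs)
  have hcont : ContinuousOn τ (Icc a b) := fun s hs => (hτ s hs).continuousWithinAt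
  have hderiv : ∀ s ∈ Ioo a b, HasDerivAt τ (τ' s) s := fun s hs =>
    (hτ s (Ioo_subset_Icc_self hs)).hasDerivAt (Icc_mem_nhds hs.1 hs.2)
  have hint : MeasureTheory.IntegrableOn τ' (Ioc a b) :=
    intervalIntegral.integrableOn_deriv_of_nonneg hcont hderiv
      fun s hs => hnonneg s (Ioo_subset_Icc_self hs)
  calc riemannianEDist 𝓘(ℝ, E) (c a) (c b)
      ≤ ∫⁻ s in Icc a b, ENNReal.ofReal (curveSpeed E c (Icc a b) s) :=
        (riemannianEDist_le_pathELength hc rfl rfl hab).trans_eq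
          (pathELength_eq_lintegral_curveSpeed c a b)
    _ ≤ ∫⁻ s in Icc a b, ENNReal.ofReal (τ' s) :=
        MeasureTheory.setLIntegral_mono' measurableSet_Icc fun s hs =>
          ENNReal.ofReal_le_ofReal (hspeed s hs)
    _ = ENNReal.ofReal (∫ s in Icc a b, τ' s) :=
        (MeasureTheory.ofReal_integral_eq_lintegral_ofReal
          ((integrableOn_Icc_iff_integrableOn_Ioc).2 hint)
          ((MeasureTheory.ae_restrict_mem measurableSet_Icc).mono hnonneg)).symm
    _ = ENNReal.ofReal (τ b - τ a) := by
        rw [MeasureTheory.integral_Icc_eq_integral_Ioc, ← intervalIntegral.integral_of_le hab,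
          intervalIntegral.integral_eq_sub_of_hasDerivAt_of_le hab hcont hderiv
            ((intervalIntegrable_iff_integrableOn_Ioc_of_le hab).2 hint)]

lemma riemannianEDist_le_of_curveSpeed_le_one {c : ℝ → S}
    (hc : ContMDiff 𝓘(ℝ, ℝ) 𝓘(ℝ, E) 1 c) {a b : ℝ} (hab : a ≤ b)
    (hspeed : ∀ s ∈ Icc a b, curveSpeed E c univ s ≤ 1) :
    riemannianEDist 𝓘(ℝ, E) (c a) (c b) ≤ ENNReal.ofReal (b - a) := by
  rcases hab.eq_or_lt with rfl | hlt
  · simp [riemannianEDist_self]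
  refine riemannianEDist_le_of_curveSpeed_le_deriv hab hc.contMDiffOn (τ := id) (τ' := 1)
    (fun s _ => hasDerivWithinAt_id s _) fun s hs => ?_
  rw [curveSpeed_subset (subset_univ _)
    (hc.mdifferentiable (by simp) s).mdifferentiableWithinAt (uniqueDiffOn_Icc hlt s hs)]
  exact hspeed s hs

end CurveSpeed

section SmoothStep

open MeasureTheory

lemma exists_contDiff_step {L T : ℝ} (hL : 0 < L) (hLT : L < T) :
    ∃ l : ℝ → ℝ, ContDiff ℝ ∞ l ∧ (∀ t ≤ 0, l t = 0) ∧ (∀ t, T ≤ t → l t = 1) ∧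
      (∀ t, l t ∈ Icc (0 : ℝ) 1) ∧ ∀ t, |deriv l t| ≤ L⁻¹ := by
  let bump : ContDiffBump (T / 2) := ⟨L / 2, T / 2, by positivity, by linarith⟩
  let φ : ℝ → ℝ := bump.normed volume
  let l : ℝ → ℝ := fun t => ∫ s in (0 : ℝ)..t, φ s
  have hφ_nonneg : ∀ t, 0 ≤ φ t := bump.nonneg_normed
  have hφ_le : ∀ t, φ t ≤ L⁻¹ := fun t => by
    refine (bump.normed_le_div_measure_closedBall_rIn volume t).trans_eq ?_
    rw [Real.volume_real_closedBall (by positivity), mul_div_cancel₀ _ two_ne_zero, one_div]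
  have hφ_support : Function.support φ = Ioo 0 T := by
    rw [bump.support_normed_eq, Real.ball_eq_Ioo, sub_self, add_halves]
  have hderiv : ∀ t, HasDerivAt l (φ t) t := fun t =>
    intervalIntegral.integral_hasDerivAt_right (bump.continuous_normed.intervalIntegrable _ _)
      (bump.continuous_normed.stronglyMeasurableAtFilter _ _) bump.continuous_normed.continuousAt
  have hl_zero : ∀ t ≤ 0, l t = 0 := fun t ht => by
    refine intervalIntegral.integral_zero_ae (Eventually.of_forall fun s hs => ?_)
    rw [uIoc_of_ge ht] at hs
    exact Function.notMem_support.1 fun h => (hφ_support ▸ h).1.not_ge hs.2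
  have hl_one : ∀ t, T ≤ t → l t = 1 := fun t ht => by
    refine (intervalIntegral.integral_eq_integral_of_support_subset ?_).trans bump.integral_normed
    exact hφ_support.subset.trans (Ioo_subset_Ioc_self.trans (Ioc_subset_Ioc_right ht))
  have hmono : Monotone l := monotone_of_hasDerivAt_nonneg hderiv hφ_nonneg
  refine ⟨l, ?_, hl_zero, hl_one, fun t => ⟨?_, ?_⟩, fun t => ?_⟩
  · refine contDiff_infty_iff_deriv.2 ⟨fun t => (hderiv t).differentiableAt, ?_⟩
    rw [funext fun t => (hderiv t).deriv]
    exact bump.contDiff_normed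
  · exact (hl_zero _ (min_le_right t 0)).symm.le.trans (hmono (min_le_left t 0))
  · exact (hmono (le_max_left t T)).trans (hl_one _ (le_max_right t T)).le
  · rw [(hderiv t).deriv, abs_of_nonneg (hφ_nonneg t)]
    exact hφ_le t

end SmoothStep

section PositiveDefinite

variable {E : Type*} [NormedAddCommGroup E] [NormedSpace ℝ E] [FiniteDimensional ℝ E]

lemma exists_forall_mul_sq_norm_le_of_pos (B : E →L[ℝ] E →L[ℝ] ℝ)
    (hB : ∀ v, v ≠ 0 → 0 < B v v) : ∃ m > 0, ∀ v, m * ‖v‖ ^ 2 ≤ B v v := by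
  rcases subsingleton_or_nontrivial E with _ | _
  · exact ⟨1, one_pos, fun v => by simp [Subsingleton.elim v 0]⟩
  have hcont : Continuous fun v => B v v := by fun_prop
  obtain ⟨v₀, hv₀, hmin⟩ := (isCompact_sphere (0 : E) 1).exists_isMinOn
    (NormedSpace.sphere_nonempty.2 zero_le_one) hcont.continuousOn
  refine ⟨B v₀ v₀, hB _ (ne_zero_of_mem_unit_sphere ⟨v₀, hv₀⟩), fun v => ?_⟩
  rcases eq_or_ne v 0 with rfl | hv
  · simp
  have hnorm : ‖v‖ ≠ 0 := norm_ne_zero_iff.2 hv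
  have hle : B v₀ v₀ ≤ B (‖v‖⁻¹ • v) (‖v‖⁻¹ • v) :=
    hmin (show ‖v‖⁻¹ • v ∈ Metric.sphere (0 : E) 1 by simp [norm_smul, hnorm])
  calc B v₀ v₀ * ‖v‖ ^ 2 ≤ B (‖v‖⁻¹ • v) (‖v‖⁻¹ • v) * ‖v‖ ^ 2 := by gcongr
    _ = B v v := by
        simp only [map_smul, smul_apply, smul_eq_mul]
        field_simp

lemma eventually_forall_le_mul_of_continuousAt {X : Type*} [TopologicalSpace X]
    {G : X → E →L[ℝ] E →L[ℝ] ℝ} {x₀ : X} (hG : ContinuousAt G x₀)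
    (hpos : ∀ v, v ≠ 0 → 0 < G x₀ v v) {C : ℝ} (hC : 1 < C) :
    ∀ᶠ x in 𝓝 x₀, ∀ v, G x v v ≤ C * G x₀ v v ∧ G x₀ v v ≤ C * G x v v := by
  obtain ⟨m, hm, hmv⟩ := exists_forall_mul_sq_norm_le_of_pos _ hpos
  have hC₀ : 0 < C := one_pos.trans hC
  set δ := min (C - 1) (1 - C⁻¹)
  have hδ₀ : 0 < δ := lt_min (sub_pos.2 hC) (sub_pos.2 (inv_lt_one_of_one_lt₀ hC))
  filter_upwards [hG.eventually (eventually_norm_sub_lt (G x₀) (mul_pos hδ₀ hm))] with x hx v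
  have hdiff : |G x v v - G x₀ v v| ≤ δ * G x₀ v v := calc
    |(G x - G x₀) v v| ≤ ‖G x - G x₀‖ * ‖v‖ * ‖v‖ := (G x - G x₀).le_opNorm₂ v v
    _ ≤ δ * m * ‖v‖ * ‖v‖ := by gcongr
    _ = δ * (m * ‖v‖ ^ 2) := by ring
    _ ≤ δ * G x₀ v v := by gcongr; exact hmv v
  have hnonneg : 0 ≤ G x₀ v v := le_trans (by positivity) (hmv v)
  have hle₁ : δ * G x₀ v v ≤ (C - 1) * G x₀ v v := by gcongr; exact min_le_left _ _
  have hle₂ : δ * G x₀ v v ≤ (1 - C⁻¹) * G x₀ v v := by gcongr; exact min_le_right _ _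
  obtain ⟨hlower, hupper⟩ := abs_le.1 hdiff
  refine ⟨by linarith, ?_⟩
  rw [← inv_mul_le_iff₀ hC₀]
  linarith

end PositiveDefinite

section LengthBound

open MeasureTheory

variable {X : Type*} [PseudoEMetricSpace X] {c : ℝ → X} {a b : ℝ} {v : ℝ → ℝ}

lemma toReal_min_edist_sub_le {p x y : X} {N : ℝ≥0∞} (hN : N ≠ ⊤) {r : ℝ} (hr : 0 ≤ r)
    (h : edist x y ≤ ENNReal.ofReal r) :
    (min (edist p y) N).toReal - (min (edist p x) N).toReal ≤ r := by
  have hx : min (edist p x) N ≠ ⊤ := ne_top_of_le_ne_top hN (min_le_right _ _)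
  have hle : min (edist p y) N ≤ min (edist p x) N + ENNReal.ofReal r := by
    rw [min_add]
    exact min_le_min ((edist_triangle p x y).trans (by gcongr)) le_self_add
  have := ENNReal.toReal_mono (ENNReal.add_ne_top.2 ⟨hx, ENNReal.ofReal_ne_top⟩) hle
  rw [ENNReal.toReal_add hx ENNReal.ofReal_ne_top, ENNReal.toReal_ofReal hr] at this
  linarith

lemma abs_toReal_min_edist_sub_le {p x y : X} {N : ℝ≥0∞} (hN : N ≠ ⊤) {r : ℝ} (hr : 0 ≤ r)
    (h : edist x y ≤ ENNReal.ofReal r) :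
    |(min (edist p y) N).toReal - (min (edist p x) N).toReal| ≤ r :=
  abs_sub_le_iff.2 ⟨toReal_min_edist_sub_le hN hr h,
    toReal_min_edist_sub_le hN hr (by rwa [edist_comm])⟩

lemma le_ofReal_of_toReal_min_le {x : ℝ≥0∞} {r : ℝ} (hr : 0 ≤ r)
    (h : (min x (ENNReal.ofReal (r + 1))).toReal ≤ r) : x ≤ ENNReal.ofReal r := by
  have hmin := (ENNReal.le_ofReal_iff_toReal_le (by simp) hr).2 h
  refine (min_le_iff.1 hmin).resolve_right (not_le.2 ?_)
  exact (ENNReal.ofReal_lt_ofReal_iff (by positivity)).2 (lt_add_one r)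

lemma edist_le_integral_of_eventually_le (hab : a ≤ b) (hv : ContinuousOn v (Icc a b))
    (hv₀ : ∀ s ∈ Icc a b, 0 ≤ v s)
    (hc : ∀ s ∈ Icc a b, ∀ r > v s, ∀ᶠ t in 𝓝[Icc a b] s,
      edist (c s) (c t) ≤ ENNReal.ofReal (r * |t - s|)) :
    edist (c a) (c b) ≤ ENNReal.ofReal (∫ s in a..b, v s) := by
  set N : ℝ≥0∞ := ENNReal.ofReal ((∫ s in a..b, v s) + 1)
  have hN : N ≠ ⊤ := ENNReal.ofReal_ne_top
  let F : ℝ → ℝ := fun s => (min (edist (c a) (c s)) N).toReal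
  have hF_cont : ContinuousOn F (Icc a b) := fun s hs => by
    have hr : 0 ≤ v s + 1 := add_nonneg (hv₀ s hs) zero_le_one
    refine tendsto_iff_norm_sub_tendsto_zero.2 (squeeze_zero' (g := fun t => (v s + 1) * |t - s|)
      (Eventually.of_forall fun _ => norm_nonneg _) ?_ ?_)
    · filter_upwards [hc s hs (v s + 1) (lt_add_one _)] with t ht
      exact abs_toReal_min_edist_sub_le hN (by positivity) ht
    · exact (Continuous.tendsto' (by fun_prop) _ _ (by simp)).mono_left nhdsWithin_le_nhds
  refine le_ofReal_of_toReal_min_le (intervalIntegral.integral_nonneg hab hv₀) ?_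
  refine image_le_of_liminf_slope_right_le_deriv_boundary (B := fun t => ∫ s in a..t, v s)
    (B' := v) hF_cont ?_ ?_ ?_ ?_ (right_mem_Icc.2 hab)
  · simp [F]
  · rw [← uIcc_of_le hab]
    exact intervalIntegral.continuousOn_primitive_interval
      (uIcc_of_le hab ▸ hv.integrableOn_Icc)
  · intro s hs
    have hmem : Icc a b ∈ 𝓝[>] s :=
      mem_of_superset (Ioo_mem_nhdsGT hs.2) fun t ht => ⟨hs.1.trans ht.1.le, ht.2.le⟩
    exact intervalIntegral.integral_hasDerivWithinAt_right
      (hv.mono (uIcc_of_le hs.1 ▸ Icc_subset_Icc_right hs.2.le)).intervalIntegrable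
      ⟨Icc a b, hmem, hv.aestronglyMeasurable measurableSet_Icc⟩
      ((hv s (Ico_subset_Icc_self hs)).mono_of_mem_nhdsWithin hmem)
  · intro s hs r hr
    obtain ⟨r', hvr', hr'r⟩ := exists_between hr
    have hr' : 0 ≤ r' := (hv₀ s (Ico_subset_Icc_self hs)).trans hvr'.le
    have hle : 𝓝[>] s ≤ 𝓝[Icc a b] s := nhdsWithin_le_iff.2
      (mem_of_superset (Ioo_mem_nhdsGT hs.2) fun t ht => ⟨hs.1.trans ht.1.le, ht.2.le⟩)
    refine Eventually.frequently ?_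
    filter_upwards [hle (hc s (Ico_subset_Icc_self hs) r' hvr'), self_mem_nhdsWithin] with t ht hst
    have hpos : 0 < t - s := sub_pos.2 hst
    rw [abs_of_pos hpos] at ht
    rw [slope_def_field, div_lt_iff₀ hpos]
    exact (toReal_min_edist_sub_le hN (by positivity) ht).trans_lt (by gcongr)

lemma edist_le_lintegral_of_ae_eventually_le {K : NNReal} (hab : a ≤ b)
    (hlip : LipschitzOnWith K c (Icc a b)) (hv₀ : ∀ s, 0 ≤ v s)
    (hc : ∀ᵐ s, s ∈ Ioo a b → ∀ r > v s, ∀ᶠ t in 𝓝 s,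
      edist (c s) (c t) ≤ ENNReal.ofReal (r * |t - s|)) :
    edist (c a) (c b) ≤ ∫⁻ s in Ioo a b, ENNReal.ofReal (v s) := by
  have hlip' : ∀ s ∈ Icc a b, ∀ t ∈ Icc a b,
      edist (c s) (c t) ≤ ENNReal.ofReal (K * dist s t) := fun s hs t ht => by
    simpa [ENNReal.ofReal_mul, edist_dist] using hlip hs ht
  set N := edist (c a) (c b) with hN_def
  have hN : N ≠ ⊤ :=
    ((hlip' a (left_mem_Icc.2 hab) b (right_mem_Icc.2 hab)).trans_lt ENNReal.ofReal_lt_top).ne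
  let F : ℝ → ℝ := fun s => (min (edist (c a) (c s)) N).toReal
  have hF_lip : LipschitzOnWith K F (uIcc a b) := by
    rw [uIcc_of_le hab]
    refine LipschitzOnWith.of_dist_le_mul fun s hs t ht => ?_
    rw [dist_comm s t]
    exact abs_toReal_min_edist_sub_le hN (by positivity) (hlip' t ht s hs)
  have hF_deriv : ∀ᵐ s, s ∈ Ioo a b → ‖deriv F s‖ₑ ≤ ENNReal.ofReal (v s) := by
    filter_upwards [hc] with s hs hsab
    rw [← ofReal_norm]
    refine ENNReal.ofReal_le_ofReal (le_of_forall_gt_imp_ge_of_dense fun r hr => ?_)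
    have hr₀ : 0 ≤ r := (hv₀ s).trans hr.le
    refine norm_deriv_le_of_lip' hr₀ ((hs hsab r hr).mono fun t ht => ?_)
    exact abs_toReal_min_edist_sub_le hN (by positivity) ht
  calc N = ENNReal.ofReal (F b - F a) := by simp [F, ← hN_def, hN]
    _ = ENNReal.ofReal (∫ s in a..b, deriv F s) := by
        rw [hF_lip.absolutelyContinuousOnInterval.integral_deriv_eq_sub]
    _ ≤ ‖∫ s in Ioo a b, deriv F s‖ₑ := by
        rw [intervalIntegral.integral_of_le hab, integral_Ioc_eq_integral_Ioo, ← ofReal_norm]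
        exact ENNReal.ofReal_le_ofReal (Real.le_norm_self _)
    _ ≤ ∫⁻ s in Ioo a b, ‖deriv F s‖ₑ := enorm_integral_le_lintegral_enorm _
    _ ≤ ∫⁻ s in Ioo a b, ENNReal.ofReal (v s) :=
        setLIntegral_mono_ae' measurableSet_Ioo hF_deriv

end LengthBound

section SmoothReach

variable (E : Type*) [NormedAddCommGroup E] [NormedSpace ℝ E]
  {S : Type*} [TopologicalSpace S] [ChartedSpace E S]
  [RiemannianBundle (fun x : S => TangentSpace 𝓘(ℝ, E) x)]

/-- `q` is reached from `p` in time less than `T` by a smooth curve of speed at most `1`. The curve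
rests at `p` before time `0` and at `q` after its arrival, so that such curves concatenate
smoothly. -/
def SmoothReach (p q : S) (T : ℝ) : Prop :=
  ∃ c : ℝ → S, ContMDiff 𝓘(ℝ, ℝ) 𝓘(ℝ, E) ∞ c ∧ (∀ t ≤ 0, c t = p) ∧
    (∃ T' ∈ Ioo 0 T, ∀ t, T' ≤ t → c t = q) ∧ ∀ t, curveSpeed E c univ t ≤ 1

/-- The infimum of the times in which `q` is reached from `p` by smooth curves of speed at most
`1`. -/
noncomputable def reachDist (p q : S) : ℝ≥0∞ :=
  ⨅ (T : ℝ) (_ : SmoothReach E p q T), ENNReal.ofReal T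

variable {E}

lemma curveSpeed_comp {c : ℝ → S} {φ : ℝ → ℝ} {φ' t : ℝ} (hφ : HasDerivAt φ φ' t)
    (hc : MDifferentiableAt 𝓘(ℝ, ℝ) 𝓘(ℝ, E) c (φ t)) :
    curveSpeed E (fun t => c (φ t)) univ t = |φ'| * curveSpeed E c univ (φ t) := by
  have hcomp := hc.hasMFDerivAt.comp t hφ.hasFDerivAt.hasMFDerivAt
  have hderiv : (mfderiv 𝓘(ℝ, ℝ) 𝓘(ℝ, E) (fun t => c (φ t)) t (1 : ℝ) : E) =
      mfderiv 𝓘(ℝ, ℝ) 𝓘(ℝ, E) c (φ t) (φ' • (1 : ℝ)) :=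
    (congrArg (fun L : ℝ →L[ℝ] E => L 1) hcomp.mfderiv).trans
      (congrArg (mfderiv 𝓘(ℝ, ℝ) 𝓘(ℝ, E) c (φ t) : ℝ →L[ℝ] E) (mul_comm 1 φ'))
  simp only [curveSpeed, mfderivWithin_univ]
  refine (norm_tangentSpace_congr rfl hderiv).trans ?_
  exact (congrArg norm (map_smul (mfderiv 𝓘(ℝ, ℝ) 𝓘(ℝ, E) c (φ t)) φ' (1 : ℝ))).trans
    (norm_smul _ _)

namespace SmoothReach

variable {p q r : S} {T T' : ℝ}

lemma mono (h : SmoothReach E p q T) (hT : T ≤ T') : SmoothReach E p q T' := by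
  obtain ⟨c, hc, hc₀, ⟨T₁, hT₁, hc₁⟩, hspeed⟩ := h
  exact ⟨c, hc, hc₀, ⟨T₁, Ioo_subset_Ioo_right hT hT₁, hc₁⟩, hspeed⟩

lemma refl (p : S) (hT : 0 < T) : SmoothReach E p p T := by
  refine ⟨fun _ => p, contMDiff_const, fun _ _ => rfl,
    ⟨T / 2, ⟨half_pos hT, half_lt_self hT⟩, fun _ _ => rfl⟩, fun t => ?_⟩
  simp only [curveSpeed, mfderivWithin_const]
  exact (norm_zero (E := TangentSpace 𝓘(ℝ, E) p)).trans_le zero_le_one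

lemma symm (h : SmoothReach E p q T) : SmoothReach E q p T := by
  obtain ⟨c, hc, hc₀, ⟨T₁, hT₁, hc₁⟩, hspeed⟩ := h
  have hφ : ∀ t, HasDerivAt (fun t : ℝ => T₁ - t) (-1) t := fun t =>
    (hasDerivAt_id t).const_sub T₁
  refine ⟨fun t => c (T₁ - t), hc.comp (contMDiff_iff_contDiff.2 (by fun_prop)),
    fun t ht => hc₁ _ (by linarith), ⟨T₁, hT₁, fun t ht => hc₀ _ (by linarith)⟩, fun t => ?_⟩
  rw [curveSpeed_comp (hφ t) (hc.mdifferentiable (by simp) _), abs_neg, abs_one, one_mul]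
  exact hspeed _

lemma trans (hpq : SmoothReach E p q T) (hqr : SmoothReach E q r T') :
    SmoothReach E p r (T + T') := by
  obtain ⟨c, hc, hc₀, ⟨T₁, hT₁, hc₁⟩, hspeed⟩ := hpq
  obtain ⟨c', hc', hc'₀, ⟨T₂, hT₂, hc'₁⟩, hspeed'⟩ := hqr
  let z : ℝ → S := fun t => if t < T then c t else c' (t - T)
  have hz_left : ∀ t < T, z =ᶠ[𝓝 t] c := fun t ht => by
    filter_upwards [Iio_mem_nhds ht] with s hs using if_pos hs
  have hz_right : ∀ t > T₁, z =ᶠ[𝓝 t] fun s => c' (s - T) := fun t ht => by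
    filter_upwards [Ioi_mem_nhds ht] with s hs
    rcases lt_or_ge s T with hsT | hsT
    · exact (if_pos hsT).trans ((hc₁ s hs.le).trans (hc'₀ _ (by linarith)).symm)
    · exact if_neg hsT.not_gt
  have hc'T : ContMDiff 𝓘(ℝ, ℝ) 𝓘(ℝ, E) ∞ fun s => c' (s - T) :=
    hc'.comp (contMDiff_iff_contDiff.2 (by fun_prop))
  refine ⟨z, fun t => ?_, fun t ht => ?_, ⟨T + T₂, ⟨?_, ?_⟩, fun t ht => ?_⟩, fun t => ?_⟩
  · rcases lt_or_ge t T with ht | ht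
    · exact hc.contMDiffAt.congr_of_eventuallyEq (hz_left t ht)
    · exact hc'T.contMDiffAt.congr_of_eventuallyEq (hz_right t (hT₁.2.trans_le ht))
  · exact (if_pos (by linarith [hT₁.1, hT₁.2])).trans (hc₀ t ht)
  · linarith [hT₁.1, hT₁.2, hT₂.1]
  · linarith [hT₂.2]
  · exact (if_neg (by linarith [hT₂.1])).trans (hc'₁ _ (by linarith))
  · rcases lt_or_ge t T with ht | ht
    · rw [curveSpeed_congr (nhdsWithin_univ t ▸ hz_left t ht) (hz_left t ht).eq_of_nhds]
      exact hspeed t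
    · have hz := hz_right t (hT₁.2.trans_le ht)
      rw [curveSpeed_congr (nhdsWithin_univ t ▸ hz) hz.eq_of_nhds,
        curveSpeed_comp ((hasDerivAt_id' t).sub_const T) (hc'.mdifferentiable (by simp) _),
        abs_one, one_mul]
      exact hspeed' _

lemma riemannianEDist_le (h : SmoothReach E p q T) :
    riemannianEDist 𝓘(ℝ, E) p q ≤ ENNReal.ofReal T := by
  obtain ⟨c, hc, hc₀, ⟨T₁, hT₁, hc₁⟩, hspeed⟩ := h
  rw [← hc₀ 0 le_rfl, ← hc₁ T₁ le_rfl]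
  refine (riemannianEDist_le_of_curveSpeed_le_one (hc.of_le (by simp)) hT₁.1.le
    fun s _ => hspeed s).trans (ENNReal.ofReal_le_ofReal ?_)
  linarith [hT₁.2]

lemma reachDist_le (h : SmoothReach E p q T) : reachDist E p q ≤ ENNReal.ofReal T :=
  iInf₂_le T h

end SmoothReach

lemma smoothReach_of_reachDist_lt {p q : S} {T : ℝ} (h : reachDist E p q < ENNReal.ofReal T) :
    SmoothReach E p q T := by
  simp only [reachDist, iInf_lt_iff] at h
  obtain ⟨T', hT', hlt⟩ := h
  exact hT'.mono (ENNReal.ofReal_lt_ofReal_iff'.1 hlt).1.le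

lemma riemannianEDist_le_reachDist (p q : S) :
    riemannianEDist 𝓘(ℝ, E) p q ≤ reachDist E p q :=
  le_iInf₂ fun _ h => h.riemannianEDist_le

lemma reachDist_self (p : S) : reachDist E p p = 0 := by
  refine le_antisymm (ENNReal.le_of_forall_pos_le_add fun ε hε _ => ?_) zero_le
  simpa using (SmoothReach.refl (E := E) p (NNReal.coe_pos.2 hε)).reachDist_le

lemma reachDist_comm (p q : S) : reachDist E p q = reachDist E q p :=
  iInf_congr fun _ => iInf_congr_Prop ⟨.symm, .symm⟩ fun _ => rfl

lemma reachDist_triangle (p q r : S) :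
    reachDist E p r ≤ reachDist E p q + reachDist E q r := by
  refine ENNReal.le_iInf₂_add_iInf₂ fun T hT T' hT' => ?_
  refine (hT.trans hT').reachDist_le.trans ENNReal.ofReal_add_le

end SmoothReach

section LocalEstimates

variable {E : Type*} [NormedAddCommGroup E] [NormedSpace ℝ E] [FiniteDimensional ℝ E]
  {S : Type*} [TopologicalSpace S] [ChartedSpace E S] [IsManifold 𝓘(ℝ, E) ∞ S]
  [RiemannianBundle (fun x : S => TangentSpace 𝓘(ℝ, E) x)]
  [IsContMDiffRiemannianBundle 𝓘(ℝ, E) ∞ E (fun x : S => TangentSpace 𝓘(ℝ, E) x)]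

lemma continuousAt_chartMetric {x₀ : S} {y₀ : E} (hy₀ : y₀ ∈ (extChartAt 𝓘(ℝ, E) x₀).target) :
    ContinuousAt (chartMetric x₀) y₀ :=
  (contDiffOn_chartMetric x₀).continuousOn.continuousAt
    ((isOpen_extChartAt_target x₀).mem_nhds hy₀)

lemma exists_nhds_forall_smoothReach {x₀ : S} {y₀ : E}
    (hy₀ : y₀ ∈ (extChartAt 𝓘(ℝ, E) x₀).target) {C : ℝ} (hC : 1 < C) :
    ∃ U ∈ 𝓝 y₀, ∀ y ∈ U, ∀ y' ∈ U, ∀ T > C * √(chartMetric x₀ y₀ (y' - y) (y' - y)),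
      SmoothReach E ((extChartAt 𝓘(ℝ, E) x₀).symm y) ((extChartAt 𝓘(ℝ, E) x₀).symm y') T := by
  obtain ⟨ε, hε, hball⟩ := Metric.eventually_nhds_iff_ball.1
    (((isOpen_extChartAt_target x₀).eventually_mem hy₀).and
      (eventually_forall_le_mul_of_continuousAt (continuousAt_chartMetric hy₀)
        (fun v => chartMetric_pos hy₀) (one_lt_pow₀ hC two_ne_zero)))
  refine ⟨Metric.ball y₀ ε, Metric.ball_mem_nhds y₀ hε, fun y hy y' hy' T hT => ?_⟩
  set Δ := y' - y
  obtain ⟨L, hL, hLT⟩ := exists_between hT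
  obtain ⟨T', hLT', hT'⟩ := exists_between hLT
  have hL₀ : 0 < L := hL.trans_le' (by positivity)
  obtain ⟨l, hl, hl₀, hl₁, hl_mem, hl_deriv⟩ := exists_contDiff_step hL₀ hLT'
  let z : ℝ → E := fun t => y + l t • Δ
  have hz : ContDiff ℝ ∞ z := by fun_prop
  have hz_mem : ∀ t, z t ∈ Metric.ball y₀ ε := fun t =>
    (convex_ball y₀ ε).add_smul_sub_mem hy hy' (hl_mem t)
  have hz_deriv : ∀ t, HasDerivAt z (deriv l t • Δ) t := fun t =>
    ((hl.differentiable (by simp) t).hasDerivAt.smul_const Δ).const_add y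
  refine ⟨fun t => (extChartAt 𝓘(ℝ, E) x₀).symm (z t), fun t => ?_, fun t ht => ?_,
    ⟨T', ⟨hL₀.trans hLT', hT'⟩, fun t ht => ?_⟩, fun t => ?_⟩
  · exact ((contMDiffOn_extChartAt_symm x₀).contMDiffAt ((isOpen_extChartAt_target x₀).mem_nhds
      (hball _ (hz_mem t)).1)).comp t hz.contMDiff.contMDiffAt
  · simp only [z, hl₀ t ht, zero_smul, add_zero]
  · simp only [z, Δ, hl₁ t ht, one_smul, add_sub_cancel]
  · rw [curveSpeed_extChartAt_symm (hz_deriv t).hasDerivWithinAt uniqueDiffWithinAt_univ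
      (hball _ (hz_mem t)).1, sqrt_chartMetric_smul]
    calc |deriv l t| * √(chartMetric x₀ (z t) Δ Δ)
        ≤ L⁻¹ * √(C ^ 2 * chartMetric x₀ y₀ Δ Δ) := by
          gcongr
          · exact hl_deriv t
          · exact ((hball _ (hz_mem t)).2 Δ).1
      _ = L⁻¹ * (C * √(chartMetric x₀ y₀ Δ Δ)) := by
          rw [Real.sqrt_mul (sq_nonneg C), Real.sqrt_sq (by positivity)]
      _ ≤ L⁻¹ * L := by gcongr
      _ = 1 := inv_mul_cancel₀ hL₀.ne'

lemma exists_nhds_forall_reachDist_le {x₀ : S} {y₀ : E}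
    (hy₀ : y₀ ∈ (extChartAt 𝓘(ℝ, E) x₀).target) {C : ℝ} (hC : 1 < C) :
    ∃ U ∈ 𝓝 y₀, ∀ y ∈ U, ∀ y' ∈ U,
      reachDist E ((extChartAt 𝓘(ℝ, E) x₀).symm y) ((extChartAt 𝓘(ℝ, E) x₀).symm y') ≤
        ENNReal.ofReal (C * √(chartMetric x₀ y₀ (y' - y) (y' - y))) := by
  obtain ⟨U, hU, hreach⟩ := exists_nhds_forall_smoothReach hy₀ hC
  refine ⟨U, hU, fun y hy y' hy' => ENNReal.le_of_forall_pos_le_add fun ε hε _ => ?_⟩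
  rw [← ENNReal.ofReal_coe_nnreal, ← ENNReal.ofReal_add (by positivity) ε.coe_nonneg]
  exact (hreach y hy y' hy' _ (lt_add_of_pos_right _ hε)).reachDist_le

lemma eventually_reachDist_extChartAt_symm_le {x₀ : S} {w : ℝ → E} {f : E} {I : Set ℝ} {s : ℝ}
    (hw : HasDerivWithinAt w f I s) (hs : w s ∈ (extChartAt 𝓘(ℝ, E) x₀).target) {r : ℝ}
    (hr : √(chartMetric x₀ (w s) f f) < r) :
    ∀ᶠ t in 𝓝[I] s, reachDist E ((extChartAt 𝓘(ℝ, E) x₀).symm (w s))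
      ((extChartAt 𝓘(ℝ, E) x₀).symm (w t)) ≤ ENNReal.ofReal (r * |t - s|) := by
  have hC : ∀ᶠ C in 𝓝[>] (1 : ℝ), C * √(chartMetric x₀ (w s) f f) < r :=
    nhdsWithin_le_nhds <| (Continuous.tendsto' (f := fun C : ℝ => C * _) (by fun_prop) 1 _
      (one_mul _)).eventually_lt_const hr
  obtain ⟨C, hCr, hC₁⟩ := (hC.and self_mem_nhdsWithin).exists
  obtain ⟨U, hU, hdist⟩ := exists_nhds_forall_reachDist_le hs hC₁
  have hslope : ∀ᶠ t in 𝓝[I \ {s}] s,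
      C * √(chartMetric x₀ (w s) (slope w s t) (slope w s t)) < r := by
    have hcont : Continuous fun v => C * √(chartMetric x₀ (w s) v v) := by fun_prop
    exact ((hcont.tendsto f).comp (hasDerivWithinAt_iff_tendsto_slope.1 hw)).eventually_lt_const
      hCr
  rw [eventually_nhdsWithin_iff] at hslope ⊢
  have hwU := eventually_nhdsWithin_iff.1 (hw.continuousWithinAt.eventually_mem hU)
  filter_upwards [hslope, hwU] with t ht htU htI
  rcases eq_or_ne t s with rfl | hts
  · simp [reachDist_self]
  refine (hdist _ (mem_of_mem_nhds hU) _ (htU htI)).trans (ENNReal.ofReal_le_ofReal ?_)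
  have hsub : w t - w s = (t - s) • slope w s t := (sub_smul_slope w s t).symm
  rw [hsub, sqrt_chartMetric_smul]
  nlinarith [ht ⟨htI, hts⟩, abs_nonneg (t - s)]

lemma continuousOn_curveSpeed {c : ℝ → S} {I : Set ℝ} (hc : ContMDiffOn 𝓘(ℝ, ℝ) 𝓘(ℝ, E) 1 c I)
    (hI : UniqueDiffOn ℝ I) : ContinuousOn (curveSpeed E c I) I := by
  intro s hs
  set x₀ := c s
  set w : ℝ → E := fun t => extChartAt 𝓘(ℝ, E) x₀ (c t)
  have hw : ∀ t ∈ I, c t ∈ (chartAt E x₀).source → ContDiffWithinAt ℝ 1 w I t := fun t ht hct =>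
    ((contMDiffAt_extChartAt' hct).comp_contMDiffWithinAt t (hc t ht)).contDiffWithinAt
  have hw_s := hw s hs (mem_chart_source E _)
  have hG : ContinuousAt (chartMetric x₀) (w s) :=
    continuousAt_chartMetric (mem_extChartAt_target _)
  have hcont : ContinuousWithinAt (fun t => √(chartMetric x₀ (w t) (derivWithin w I t)
      (derivWithin w I t))) I s := by
    have hderiv : ContinuousWithinAt (derivWithin w I) I s :=
      ((hw_s.fderivWithin_right hI (m := 0) (by simp) hs).clm_apply
        contDiffWithinAt_const).continuousWithinAt
    exact (((hG.comp_continuousWithinAt hw_s.continuousWithinAt).clm_apply hderiv).clm_apply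
      hderiv).sqrt
  have heq : ∀ t ∈ I, c t ∈ (chartAt E x₀).source →
      curveSpeed E c I t = √(chartMetric x₀ (w t) (derivWithin w I t) (derivWithin w I t)) :=
    fun t ht hct => curveSpeed_eq_sqrt_chartMetric (hc t ht).continuousWithinAt
      ((hw t ht hct).differentiableWithinAt one_ne_zero).hasDerivWithinAt (hI t ht)
      (by rwa [extChartAt_source])
  refine hcont.congr_of_eventuallyEq ?_ (heq s hs (mem_chart_source E _))
  filter_upwards [self_mem_nhdsWithin, (hc s hs).continuousWithinAt.eventually_mem
    (chart_source_mem_nhds E (c s))] with t using heq t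

lemma eventually_reachDist_le_of_curveSpeed_lt {c : ℝ → S} {I : Set ℝ} {s r : ℝ}
    (hc : ContMDiffWithinAt 𝓘(ℝ, ℝ) 𝓘(ℝ, E) 1 c I s) (hI : UniqueDiffWithinAt ℝ I s)
    (hr : curveSpeed E c I s < r) :
    ∀ᶠ t in 𝓝[I] s, reachDist E (c s) (c t) ≤ ENNReal.ofReal (r * |t - s|) := by
  have hsource := mem_extChartAt_source (I := 𝓘(ℝ, E)) (c s)
  have hw : HasDerivWithinAt (fun t => extChartAt 𝓘(ℝ, E) (c s) (c t)) _ I s :=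
    (((contMDiffAt_extChartAt (n := 1)).comp_contMDiffWithinAt s
      hc).contDiffWithinAt.differentiableWithinAt one_ne_zero).hasDerivWithinAt
  rw [curveSpeed_eq_sqrt_chartMetric hc.continuousWithinAt hw hI hsource] at hr
  filter_upwards [eventually_reachDist_extChartAt_symm_le hw (mem_extChartAt_target _) hr,
    hc.continuousWithinAt.eventually_mem (extChartAt_source_mem_nhds (I := 𝓘(ℝ, E)) (c s))]
    with t ht htsource
  rwa [(extChartAt 𝓘(ℝ, E) (c s)).left_inv hsource,
    (extChartAt 𝓘(ℝ, E) (c s)).left_inv htsource] at ht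

lemma reachDist_eq_riemannianEDist (p q : S) :
    reachDist E p q = riemannianEDist 𝓘(ℝ, E) p q := by
  let _ : PseudoEMetricSpace S :=
    { edist := reachDist E
      edist_self := reachDist_self
      edist_comm := reachDist_comm
      edist_triangle := reachDist_triangle }
  refine le_antisymm (le_of_forall_gt fun r hr => ?_) (riemannianEDist_le_reachDist p q)
  obtain ⟨c, rfl, rfl, hc, hlt⟩ := exists_lt_of_riemannianEDist_lt hr
  have hI : UniqueDiffOn ℝ (Icc (0 : ℝ) 1) := uniqueDiffOn_Icc one_pos
  have hcont := continuousOn_curveSpeed hc hI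
  calc reachDist E (c 0) (c 1)
      ≤ ENNReal.ofReal (∫ s in (0 : ℝ)..1, curveSpeed E c (Icc 0 1) s) :=
        edist_le_integral_of_eventually_le (c := c) zero_le_one hcont
          (fun s _ => curveSpeed_nonneg _ _ _) fun s hs r hr =>
            eventually_reachDist_le_of_curveSpeed_lt (hc s hs) (hI s hs) hr
    _ = pathELength 𝓘(ℝ, E) c 0 1 := by
        rw [pathELength_eq_lintegral_curveSpeed, intervalIntegral.integral_of_le zero_le_one,
          ← MeasureTheory.integral_Icc_eq_integral_Ioc,
          MeasureTheory.ofReal_integral_eq_lintegral_ofReal hcont.integrableOn_Icc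
            (Eventually.of_forall fun s => curveSpeed_nonneg _ _ _)]
    _ < r := hlt

end LocalEstimates

section LipschitzPrimitive

open MeasureTheory

variable {F : Type*} [NormedAddCommGroup F] [NormedSpace ℝ F] {u h k : ℝ → F} {a b : ℝ}

lemma lipschitzOnWith_integral_of_ae_norm_le {C : ℝ} (hab : a ≤ b)
    (hh : IntervalIntegrable h volume a b) (hC : ∀ᵐ s ∂volume.restrict (Ioc a b), ‖h s‖ ≤ C) :
    LipschitzOnWith C.toNNReal (fun s => ∫ t in a..s, h t) (Icc a b) := by
  refine LipschitzOnWith.of_dist_le_mul fun s hs s' hs' => ?_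
  have hint (x : ℝ) (hx : x ∈ Icc a b) : IntervalIntegrable h volume a x :=
    hh.mono_set (by rw [uIcc_of_le hab, uIcc_of_le hx.1]; exact Icc_subset_Icc_right hx.2)
  rw [dist_eq_norm, intervalIntegral.integral_interval_sub_left (hint s hs) (hint s' hs'),
    Real.dist_eq]
  refine (intervalIntegral.norm_integral_le_of_norm_le_const_ae (C := C) ?_).trans
    (mul_le_mul_of_nonneg_right (Real.le_coe_toNNReal C) (abs_nonneg _))
  filter_upwards [(ae_restrict_iff' measurableSet_Ioc).1 hC] with t ht hts
  exact ht ⟨(le_min hs'.1 hs.1).trans_lt hts.1, hts.2.trans (max_le hs'.2 hs.2)⟩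

lemma hasDerivWithinAt_integral_of_continuousOn [CompleteSpace F]
    (hk : ContinuousOn k (Icc a b)) {s : ℝ} (hs : s ∈ Icc a b) :
    HasDerivWithinAt (fun s => ∫ t in a..s, k t) (k s) (Icc a b) s := by
  have : Fact (s ∈ Icc a b) := ⟨hs⟩
  exact intervalIntegral.integral_hasDerivWithinAt_right
    ((hk.mono (Icc_subset_Icc_right hs.2)).intervalIntegrable_of_Icc hs.1)
    (hk.stronglyMeasurableAtFilter_nhdsWithin measurableSet_Icc s) (hk s hs)

lemma ae_restrict_Ioc_mem_Ioo : ∀ᵐ s ∂volume.restrict (Ioc a b), s ∈ Ioo a b := by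
  rw [← Measure.restrict_congr_set Ioo_ae_eq_Ioc]
  exact ae_restrict_mem measurableSet_Ioo

lemma ae_hasDerivAt_deriv_of_lipschitzOnWith [FiniteDimensional ℝ F] {K : NNReal}
    (hu : LipschitzOnWith K u (Icc a b)) :
    ∀ᵐ s ∂volume.restrict (Ioc a b), HasDerivAt u (deriv u s) s := by
  filter_upwards [ae_restrict_of_ae hu.ae_differentiableWithinAt_of_mem, ae_restrict_Ioc_mem_Ioo]
    with s hd hs
  exact ((hd (Ioo_subset_Icc_self hs)).differentiableAt (Icc_mem_nhds hs.1 hs.2)).hasDerivAt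

lemma ae_norm_deriv_le_of_lipschitzOnWith {K : NNReal} (hu : LipschitzOnWith K u (Icc a b)) :
    ∀ᵐ s ∂volume.restrict (Ioc a b), ‖deriv u s‖ ≤ K := by
  filter_upwards [ae_restrict_Ioc_mem_Ioo] with s hs
  exact norm_deriv_le_of_lipschitzOn (Icc_mem_nhds hs.1 hs.2) hu

lemma ae_hasDerivAt_integral [CompleteSpace F] (hab : a ≤ b)
    (hh : IntervalIntegrable h volume a b) :
    ∀ᵐ s ∂volume.restrict (Ioc a b), HasDerivAt (fun s => ∫ t in a..s, h t) (h s) s := by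
  filter_upwards [ae_restrict_of_ae hh.ae_hasDerivAt_integral, ae_restrict_mem measurableSet_Ioc]
    with s hd hs
  exact hd (by rw [uIcc_of_le hab]; exact Ioc_subset_Icc_self hs) a left_mem_uIcc

lemma hasDerivWithinAt_of_ae_deriv_eq [FiniteDimensional ℝ F] {K : NNReal}
    (hu : LipschitzOnWith K u (Icc a b)) (hk : ContinuousOn k (Icc a b))
    (huk : ∀ᵐ s ∂volume.restrict (Ioc a b), deriv u s = k s) {s : ℝ} (hs : s ∈ Icc a b) :
    HasDerivWithinAt u (k s) (Icc a b) s := by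
  have hab : a ≤ b := hs.1.trans hs.2
  have := FiniteDimensional.complete ℝ F
  have hki : IntervalIntegrable k volume a b := hk.intervalIntegrable_of_Icc hab
  obtain ⟨D, hD⟩ := isCompact_Icc.exists_bound_of_continuousOn hk
  have hlip := lipschitzOnWith_integral_of_ae_norm_le hab hki (ae_restrict_of_forall_mem
    measurableSet_Ioc fun s hs => hD s (Ioc_subset_Icc_self hs))
  rw [← uIcc_of_le hab] at hu hlip
  have hderiv : ∀ᵐ t, t ∈ uIcc a b → HasDerivAt (fun s => u s - ∫ t in a..s, k t) 0 t := by
    rw [uIcc_of_le hab, ← ae_restrict_iff' measurableSet_Icc,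
      ← Measure.restrict_congr_set Ioc_ae_eq_Icc]
    rw [uIcc_of_le hab] at hu
    filter_upwards [huk, ae_hasDerivAt_deriv_of_lipschitzOnWith hu, ae_hasDerivAt_integral hab hki]
      with t hut hu' hk'
    exact (hu'.sub hk').congr_deriv (by rw [hut, sub_self])
  obtain ⟨c, hc⟩ := (hu.absolutelyContinuousOnInterval.sub
    hlip.absolutelyContinuousOnInterval).const_of_ae_hasDerivAt_zero hderiv
  rw [uIcc_of_le hab] at hc
  exact ((hasDerivWithinAt_integral_of_continuousOn hk hs).const_add c).congr
    (fun t ht => by rw [← hc t ht]; simp) (by rw [← hc s hs]; simp)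

end LipschitzPrimitive

section DuBoisReymond

open MeasureTheory

lemma ae_eq_average_of_forall_integral_mul_eq_zero {α : Type*} [MeasurableSpace α]
    {μ : Measure α} [IsFiniteMeasure μ] {f : α → ℝ} (hf : MemLp f ∞ μ)
    (h : ∀ φ, MemLp φ ∞ μ → ∫ x, φ x ∂μ = 0 → ∫ x, f x * φ x ∂μ = 0) :
    ∀ᵐ x ∂μ, f x = ⨍ y, f y ∂μ := by
  set m := ⨍ y, f y ∂μ
  have hφ : MemLp (fun x => f x - m) ∞ μ := hf.sub (memLp_const m)
  have hfφ : Integrable (fun x => f x * (f x - m)) μ := (hφ.integrable le_top).mul_of_top_right hf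
  have hsq : ∫ x, (f x - m) * (f x - m) ∂μ = 0 := calc
    _ = ∫ x, (f x * (f x - m) - m * (f x - m)) ∂μ := by simp only [sub_mul]
    _ = 0 := by
      rw [integral_sub hfφ ((hφ.integrable le_top).const_mul m), integral_const_mul,
        integral_sub_average, h _ hφ (integral_sub_average μ f), mul_zero, sub_zero]
  rw [integral_eq_zero_iff_of_nonneg (fun x => mul_self_nonneg _)
    ((hφ.integrable le_top).mul_of_top_right hφ)] at hsq
  filter_upwards [hsq] with x hx using sub_eq_zero.1 (mul_self_eq_zero.1 hx)

lemma integral_mul_integral_eq_sub {p φ : ℝ → ℝ} {a b : ℝ} (hab : a ≤ b)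
    (hp : IntervalIntegrable p volume a b) (hφ : IntervalIntegrable φ volume a b) :
    ∫ s in a..b, p s * ∫ t in a..s, φ t =
      (∫ s in a..b, p s) * (∫ s in a..b, φ s) - ∫ s in a..b, (∫ t in a..s, p t) * φ s := by
  have key := (hp.absolutelyContinuousOnInterval_intervalIntegral left_mem_uIcc)
    |>.integral_mul_deriv_eq_deriv_mul
      (hφ.absolutelyContinuousOnInterval_intervalIntegral left_mem_uIcc)
  simp only [intervalIntegral.integral_same, zero_mul, sub_zero] at key
  have hleft : ∫ s in a..b, deriv (fun s => ∫ t in a..s, p t) s * ∫ t in a..s, φ t =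
      ∫ s in a..b, p s * ∫ t in a..s, φ t := by
    refine intervalIntegral.integral_congr_ae_restrict ?_
    rw [uIoc_of_le hab]
    filter_upwards [ae_hasDerivAt_integral hab hp] with s hs using by rw [hs.deriv]
  have hright : ∫ s in a..b, (∫ t in a..s, p t) * deriv (fun s => ∫ t in a..s, φ t) s =
      ∫ s in a..b, (∫ t in a..s, p t) * φ s := by
    refine intervalIntegral.integral_congr_ae_restrict ?_
    rw [uIoc_of_le hab]
    filter_upwards [ae_hasDerivAt_integral hab hφ] with s hs using by rw [hs.deriv]
  rw [hleft, hright] at key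
  rw [key, sub_sub_cancel]

/-- The fundamental lemma of du Bois-Reymond, with the test function written as the primitive of
`φ` so that no derivative occurs. -/
lemma ae_sub_integral_eq_average {p q : ℝ → ℝ} {a b : ℝ} (hab : a ≤ b)
    (hp : IntervalIntegrable p volume a b) (hq : MemLp q ∞ (volume.restrict (Ioc a b)))
    (h : ∀ φ, MemLp φ ∞ (volume.restrict (Ioc a b)) → ∫ s in a..b, φ s = 0 →
      ∫ s in a..b, (p s * (∫ t in a..s, φ t) + q s * φ s) = 0) :
    ∀ᵐ s ∂volume.restrict (Ioc a b), q s - ∫ t in a..s, p t =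
      ⨍ s in Ioc a b, (q s - ∫ t in a..s, p t) := by
  have hQc : ContinuousOn (fun s => ∫ t in a..s, p t) (Icc a b) := by
    simpa only [uIcc_of_le hab] using intervalIntegral.continuousOn_primitive_interval' hp
      left_mem_uIcc
  have hQ : MemLp (fun s => ∫ t in a..s, p t) ∞ (volume.restrict (Ioc a b)) := by
    obtain ⟨D, hD⟩ := isCompact_Icc.exists_bound_of_continuousOn hQc
    exact memLp_top_of_bound ((hQc.mono Ioc_subset_Icc_self).aestronglyMeasurable
      measurableSet_Ioc) D (ae_restrict_of_forall_mem measurableSet_Ioc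
        fun s hs => hD s (Ioc_subset_Icc_self hs))
  refine ae_eq_average_of_forall_integral_mul_eq_zero (hq.sub hQ) fun φ hφ hφ0 => ?_
  have hφi : IntegrableOn φ (Ioc a b) := hφ.integrable le_top
  have hqφ : IntegrableOn (fun s => q s * φ s) (Ioc a b) := hφi.mul_of_top_right hq
  have hQφ : IntegrableOn (fun s => (∫ t in a..s, p t) * φ s) (Ioc a b) := hφi.mul_of_top_right hQ
  rw [← intervalIntegral.integral_of_le hab] at hφ0
  rw [← intervalIntegrable_iff_integrableOn_Ioc_of_le hab] at hφi hqφ hQφ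
  have hpψ : IntervalIntegrable (fun s => p s * ∫ t in a..s, φ t) volume a b :=
    hp.mul_continuousOn (intervalIntegral.continuousOn_primitive_interval' hφi left_mem_uIcc)
  have hzero := h φ hφ hφ0
  rw [intervalIntegral.integral_add hpψ hqφ, integral_mul_integral_eq_sub hab hp hφi, hφ0,
    mul_zero, zero_sub, neg_add_eq_zero] at hzero
  simp only [sub_mul]
  rw [← intervalIntegral.integral_of_le hab, intervalIntegral.integral_sub hqφ hQφ, hzero, sub_self]

end DuBoisReymond

section FirstVariation

open MeasureTheory

lemma aestronglyMeasurable_comp_of_continuousOn {α Z Y : Type*} [MeasurableSpace α]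
    {μ : Measure α} [TopologicalSpace Z] [TopologicalSpace.PseudoMetrizableSpace Z]
    [SecondCountableTopology Z] [TopologicalSpace Y] [TopologicalSpace.PseudoMetrizableSpace Y]
    {L : Z → Y} {Ω : Set Z} {z : α → Z} (hΩ : IsOpen Ω) (hL : ContinuousOn L Ω)
    (hz : AEStronglyMeasurable z μ) (hzΩ : ∀ᵐ x ∂μ, z x ∈ Ω) :
    AEStronglyMeasurable (fun x => L (z x)) μ := by
  borelize Z
  have hmap : (μ.map z).restrict Ω = μ.map z := Measure.restrict_eq_self_of_ae_mem
    ((ae_map_iff hz.aemeasurable hΩ.measurableSet).2 hzΩ)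
  exact (hmap ▸ hL.aestronglyMeasurable hΩ.measurableSet).comp_aemeasurable hz.aemeasurable

variable {Z : Type*} [NormedAddCommGroup Z] [NormedSpace ℝ Z] [FiniteDimensional ℝ Z]
  {L : Z → ℝ} {Ω C : Set Z}

lemma memLp_top_comp_of_isCompact {α Y : Type*} [MeasurableSpace α] {μ : Measure α}
    [NormedAddCommGroup Y] {L : Z → Y} {z : α → Z} (hΩ : IsOpen Ω) (hL : ContinuousOn L Ω)
    (hC : IsCompact C) (hCΩ : C ⊆ Ω) (hz : AEStronglyMeasurable z μ) (hzC : ∀ᵐ x ∂μ, z x ∈ C) :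
    MemLp (fun x => L (z x)) ∞ μ := by
  obtain ⟨D, hD⟩ := hC.exists_bound_of_continuousOn (hL.mono hCΩ)
  exact memLp_top_of_bound (aestronglyMeasurable_comp_of_continuousOn hΩ hL hz
    (hzC.mono fun x hx => hCΩ hx)) D (hzC.mono fun x hx => hD _ hx)

lemma hasDerivAt_integral_comp_add_smul {α : Type*} [MeasurableSpace α] {μ : Measure α}
    [IsFiniteMeasure μ] {z ζ : α → Z} (hΩ : IsOpen Ω) (hL : ContDiffOn ℝ 1 L Ω)
    (hC : IsCompact C) (hCΩ : C ⊆ Ω) (hz : AEStronglyMeasurable z μ)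
    (hzC : ∀ᵐ x ∂μ, z x ∈ C) (hζ : MemLp ζ ∞ μ) :
    HasDerivAt (fun ε : ℝ => ∫ x, L (z x + ε • ζ x) ∂μ) (∫ x, fderiv ℝ L (z x) (ζ x) ∂μ) 0 := by
  have hdL : ContinuousOn (fderiv ℝ L) Ω :=
    (hL.fderiv_of_isOpen (m := 0) hΩ (by simp)).continuousOn
  obtain ⟨δ, hδ, hδΩ⟩ := hC.exists_cthickening_subset_open hΩ hCΩ
  obtain ⟨D, hD⟩ := hC.cthickening (r := δ).exists_bound_of_continuousOn (hdL.mono hδΩ)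
  set R := lpNorm ζ ∞ μ
  have hζR : ∀ᵐ x ∂μ, ‖ζ x‖ ≤ R := ae_le_lpNorm_exponent_top hζ
  have hball : {ε : ℝ | |ε| * R < δ} ∈ 𝓝 (0 : ℝ) :=
    (isOpen_lt (by fun_prop) continuous_const).mem_nhds (by simpa using hδ)
  have hmem : ∀ᵐ x ∂μ, ∀ ε ∈ {ε : ℝ | |ε| * R < δ}, z x + ε • ζ x ∈ Metric.cthickening δ C := by
    filter_upwards [hzC, hζR] with x hzx hζx ε hε
    refine Metric.mem_cthickening_of_dist_le _ (z x) _ _ hzx ?_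
    rw [dist_eq_norm, add_sub_cancel_left, norm_smul, Real.norm_eq_abs]
    exact (mul_le_mul_of_nonneg_left hζx (abs_nonneg ε)).trans (le_of_lt hε)
  have main := (hasDerivAt_integral_of_dominated_loc_of_deriv_le (μ := μ) (x₀ := 0)
    (F := fun (ε : ℝ) x => L (z x + ε • ζ x)) (bound := fun _ => D * R)
    (F' := fun (ε : ℝ) x => fderiv ℝ L (z x + ε • ζ x) (ζ x)) hball ?_ ?_ ?_ ?_
    (integrable_const _) ?_).2
  · simpa only [zero_smul, add_zero] using main
  · filter_upwards [hball] with ε hε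
    exact aestronglyMeasurable_comp_of_continuousOn hΩ hL.continuousOn
      (hz.add (hζ.aestronglyMeasurable.const_smul ε)) (hmem.mono fun x hx => hδΩ (hx ε hε))
  · simpa only [zero_smul, add_zero] using
      (memLp_top_comp_of_isCompact hΩ hL.continuousOn hC hCΩ hz hzC).integrable le_top
  · simp only [zero_smul, add_zero]
    exact isBoundedBilinearMap_apply.continuous.comp_aestronglyMeasurable
      ((memLp_top_comp_of_isCompact hΩ hdL hC hCΩ hz hzC).aestronglyMeasurable.prodMk
        hζ.aestronglyMeasurable)
  · filter_upwards [hmem, hζR] with x hx hζx ε hε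
    exact (ContinuousLinearMap.le_opNorm _ _).trans (mul_le_mul (hD _ (hx ε hε)) hζx
      (norm_nonneg _) ((norm_nonneg _).trans (hD _ (hx ε hε))))
  · filter_upwards [hmem] with x hx ε hε
    have hline : HasDerivAt (fun ε : ℝ => z x + ε • ζ x) (ζ x) ε := by
      simpa using ((hasDerivAt_id ε).smul_const (ζ x)).const_add (z x)
    exact ((hL.differentiableOn one_ne_zero).differentiableAt
      (hΩ.mem_nhds (hδΩ (hx ε hε)))).hasFDerivAt.comp_hasDerivAt ε hline

end FirstVariation

section EulerLagrange

open MeasureTheory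

variable {F : Type*} [NormedAddCommGroup F] [NormedSpace ℝ F] [FiniteDimensional ℝ F]
  {L : F × F → ℝ} {a b : ℝ} {u : ℝ → F}

/-- The action of the curve `u` on `[a, b]` for the Lagrangian `L`, a function of position and
velocity. -/
noncomputable def action (L : F × F → ℝ) (a b : ℝ) (u : ℝ → F) : ℝ :=
  ∫ s in a..b, L (u s, deriv u s)

/-- Lipschitz curves whose action does not decrease under small Lipschitz variations with fixed
endpoints. -/
def IsActionMin (L : F × F → ℝ) (a b : ℝ) (u : ℝ → F) : Prop :=
  ∀ (η : ℝ → F) (K : NNReal), LipschitzOnWith K η (Icc a b) → η a = 0 → η b = 0 →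
    ∀ᶠ ε : ℝ in 𝓝 0, action L a b u ≤ action L a b (fun s => u s + ε • η s)

lemma exists_ae_eq_add_integral_dual {p q : ℝ → F →L[ℝ] ℝ} (hab : a ≤ b)
    (hp : IntervalIntegrable p volume a b) (hq : MemLp q ∞ (volume.restrict (Ioc a b)))
    (h : ∀ (e : F) (φ : ℝ → ℝ), MemLp φ ∞ (volume.restrict (Ioc a b)) → ∫ s in a..b, φ s = 0 →
      ∫ s in a..b, (p s ((∫ t in a..s, φ t) • e) + q s (φ s • e)) = 0) :
    ∃ m : F →L[ℝ] ℝ, ∀ᵐ s ∂volume.restrict (Ioc a b), q s = m + ∫ t in a..s, p t := by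
  let B := Module.finBasis ℝ F
  have happ (e : F) : MemLp (fun s => q s e) ∞ (volume.restrict (Ioc a b)) :=
    (ContinuousLinearMap.apply ℝ ℝ e).comp_memLp' hq
  have hpapp (e : F) : IntervalIntegrable (fun s => p s e) volume a b :=
    ⟨hp.1.apply_continuousLinearMap e, hp.2.apply_continuousLinearMap e⟩
  have hcoord (i) := ae_sub_integral_eq_average hab (hpapp (B i)) (happ (B i))
    fun φ hφ hφ0 => by simpa only [map_smul, smul_eq_mul, mul_comm] using h (B i) φ hφ hφ0
  let m := B.constr ℝ fun i => ⨍ s in Ioc a b, (q s (B i) - ∫ t in a..s, p t (B i))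
  refine ⟨LinearMap.toContinuousLinearMap m, ?_⟩
  filter_upwards [ae_all_iff.2 hcoord, ae_restrict_mem measurableSet_Ioc] with s hs hsI
  have hps : IntervalIntegrable p volume a s := hp.mono_set (by
    rw [uIcc_of_le hab, uIcc_of_le hsI.1.le]; exact Icc_subset_Icc_right hsI.2)
  refine ContinuousLinearMap.coe_injective (B.ext fun i => ?_)
  have hmi : m (B i) = q s (B i) - ∫ t in a..s, p t (B i) :=
    (B.constr_basis ℝ _ i).trans (hs i).symm
  simp only [ContinuousLinearMap.coe_coe, add_apply,
    LinearMap.coe_toContinuousLinearMap', ContinuousLinearMap.intervalIntegral_apply hps, hmi,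
    sub_add_cancel]

lemma aestronglyMeasurable_prodMk_deriv {K : NNReal} (hu : LipschitzOnWith K u (Icc a b)) :
    AEStronglyMeasurable (fun s => (u s, deriv u s)) (volume.restrict (Ioc a b)) :=
  ((hu.continuousOn.mono Ioc_subset_Icc_self).aestronglyMeasurable measurableSet_Ioc).prodMk
    (stronglyMeasurable_deriv u).aestronglyMeasurable

/-- The Euler–Lagrange equation in weak form. -/
lemma integral_fderiv_apply_eq_zero {K K' : NNReal} {Ω C : Set (F × F)} {η : ℝ → F}
    (hab : a ≤ b) (hΩ : IsOpen Ω) (hL : ContDiffOn ℝ 1 L Ω) (hC : IsCompact C) (hCΩ : C ⊆ Ω)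
    (hu : LipschitzOnWith K u (Icc a b))
    (huC : ∀ᵐ s ∂volume.restrict (Ioc a b), (u s, deriv u s) ∈ C) (hmin : IsActionMin L a b u)
    (hη : LipschitzOnWith K' η (Icc a b)) (hηa : η a = 0) (hηb : η b = 0) :
    ∫ s in a..b, fderiv ℝ L (u s, deriv u s) (η s, deriv η s) = 0 := by
  have hζ : MemLp (fun s => (η s, deriv η s)) ∞ (volume.restrict (Ioc a b)) := by
    obtain ⟨D, hD⟩ := isCompact_Icc.exists_bound_of_continuousOn hη.continuousOn
    refine memLp_top_of_bound (aestronglyMeasurable_prodMk_deriv hη) (max D K') ?_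
    filter_upwards [ae_norm_deriv_le_of_lipschitzOnWith hη, ae_restrict_mem measurableSet_Ioc]
      with s hs hsI
    exact max_le_max (hD s (Ioc_subset_Icc_self hsI)) hs
  have hvar := hasDerivAt_integral_comp_add_smul hΩ hL hC hCΩ
    (aestronglyMeasurable_prodMk_deriv hu) huC hζ
  have haction (ε : ℝ) : action L a b (fun s => u s + ε • η s) =
      ∫ s in Ioc a b, L ((u s, deriv u s) + ε • (η s, deriv η s)) := by
    rw [action, intervalIntegral.integral_of_le hab]
    refine integral_congr_ae ?_
    filter_upwards [ae_hasDerivAt_deriv_of_lipschitzOnWith hu,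
      ae_hasDerivAt_deriv_of_lipschitzOnWith hη] with s hus hηs
    rw [show deriv (fun s => u s + ε • η s) s = _ from (hus.add (hηs.const_smul ε)).deriv]
    rfl
  rw [intervalIntegral.integral_of_le hab]
  refine IsLocalMin.hasDerivAt_eq_zero ?_ hvar
  filter_upwards [hmin η K' hη hηa hηb] with ε hε
  rw [← haction, ← haction]
  simpa only [zero_smul, add_zero] using hε

/-- The Euler–Lagrange equation, integrated once. -/
theorem exists_ae_fderiv_comp_inr_eq_add_integral {K : NNReal} {Ω C : Set (F × F)}
    (hab : a ≤ b) (hΩ : IsOpen Ω) (hL : ContDiffOn ℝ 1 L Ω) (hC : IsCompact C) (hCΩ : C ⊆ Ω)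
    (hu : LipschitzOnWith K u (Icc a b))
    (huC : ∀ᵐ s ∂volume.restrict (Ioc a b), (u s, deriv u s) ∈ C) (hmin : IsActionMin L a b u) :
    ∃ m : F →L[ℝ] ℝ, ∀ᵐ s ∂volume.restrict (Ioc a b),
      fderiv ℝ L (u s, deriv u s) ∘L .inr ℝ F F =
        m + ∫ t in a..s, fderiv ℝ L (u t, deriv u t) ∘L .inl ℝ F F := by
  have hdL : ContinuousOn (fderiv ℝ L) Ω :=
    (hL.fderiv_of_isOpen (m := 0) hΩ (by simp)).continuousOn
  have hmem : MemLp (fun s => fderiv ℝ L (u s, deriv u s)) ∞ (volume.restrict (Ioc a b)) :=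
    memLp_top_comp_of_isCompact hΩ hdL hC hCΩ (aestronglyMeasurable_prodMk_deriv hu) huC
  have hcomp (j : F →L[ℝ] F × F) := ((ContinuousLinearMap.compL ℝ F (F × F) ℝ).flip j).comp_memLp'
    hmem
  refine exists_ae_eq_add_integral_dual hab ((intervalIntegrable_iff_integrableOn_Ioc_of_le hab).2
    ((hcomp (.inl ℝ F F)).integrable le_top)) (hcomp (.inr ℝ F F)) fun e φ hφ hφ0 => ?_
  have hφi : IntervalIntegrable φ volume a b :=
    (intervalIntegrable_iff_integrableOn_Ioc_of_le hab).2 (hφ.integrable le_top)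
  have hψ := lipschitzOnWith_integral_of_ae_norm_le hab hφi (ae_le_lpNorm_exponent_top hφ)
  have hη := ((ContinuousLinearMap.toSpanSingleton ℝ e).lipschitz.comp_lipschitzOnWith hψ)
  change LipschitzOnWith _ (fun s => (∫ t in a..s, φ t) • e) _ at hη
  have hzero := integral_fderiv_apply_eq_zero hab hΩ hL hC hCΩ hu huC hmin hη (by simp)
    (by simp [hφ0])
  rw [← hzero]
  refine intervalIntegral.integral_congr_ae_restrict ?_
  rw [uIoc_of_le hab]
  filter_upwards [ae_hasDerivAt_integral hab hφi] with s hs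
  rw [(hs.smul_const e).deriv]
  exact (fderiv ℝ L (u s, deriv u s)).comp_inl_add_comp_inr (_, _)

end EulerLagrange

section MinimizerRegularity

open MeasureTheory

lemma fderiv_quadratic_comp_inr {F : Type*} [NormedAddCommGroup F] [NormedSpace ℝ F]
    {G : F → F →L[ℝ] F →L[ℝ] ℝ} {y v : F}
    (hL : DifferentiableAt ℝ (fun z : F × F => G z.1 z.2 z.2) (y, v))
    (hsymm : ∀ w w', G y w w' = G y w' w) :
    fderiv ℝ (fun z : F × F => G z.1 z.2 z.2) (y, v) ∘L .inr ℝ F F = (2 : ℝ) • G y v := by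
  have hpartial : HasFDerivAt (fun w => G y w w)
      (fderiv ℝ (fun z : F × F => G z.1 z.2 z.2) (y, v) ∘L .inr ℝ F F) v :=
    hL.hasFDerivAt.comp v (hasFDerivAt_prodMk_right y v)
  rw [hpartial.unique ((G y).hasFDerivAt.clm_apply (hasFDerivAt_id v))]
  ext w
  simp [hsymm w v, two_mul]

variable {F : Type*} [NormedAddCommGroup F] [NormedSpace ℝ F] [FiniteDimensional ℝ F]
  {a b : ℝ} {u : ℝ → F} {K : NNReal} {Ω : Set F}

lemma exists_isCompact_ae_mem_prod (hu : LipschitzOnWith K u (Icc a b))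
    (huΩ : MapsTo u (Icc a b) Ω) :
    ∃ C ⊆ Ω ×ˢ univ, IsCompact C ∧
      ∀ᵐ s ∂volume.restrict (Ioc a b), (u s, deriv u s) ∈ C := by
  refine ⟨(u '' Icc a b) ×ˢ Metric.closedBall (0 : F) K,
    prod_mono (image_subset_iff.2 huΩ) (subset_univ _),
    (isCompact_Icc.image_of_continuousOn hu.continuousOn).prod (isCompact_closedBall _ _), ?_⟩
  filter_upwards [ae_norm_deriv_le_of_lipschitzOnWith hu, ae_restrict_mem measurableSet_Ioc]
    with s hs hsI
  exact ⟨mem_image_of_mem u (Ioc_subset_Icc_self hsI), mem_closedBall_zero_iff.2 hs⟩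

lemma intervalIntegrable_comp_prodMk_deriv {Y : Type*} [NormedAddCommGroup Y] {f : F × F → Y}
    (hab : a ≤ b) (hΩ : IsOpen Ω) (hf : ContinuousOn f (Ω ×ˢ univ))
    (hu : LipschitzOnWith K u (Icc a b)) (huΩ : MapsTo u (Icc a b) Ω) :
    IntervalIntegrable (fun s => f (u s, deriv u s)) volume a b := by
  obtain ⟨C, hCΩ, hC, huC⟩ := exists_isCompact_ae_mem_prod hu huΩ
  exact (intervalIntegrable_iff_integrableOn_Ioc_of_le hab).2
    ((memLp_top_comp_of_isCompact (hΩ.prod isOpen_univ) hf hC hCΩ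
      (aestronglyMeasurable_prodMk_deriv hu) huC).integrable le_top)

lemma continuousOn_integral_comp_prodMk_deriv {Y : Type*} [NormedAddCommGroup Y] [NormedSpace ℝ Y]
    {f : F × F → Y} (hab : a ≤ b) (hΩ : IsOpen Ω) (hf : ContinuousOn f (Ω ×ˢ univ))
    (hu : LipschitzOnWith K u (Icc a b)) (huΩ : MapsTo u (Icc a b) Ω) :
    ContinuousOn (fun s => ∫ t in a..s, f (u t, deriv u t)) (Icc a b) := by
  simpa only [uIcc_of_le hab] using intervalIntegral.continuousOn_primitive_interval'
    (intervalIntegrable_comp_prodMk_deriv hab hΩ hf hu huΩ) left_mem_uIcc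

/-- Let `ν` recover the velocity from position and momentum. The momentum of a minimiser is
continuous, hence so is the velocity, and the minimiser is a classical solution of Hamilton's
equations with smooth coefficients. -/
theorem contDiffOn_of_isActionMin {L : F × F → ℝ} {ν : F × (F →L[ℝ] ℝ) → F} (hab : a ≤ b)
    (hΩ : IsOpen Ω) (hL : ContDiffOn ℝ ∞ L (Ω ×ˢ univ)) (hν : ContDiffOn ℝ ∞ ν (Ω ×ˢ univ))
    (hLν : ∀ y ∈ Ω, ∀ v, ν (y, fderiv ℝ L (y, v) ∘L .inr ℝ F F) = v)
    (hu : LipschitzOnWith K u (Icc a b)) (huΩ : MapsTo u (Icc a b) Ω)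
    (hmin : IsActionMin L a b u) : ContDiffOn ℝ ∞ u (Icc a b) := by
  have hΩ' : IsOpen (Ω ×ˢ (univ : Set F)) := hΩ.prod isOpen_univ
  set f : F × F → F →L[ℝ] ℝ := fun z => fderiv ℝ L z ∘L .inl ℝ F F
  have hf : ContDiffOn ℝ ∞ f (Ω ×ˢ univ) :=
    (hL.fderiv_of_isOpen hΩ' (by simp)).clm_comp contDiffOn_const
  obtain ⟨C, hCΩ, hC, huC⟩ := exists_isCompact_ae_mem_prod hu huΩ
  obtain ⟨m, hm⟩ := exists_ae_fderiv_comp_inr_eq_add_integral hab hΩ' (hL.of_le (by simp)) hC hCΩ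
    hu huC hmin
  set p : ℝ → F →L[ℝ] ℝ := fun s => m + ∫ t in a..s, f (u t, deriv u t)
  set k : ℝ → F := fun s => ν (u s, p s)
  have huk : ∀ᵐ s ∂volume.restrict (Ioc a b), deriv u s = k s := by
    filter_upwards [hm, ae_restrict_mem measurableSet_Ioc] with s hs hsI
    exact (hLν _ (huΩ (Ioc_subset_Icc_self hsI)) _).symm.trans (by rw [hs])
  have hp : ContinuousOn p (Icc a b) := continuousOn_const.add
    (continuousOn_integral_comp_prodMk_deriv hab hΩ hf.continuousOn hu huΩ)
  have hk : ContinuousOn k (Icc a b) :=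
    hν.continuousOn.comp (hu.continuousOn.prodMk hp) fun s hs => ⟨huΩ hs, mem_univ _⟩
  have hfk : ContinuousOn (fun t => f (u t, k t)) (Icc a b) :=
    hf.continuousOn.comp (hu.continuousOn.prodMk hk) fun s hs => ⟨huΩ hs, mem_univ _⟩
  have hpk (s : ℝ) (hs : s ∈ Icc a b) : p s = m + ∫ t in a..s, f (u t, k t) := by
    refine congrArg (m + ·) (intervalIntegral.integral_congr_ae_restrict ?_)
    rw [uIoc_of_le hs.1]
    filter_upwards [ae_mono (Measure.restrict_mono (Ioc_subset_Ioc_right hs.2) le_rfl) huk]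
      with t ht using by rw [ht]
  have hode (s : ℝ) (hs : s ∈ Icc a b) : HasDerivWithinAt (fun s => (u s, p s))
      (k s, f (u s, k s)) (Icc a b) s :=
    (hasDerivWithinAt_of_ae_deriv_eq hu hk huk hs).prodMk
      (((hasDerivWithinAt_integral_of_continuousOn hfk hs).const_add m).congr hpk (hpk s hs))
  have hfield : ContDiffOn ℝ ∞ (fun z => (ν z, f (z.1, ν z))) (Ω ×ˢ univ) :=
    hν.prodMk (hf.comp (contDiff_fst.contDiffOn.prodMk hν) fun z hz => ⟨hz.1, mem_univ _⟩)
  exact contDiff_fst.comp_contDiffOn (ODE.contDiffOn_enat_Icc_of_hasDerivWithinAt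
    (f := fun _ z => (ν z, f (z.1, ν z)))
    (hfield.comp contDiff_snd.contDiffOn fun z hz => hz.2) hode
    fun s hs => ⟨huΩ hs, mem_univ _⟩)

lemma isInvertible_of_forall_pos {B : F →L[ℝ] F →L[ℝ] ℝ} (hB : ∀ v ≠ 0, 0 < B v v) :
    B.IsInvertible := by
  have hinj : Function.Injective (B : F →ₗ[ℝ] F →L[ℝ] ℝ) :=
    (injective_iff_map_eq_zero _).2 fun v hv => by
      by_contra h
      exact (hB v h).ne' (DFunLike.congr_fun hv v)
  have hrank : Module.finrank ℝ F = Module.finrank ℝ (F →L[ℝ] ℝ) :=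
    Subspace.dual_finrank_eq.symm.trans (LinearMap.toContinuousLinearMap (𝕜 := ℝ)).finrank_eq
  exact ⟨(LinearMap.linearEquivOfInjective _ hinj hrank).toContinuousLinearEquiv, rfl⟩

theorem contDiffOn_of_isActionMin_quadratic {G : F → F →L[ℝ] F →L[ℝ] ℝ} (hab : a ≤ b)
    (hΩ : IsOpen Ω) (hG : ContDiffOn ℝ ∞ G Ω) (hsymm : ∀ y v w, G y v w = G y w v)
    (hpos : ∀ y ∈ Ω, ∀ v ≠ 0, 0 < G y v v) (hu : LipschitzOnWith K u (Icc a b))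
    (huΩ : MapsTo u (Icc a b) Ω) (hmin : IsActionMin (fun z => G z.1 z.2 z.2) a b u) :
    ContDiffOn ℝ ∞ u (Icc a b) := by
  have hL : ContDiffOn ℝ ∞ (fun z : F × F => G z.1 z.2 z.2) (Ω ×ˢ univ) :=
    ((hG.comp contDiff_fst.contDiffOn fun z hz => hz.1).clm_apply
      contDiff_snd.contDiffOn).clm_apply contDiff_snd.contDiffOn
  have hinv : ContDiffOn ℝ ∞ (fun y => (G y).inverse) Ω := fun y hy =>
    (isInvertible_of_forall_pos (hpos y hy)).contDiffAt_map_inverse.comp_contDiffWithinAt y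
      (hG y hy)
  have hν : ContDiffOn ℝ ∞ (fun z : F × (F →L[ℝ] ℝ) => (G z.1).inverse ((1 / 2 : ℝ) • z.2))
      (Ω ×ˢ univ) :=
    (hinv.comp contDiff_fst.contDiffOn fun z hz => hz.1).clm_apply
      (contDiff_snd.const_smul _).contDiffOn
  refine contDiffOn_of_isActionMin hab hΩ hL hν (fun y hy v => ?_) hu huΩ hmin
  have hLd : DifferentiableAt ℝ (fun z : F × F => G z.1 z.2 z.2) (y, v) :=
    (hL.differentiableOn (by simp)).differentiableAt
      ((hΩ.prod isOpen_univ).mem_nhds ⟨hy, mem_univ v⟩)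
  dsimp only
  rw [fderiv_quadratic_comp_inr hLd (hsymm y), smul_smul, one_div, inv_mul_cancel₀ two_ne_zero,
    one_smul, (isInvertible_of_forall_pos (hpos y hy)).inverse_apply_self]

end MinimizerRegularity

lemma sq_apply_le_of_forall_nonneg {E : Type*} [NormedAddCommGroup E] [NormedSpace ℝ E]
    {B : E →L[ℝ] E →L[ℝ] ℝ} (hsymm : ∀ v w, B v w = B w v) (hB : ∀ v, 0 ≤ B v v) (v w : E) :
    B v w ^ 2 ≤ B v v * B w w :=
  LinearMap.BilinForm.apply_sq_le_of_symm
    ((ContinuousLinearMap.coeLM ℝ).comp (B : E →ₗ[ℝ] E →L[ℝ] ℝ)) hB ⟨hsymm⟩ v w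

lemma sqrt_apply_sub_le_of_deriv_le {E : Type*} [NormedAddCommGroup E] [NormedSpace ℝ E]
    {B : E →L[ℝ] E →L[ℝ] ℝ} (hsymm : ∀ v w, B v w = B w v) (hB : ∀ v, 0 ≤ B v v)
    {w w' : ℝ → E} {a b C : ℝ} (hab : a ≤ b) (hw : ∀ t ∈ Icc a b, HasDerivAt w (w' t) t)
    (hC : ∀ t ∈ Icc a b, √(B (w' t) (w' t)) ≤ C) :
    √(B (w b - w a) (w b - w a)) ≤ C * (b - a) := by
  have hC₀ : 0 ≤ C := (Real.sqrt_nonneg _).trans (hC a (left_mem_Icc.2 hab))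
  set v := w b - w a
  have hderiv (t : ℝ) (ht : t ∈ Icc a b) : HasDerivAt (fun t => B v (w t)) (B v (w' t)) t :=
    (B v).hasFDerivAt.comp_hasDerivAt t (hw t ht)
  have hbound (t : ℝ) (ht : t ∈ Icc a b) : B v (w' t) ≤ √(B v v) * C := calc
    _ ≤ √(B v v * B (w' t) (w' t)) :=
      Real.le_sqrt_of_sq_le (sq_apply_le_of_forall_nonneg hsymm hB _ _)
    _ = √(B v v) * √(B (w' t) (w' t)) := Real.sqrt_mul (hB v) _
    _ ≤ √(B v v) * C := mul_le_mul_of_nonneg_left (hC t ht) (Real.sqrt_nonneg _)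
  have hmvt : B v (w b) - B v (w a) ≤ √(B v v) * C * (b - a) :=
    (convex_Icc a b).image_sub_le_mul_sub_of_deriv_le
      (fun t ht => (hderiv t ht).continuousAt.continuousWithinAt)
      (fun t ht => (hderiv t (interior_subset ht)).differentiableAt.differentiableWithinAt)
      (fun t ht => (hderiv t (interior_subset ht)).deriv ▸ hbound t (interior_subset ht))
      a (left_mem_Icc.2 hab) b (right_mem_Icc.2 hab) hab
  rw [← map_sub, mul_assoc] at hmvt
  rcases (Real.sqrt_nonneg (B v v)).eq_or_lt with h₀ | h₀
  · rw [← h₀]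
    exact mul_nonneg hC₀ (sub_nonneg.2 hab)
  · exact le_of_mul_le_mul_left ((Real.mul_self_sqrt (hB v)).trans_le hmvt) h₀

section ChartComparison

variable {E : Type*} [NormedAddCommGroup E] [NormedSpace ℝ E]
  {S : Type*} [TopologicalSpace S] [ChartedSpace E S] [IsManifold 𝓘(ℝ, E) ∞ S]
  [RiemannianBundle (fun x : S => TangentSpace 𝓘(ℝ, E) x)]

lemma sqrt_chartMetric_sub_le_of_curve {p₀ : S} {c : ℝ → S} {T C : ℝ} (hT : 0 ≤ T)
    (hc : ContMDiff 𝓘(ℝ, ℝ) 𝓘(ℝ, E) ∞ c) (hspeed : ∀ t, curveSpeed E c univ t ≤ 1) (hC₀ : 0 ≤ C)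
    (hsource : ∀ t ∈ Icc 0 T, c t ∈ (extChartAt 𝓘(ℝ, E) p₀).source)
    (hC : ∀ t ∈ Icc 0 T, ∀ v, √(chartMetric p₀ (extChartAt 𝓘(ℝ, E) p₀ p₀) v v) ≤
      C * √(chartMetric p₀ (extChartAt 𝓘(ℝ, E) p₀ (c t)) v v)) :
    √(chartMetric p₀ (extChartAt 𝓘(ℝ, E) p₀ p₀)
      (extChartAt 𝓘(ℝ, E) p₀ (c T) - extChartAt 𝓘(ℝ, E) p₀ (c 0))
      (extChartAt 𝓘(ℝ, E) p₀ (c T) - extChartAt 𝓘(ℝ, E) p₀ (c 0))) ≤ C * T := by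
  have hderiv (t : ℝ) (ht : t ∈ Icc 0 T) :
      HasDerivAt (fun t => extChartAt 𝓘(ℝ, E) p₀ (c t)) _ t :=
    (((contMDiffAt_extChartAt' (n := 1) (by simpa only [extChartAt_source] using hsource t ht)).comp
      t (hc.contMDiffAt.of_le (by simp))).contDiffAt.differentiableAt one_ne_zero).hasDerivAt
  have h := sqrt_apply_sub_le_of_deriv_le (C := C) (chartMetric_symm p₀ (extChartAt 𝓘(ℝ, E) p₀ p₀))
    (chartMetric_nonneg p₀ _) hT hderiv fun t ht => (hC t ht _).trans ?_
  · rwa [sub_zero] at h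
  · rw [← curveSpeed_eq_sqrt_chartMetric hc.continuous.continuousWithinAt
      (hderiv t ht).hasDerivWithinAt uniqueDiffWithinAt_univ (hsource t ht)]
    exact mul_le_of_le_one_right hC₀ (hspeed t)

variable [FiniteDimensional ℝ E]
  [IsContMDiffRiemannianBundle 𝓘(ℝ, E) ∞ E (fun x : S => TangentSpace 𝓘(ℝ, E) x)]

lemma eventually_sqrt_chartMetric_le (p₀ : S) {C : ℝ} (hC : 1 < C) :
    ∀ᶠ p in 𝓝 p₀, ∀ v, √(chartMetric p₀ (extChartAt 𝓘(ℝ, E) p₀ p₀) v v) ≤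
      C * √(chartMetric p₀ (extChartAt 𝓘(ℝ, E) p₀ p) v v) := by
  have hy₀ := mem_extChartAt_target (I := 𝓘(ℝ, E)) p₀
  have hG := eventually_forall_le_mul_of_continuousAt (continuousAt_chartMetric hy₀)
    (fun v hv => chartMetric_pos hy₀ hv) (one_lt_pow₀ hC two_ne_zero)
  filter_upwards [(continuousAt_extChartAt (I := 𝓘(ℝ, E)) p₀).eventually hG] with p hp v
  calc _ ≤ √(C ^ 2 * chartMetric p₀ (extChartAt 𝓘(ℝ, E) p₀ p) v v) :=
        Real.sqrt_le_sqrt (hp v).2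
    _ = _ := by rw [Real.sqrt_mul (sq_nonneg C), Real.sqrt_sq (zero_le_one.trans hC.le)]

lemma continuousOn_chartMetric_quadratic (x₀ : S) :
    ContinuousOn (fun z : E × E => chartMetric x₀ z.1 z.2 z.2)
      ((extChartAt 𝓘(ℝ, E) x₀).target ×ˢ univ) :=
  (((contDiffOn_chartMetric x₀).continuousOn.comp continuousOn_fst fun _ hz => hz.1).clm_apply
    continuousOn_snd).clm_apply continuousOn_snd

end ChartComparison

section RiemannianDistance

variable {E : Type*} [NormedAddCommGroup E] [NormedSpace ℝ E]
  {S : Type*} [PseudoEMetricSpace S] [ChartedSpace E S]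
  [RiemannianBundle (fun x : S => TangentSpace 𝓘(ℝ, E) x)] [IsRiemannianManifold 𝓘(ℝ, E) S]

lemma edist_le_of_curveSpeed_le_one {c : ℝ → S} {a b : ℝ} (hc : ContMDiff 𝓘(ℝ, ℝ) 𝓘(ℝ, E) 1 c)
    (hab : a ≤ b) (hspeed : ∀ s ∈ Icc a b, curveSpeed E c univ s ≤ 1) :
    edist (c a) (c b) ≤ ENNReal.ofReal (b - a) := by
  rw [IsRiemannianManifold.out (I := 𝓘(ℝ, E)) (c a) (c b)]
  exact riemannianEDist_le_of_curveSpeed_le_one hc hab hspeed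

variable [FiniteDimensional ℝ E] [IsManifold 𝓘(ℝ, E) ∞ S]
  [IsContMDiffRiemannianBundle 𝓘(ℝ, E) ∞ E (fun x : S => TangentSpace 𝓘(ℝ, E) x)]

lemma reachDist_eq_edist (p q : S) : reachDist E p q = edist p q := by
  rw [reachDist_eq_riemannianEDist, IsRiemannianManifold.out (I := 𝓘(ℝ, E)) p q]

lemma smoothReach_of_edist_lt {p q : S} {T : ℝ} (h : edist p q < ENNReal.ofReal T) :
    SmoothReach E p q T :=
  smoothReach_of_reachDist_lt (reachDist_eq_edist (E := E) p q ▸ h)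

/-- A nearly shortest curve between two points close to `p₀` stays in the chart, where its
coordinate expression is nearly `1`-Lipschitz. -/
lemma exists_nhds_sqrt_chartMetric_le (p₀ : S) {C : ℝ} (hC : 1 < C) :
    ∃ W ∈ 𝓝 p₀, ∀ p ∈ W, ∀ q ∈ W, √(chartMetric p₀ (extChartAt 𝓘(ℝ, E) p₀ p₀)
      (extChartAt 𝓘(ℝ, E) p₀ q - extChartAt 𝓘(ℝ, E) p₀ p)
      (extChartAt 𝓘(ℝ, E) p₀ q - extChartAt 𝓘(ℝ, E) p₀ p)) ≤ C * (edist p q).toReal := by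
  obtain ⟨r, hr, hball⟩ := EMetric.mem_nhds_iff.1 (inter_mem
    (extChartAt_source_mem_nhds (I := 𝓘(ℝ, E)) p₀) (eventually_sqrt_chartMetric_le (E := E) p₀ hC))
  obtain ⟨R, hR₀, hR, hRr⟩ := ENNReal.lt_iff_exists_real_btwn.1 hr
  obtain ⟨ρ, rfl⟩ : ∃ ρ, R = 3 * ρ := ⟨R / 3, by ring⟩
  have hρ : 0 < ρ := by linarith [ENNReal.ofReal_pos.1 hR]
  refine ⟨Metric.eball p₀ (ENNReal.ofReal ρ), Metric.eball_mem_nhds p₀ (ENNReal.ofReal_pos.2 hρ),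
    fun p hp q hq => ?_⟩
  have hpq : edist p q < ENNReal.ofReal (2 * ρ) := calc
    _ ≤ edist p p₀ + edist q p₀ := edist_triangle_right p q p₀
    _ < ENNReal.ofReal ρ + ENNReal.ofReal ρ := ENNReal.add_lt_add hp hq
    _ = _ := by rw [← ENNReal.ofReal_add hρ.le hρ.le, two_mul]
  have hstay {c : ℝ → S} {T t : ℝ} (hc : ContMDiff 𝓘(ℝ, ℝ) 𝓘(ℝ, E) ∞ c)
      (hspeed : ∀ t, curveSpeed E c univ t ≤ 1) (hcp : c 0 = p) (hT : T < 2 * ρ)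
      (ht : t ∈ Icc 0 T) : c t ∈ Metric.eball p₀ r := by
    have hcT : edist (c 0) (c t) ≤ ENNReal.ofReal (t - 0) :=
      edist_le_of_curveSpeed_le_one (hc.of_le (by simp)) ht.1 fun s _ => hspeed s
    calc edist (c t) p₀ ≤ edist (c 0) (c t) + edist (c 0) p₀ := edist_triangle_left _ _ _
      _ ≤ ENNReal.ofReal (2 * ρ) + ENNReal.ofReal ρ := by
        gcongr
        · exact hcT.trans (ENNReal.ofReal_le_ofReal (by linarith [ht.2]))
        · exact hcp ▸ hp.le
      _ = ENNReal.ofReal (3 * ρ) := by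
        rw [← ENNReal.ofReal_add (by positivity) hρ.le]
        ring_nf
      _ < r := hRr
  have hlim : Tendsto (fun T => C * T) (𝓝[>] (edist p q).toReal) (𝓝 (C * (edist p q).toReal)) :=
    (tendsto_const_nhds.mul tendsto_id).mono_left nhdsWithin_le_nhds
  have hd : (edist p q).toReal < 2 * ρ := (ENNReal.lt_ofReal_iff_toReal_lt hpq.ne_top).1 hpq
  refine ge_of_tendsto hlim ?_
  filter_upwards [Ioo_mem_nhdsGT hd] with T hT
  obtain ⟨c, hc, hc₀, ⟨T', hT', hcT'⟩, hspeed⟩ :=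
    smoothReach_of_edist_lt (E := E) ((ENNReal.lt_ofReal_iff_toReal_lt hpq.ne_top).2 hT.1)
  have h := sqrt_chartMetric_sub_le_of_curve (p₀ := p₀) (hT'.1.trans hT'.2).le hc hspeed
    (zero_le_one.trans hC.le) (fun t ht => (hball (hstay hc hspeed (hc₀ 0 le_rfl) hT.2 ht)).1)
    fun t ht => (hball (hstay hc hspeed (hc₀ 0 le_rfl) hT.2 ht)).2
  rwa [hc₀ 0 le_rfl, hcT' T hT'.2.le] at h

end RiemannianDistance

lemma exists_forall_sqrt_apply_le {E : Type*} [NormedAddCommGroup E] [NormedSpace ℝ E]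
    (B : E →L[ℝ] E →L[ℝ] ℝ) : ∃ A ≥ 0, ∀ v, √(B v v) ≤ A * ‖v‖ := by
  obtain ⟨A, hA, hle⟩ := B.isBoundedBilinearMap.bound
  refine ⟨√A, Real.sqrt_nonneg _, fun v => ?_⟩
  rw [← Real.sqrt_sq (norm_nonneg v), ← Real.sqrt_mul hA.le, sq, ← mul_assoc]
  exact Real.sqrt_le_sqrt ((le_abs_self _).trans (hle v v))

lemma eventually_mapsTo_add_smul {X E : Type*} [TopologicalSpace X] [NormedAddCommGroup E]
    [NormedSpace ℝ E] {u η : X → E} {C : Set X} {Ω : Set E} (hC : IsCompact C)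
    (hu : ContinuousOn u C) (hη : ContinuousOn η C) (hΩ : IsOpen Ω) (huΩ : MapsTo u C Ω) :
    ∀ᶠ ε : ℝ in 𝓝 0, MapsTo (fun s => u s + ε • η s) C Ω := by
  have hmem : ∀ᶠ ε : ℝ in 𝓝 0, ∀ z ∈ (fun s => (u s, η s)) '' C, z.1 + ε • z.2 ∈ Ω := by
    refine (hC.image_of_continuousOn (hu.prodMk hη)).eventually_forall_of_forall_eventually ?_
    rintro _ ⟨s, hs, rfl⟩
    have hcont : Continuous fun z : ℝ × E × E => z.2.1 + z.1 • z.2.2 := by fun_prop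
    exact hcont.continuousAt.eventually_mem (hΩ.mem_nhds (by simpa using huΩ hs))
  exact hmem.mono fun ε hε s hs => hε _ (mem_image_of_mem _ hs)

section IsometricCurves

open MeasureTheory

variable {E : Type*} [NormedAddCommGroup E] [NormedSpace ℝ E] [FiniteDimensional ℝ E]
  {S : Type*} [PseudoEMetricSpace S] [ChartedSpace E S] [IsManifold 𝓘(ℝ, E) ∞ S]
  [RiemannianBundle (fun x : S => TangentSpace 𝓘(ℝ, E) x)]
  [IsContMDiffRiemannianBundle 𝓘(ℝ, E) ∞ E (fun x : S => TangentSpace 𝓘(ℝ, E) x)]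
  [IsRiemannianManifold 𝓘(ℝ, E) S] {γ : ℝ → S} {a b : ℝ}

lemma curveSpeed_le_of_lipschitzOnWith {I : Set ℝ} {K : NNReal} {s : ℝ}
    (hγ : LipschitzOnWith K γ I) (hs : s ∈ I) (hI : UniqueDiffWithinAt ℝ I s)
    (hd : MDifferentiableWithinAt 𝓘(ℝ, ℝ) 𝓘(ℝ, E) γ I s) : curveSpeed E γ I s ≤ K := by
  have hderiv : HasDerivWithinAt (fun t => extChartAt 𝓘(ℝ, E) (γ s) (γ t)) _ I s :=
    (mdifferentiableWithinAt_iff_differentiableWithinAt.1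
      ((mdifferentiableAt_extChartAt (mem_chart_source E _)).comp_mdifferentiableWithinAt
        s hd)).hasDerivWithinAt
  rw [curveSpeed_eq_sqrt_chartMetric hd.continuousWithinAt hderiv hI (mem_extChartAt_source _)]
  have : (𝓝[I \ {s}] s).NeBot := accPt_principal_iff_nhdsWithin.1 hI.accPt
  have hlim : Tendsto (fun C : ℝ => C * K) (𝓝[>] 1) (𝓝 K) :=
    (Continuous.tendsto' (f := fun C : ℝ => C * K) (by fun_prop) 1 _ (one_mul _)).mono_left
      nhdsWithin_le_nhds
  refine ge_of_tendsto hlim ?_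
  filter_upwards [self_mem_nhdsWithin] with C hC
  obtain ⟨W, hW, hWC⟩ := exists_nhds_sqrt_chartMetric_le (E := E) (γ s) hC
  have hcont : Continuous fun v =>
      √(chartMetric (γ s) (extChartAt 𝓘(ℝ, E) (γ s) (γ s)) v v) := by fun_prop
  refine le_of_tendsto ((hcont.tendsto _).comp (hasDerivWithinAt_iff_tendsto_slope.1 hderiv)) ?_
  filter_upwards [nhdsWithin_mono s sdiff_subset (hd.continuousWithinAt.preimage_mem_nhdsWithin hW),
    self_mem_nhdsWithin] with t ht htI
  have hdist : (edist (γ s) (γ t)).toReal ≤ K * |t - s| := by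
    refine ENNReal.toReal_le_of_le_ofReal (by positivity) ((hγ hs htI.1).trans_eq ?_)
    rw [ENNReal.ofReal_mul K.coe_nonneg, ENNReal.ofReal_coe_nnreal, edist_dist, dist_comm,
      Real.dist_eq]
  simp only [Function.comp_apply, slope_def_module, sqrt_chartMetric_smul, abs_inv]
  rw [inv_mul_le_iff₀ (abs_pos.2 (sub_ne_zero.2 htI.2))]
  calc _ ≤ C * (edist (γ s) (γ t)).toReal := hWC _ (mem_of_mem_nhds hW) _ ht
    _ ≤ C * (K * |t - s|) := mul_le_mul_of_nonneg_left hdist (zero_le_one.trans hC.le)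
    _ = |t - s| * (C * K) := by ring

lemma exists_lipschitzOnWith_extChartAt (p₀ : S) :
    ∃ K : NNReal, ∃ W ∈ 𝓝 p₀, LipschitzOnWith K (extChartAt 𝓘(ℝ, E) p₀) W := by
  obtain ⟨m, hm, hmv⟩ := exists_forall_mul_sq_norm_le_of_pos
    (chartMetric p₀ (extChartAt 𝓘(ℝ, E) p₀ p₀))
    fun v hv => chartMetric_pos (mem_extChartAt_target p₀) hv
  obtain ⟨W, hW, hWd⟩ := exists_nhds_sqrt_chartMetric_le (E := E) p₀ one_lt_two
  refine ⟨(2 / √m).toNNReal, W, hW, fun p hp q hq => ?_⟩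
  have hnorm : ‖extChartAt 𝓘(ℝ, E) p₀ q - extChartAt 𝓘(ℝ, E) p₀ p‖ ≤
      2 / √m * (edist p q).toReal := by
    have h := (Real.sqrt_le_sqrt (hmv _)).trans (hWd p hp q hq)
    rwa [Real.sqrt_mul hm.le, Real.sqrt_sq (norm_nonneg _), mul_comm,
      ← le_div_iff₀ (Real.sqrt_pos.2 hm), ← div_mul_eq_mul_div] at h
  rw [edist_dist, dist_comm, dist_eq_norm]
  calc _ ≤ ENNReal.ofReal (2 / √m * (edist p q).toReal) := ENNReal.ofReal_le_ofReal hnorm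
    _ = ENNReal.ofReal (2 / √m) * ENNReal.ofReal (edist p q).toReal :=
      ENNReal.ofReal_mul (by positivity)
    _ ≤ _ := mul_le_mul_right ENNReal.ofReal_toReal_le _

lemma exists_lipschitzOnWith_extChartAt_symm {x₀ : S} {y₀ : E}
    (hy₀ : y₀ ∈ (extChartAt 𝓘(ℝ, E) x₀).target) :
    ∃ K : NNReal, ∃ U ∈ 𝓝 y₀, LipschitzOnWith K (extChartAt 𝓘(ℝ, E) x₀).symm U := by
  obtain ⟨U, hU, hUd⟩ := exists_nhds_forall_reachDist_le hy₀ one_lt_two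
  obtain ⟨A, hA, hle⟩ := exists_forall_sqrt_apply_le (chartMetric x₀ y₀)
  refine ⟨(2 * A).toNNReal, U, hU, fun y hy y' hy' => ?_⟩
  calc edist ((extChartAt 𝓘(ℝ, E) x₀).symm y) ((extChartAt 𝓘(ℝ, E) x₀).symm y')
      ≤ ENNReal.ofReal (2 * √(chartMetric x₀ y₀ (y' - y) (y' - y))) :=
        (reachDist_eq_edist (E := E) _ _).symm.trans_le (hUd y hy y' hy')
    _ ≤ ENNReal.ofReal (2 * A * ‖y' - y‖) :=
        ENNReal.ofReal_le_ofReal (by nlinarith [hle (y' - y)])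
    _ = _ := by
        rw [ENNReal.ofReal_mul (by positivity), edist_dist, dist_comm, dist_eq_norm]
        rfl

section Action

variable {x₀ : S} {U : Set E} {w : ℝ → E} {K K' : NNReal}

/-- The length of a curve is bounded by its energy, through `v ≤ (v² + 1) / 2`. -/
lemma edist_extChartAt_symm_le_action (hab : a ≤ b) (hU : IsOpen U)
    (hUt : U ⊆ (extChartAt 𝓘(ℝ, E) x₀).target)
    (hsymm : LipschitzOnWith K' (extChartAt 𝓘(ℝ, E) x₀).symm U)
    (hw : LipschitzOnWith K w (Icc a b)) (hwU : MapsTo w (Icc a b) U) :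
    edist ((extChartAt 𝓘(ℝ, E) x₀).symm (w a)) ((extChartAt 𝓘(ℝ, E) x₀).symm (w b)) ≤
      ENNReal.ofReal ((action (fun z => chartMetric x₀ z.1 z.2 z.2) a b w + (b - a)) / 2) := by
  set e : ℝ → ℝ := fun s => chartMetric x₀ (w s) (deriv w s) (deriv w s)
  have he₀ (s : ℝ) : 0 ≤ e s := chartMetric_nonneg _ _ _
  have heint : IntervalIntegrable e volume a b := intervalIntegrable_comp_prodMk_deriv hab hU
    ((continuousOn_chartMetric_quadratic x₀).mono (prod_mono hUt le_rfl)) hw hwU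
  have hlength := edist_le_lintegral_of_ae_eventually_le hab (hsymm.comp hw hwU)
    (v := fun s => √(e s)) (fun s => Real.sqrt_nonneg _) ?_
  · calc _ ≤ ∫⁻ s in Ioo a b, ENNReal.ofReal √(e s) := hlength
      _ ≤ ∫⁻ s in Ioo a b, ENNReal.ofReal ((e s + 1) / 2) :=
        lintegral_mono fun s => ENNReal.ofReal_le_ofReal
          (by nlinarith [Real.sq_sqrt (he₀ s), sq_nonneg (√(e s) - 1)])
      _ = ENNReal.ofReal (∫ s in a..b, (e s + 1) / 2) := by
        rw [intervalIntegral.integral_of_le hab, Measure.restrict_congr_set Ioo_ae_eq_Ioc,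
          ofReal_integral_eq_lintegral_ofReal
          ((heint.add intervalIntegrable_const).div_const 2).1
          (Eventually.of_forall fun s => by have := he₀ s; positivity)]
      _ = _ := by
        rw [intervalIntegral.integral_div, intervalIntegral.integral_add heint
          intervalIntegrable_const, intervalIntegral.integral_const, smul_eq_mul, mul_one, action]
  · filter_upwards [(ae_restrict_iff' measurableSet_Ioc).1
      (ae_hasDerivAt_deriv_of_lipschitzOnWith hw)] with s hs hsI r hr
    have hreach := eventually_reachDist_extChartAt_symm_le (I := univ)
      (hs (Ioo_subset_Ioc_self hsI)).hasDerivWithinAt (hUt (hwU (Ioo_subset_Icc_self hsI))) hr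
    simpa only [nhdsWithin_univ, reachDist_eq_edist, Function.comp_apply] using hreach

lemma action_extChartAt_comp_le (hab : a ≤ b) (hγ : LipschitzOnWith 1 γ (Icc a b))
    (hsource : MapsTo γ (Icc a b) (extChartAt 𝓘(ℝ, E) x₀).source)
    (hw : LipschitzOnWith K (fun s => extChartAt 𝓘(ℝ, E) x₀ (γ s)) (Icc a b)) :
    action (fun z => chartMetric x₀ z.1 z.2 z.2) a b (fun s => extChartAt 𝓘(ℝ, E) x₀ (γ s)) ≤
      b - a := by
  rw [← mul_one (b - a), ← smul_eq_mul, ← intervalIntegral.integral_const, action]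
  refine intervalIntegral.integral_mono_ae_restrict hab ?_ intervalIntegrable_const ?_
  · exact intervalIntegrable_comp_prodMk_deriv hab (isOpen_extChartAt_target x₀)
      (continuousOn_chartMetric_quadratic x₀) hw
      fun s hs => (extChartAt 𝓘(ℝ, E) x₀).map_source (hsource hs)
  rw [Measure.restrict_congr_set Ioc_ae_eq_Icc.symm]
  filter_upwards [ae_hasDerivAt_deriv_of_lipschitzOnWith hw, ae_restrict_Ioc_mem_Ioo] with s hs hsI
  have hI : Icc a b ∈ 𝓝 s := Icc_mem_nhds hsI.1 hsI.2
  have hsI' := Ioo_subset_Icc_self hsI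
  have hd : MDifferentiableWithinAt 𝓘(ℝ, ℝ) 𝓘(ℝ, E) γ (Icc a b) s := by
    have hsymm := (contMDiffOn_extChartAt_symm (I := 𝓘(ℝ, E)) (n := ∞) x₀).contMDiffAt
      ((isOpen_extChartAt_target x₀).mem_nhds ((extChartAt 𝓘(ℝ, E) x₀).map_source (hsource hsI')))
    refine ((hsymm.mdifferentiableAt (by simp)).comp_mdifferentiableWithinAt s
      hs.differentiableAt.mdifferentiableAt.mdifferentiableWithinAt).congr (fun t ht => ?_) ?_
    · exact ((extChartAt 𝓘(ℝ, E) x₀).left_inv (hsource ht)).symm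
    · exact ((extChartAt 𝓘(ℝ, E) x₀).left_inv (hsource hsI')).symm
  have hunique : UniqueDiffWithinAt ℝ (Icc a b) s := uniqueDiffWithinAt_of_mem_nhds hI
  have hspeed := curveSpeed_le_of_lipschitzOnWith hγ hsI' hunique hd
  rwa [curveSpeed_eq_sqrt_chartMetric hd.continuousWithinAt hs.hasDerivWithinAt hunique
    (hsource hsI'), NNReal.coe_one, Real.sqrt_le_one] at hspeed

lemma isActionMin_extChartAt_comp (hab : a ≤ b) (hU : IsOpen U)
    (hUt : U ⊆ (extChartAt 𝓘(ℝ, E) x₀).target)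
    (hsymm : LipschitzOnWith K' (extChartAt 𝓘(ℝ, E) x₀).symm U)
    (hγ : ∀ s ∈ Icc a b, ∀ s' ∈ Icc a b, edist (γ s) (γ s') = edist s s')
    (hsource : MapsTo γ (Icc a b) (extChartAt 𝓘(ℝ, E) x₀).source)
    (hγU : MapsTo (fun s => extChartAt 𝓘(ℝ, E) x₀ (γ s)) (Icc a b) U)
    (hw : LipschitzOnWith K (fun s => extChartAt 𝓘(ℝ, E) x₀ (γ s)) (Icc a b)) :
    IsActionMin (fun z => chartMetric x₀ z.1 z.2 z.2) a b
      (fun s => extChartAt 𝓘(ℝ, E) x₀ (γ s)) := by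
  intro η Kη hη hηa hηb
  filter_upwards [eventually_mapsTo_add_smul isCompact_Icc hw.continuousOn hη.continuousOn hU hγU]
    with ε hε
  have hlip : LipschitzOnWith (K + ‖ε‖₊ * Kη)
      (fun s => extChartAt 𝓘(ℝ, E) x₀ (γ s) + ε • η s) (Icc a b) :=
    hw.add ((lipschitzWith_smul ε).comp_lipschitzOnWith hη)
  have hlength := edist_extChartAt_symm_le_action hab hU hUt hsymm hlip hε
  have ha := left_mem_Icc.2 hab
  have hb := right_mem_Icc.2 hab
  simp only [hηa, hηb, smul_zero, add_zero, (extChartAt 𝓘(ℝ, E) x₀).left_inv (hsource ha),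
    (extChartAt 𝓘(ℝ, E) x₀).left_inv (hsource hb)] at hlength
  have haction : 0 ≤ action (fun z => chartMetric x₀ z.1 z.2 z.2) a b
      fun s => extChartAt 𝓘(ℝ, E) x₀ (γ s) + ε • η s :=
    intervalIntegral.integral_nonneg hab fun s _ => chartMetric_nonneg _ _ _
  rw [hγ a ha b hb, edist_dist, dist_comm, Real.dist_eq, abs_of_nonneg (sub_nonneg.2 hab),
    ENNReal.ofReal_le_ofReal_iff (by linarith)] at hlength
  have hγlip : LipschitzOnWith 1 γ (Icc a b) := fun s hs s' hs' => by
    simpa only [ENNReal.coe_one, one_mul] using (hγ s hs s' hs').le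
  linarith [action_extChartAt_comp_le hab hγlip hsource hw]

end Action

lemma contMDiffOn_of_edist_eq_of_mapsTo (hab : a ≤ b) {x₀ : S} {U : Set E} {W : Set S}
    {K K' : NNReal} (hU : IsOpen U) (hUt : U ⊆ (extChartAt 𝓘(ℝ, E) x₀).target)
    (hsymm : LipschitzOnWith K' (extChartAt 𝓘(ℝ, E) x₀).symm U)
    (hchart : LipschitzOnWith K (extChartAt 𝓘(ℝ, E) x₀) W)
    (hγ : ∀ s ∈ Icc a b, ∀ s' ∈ Icc a b, edist (γ s) (γ s') = edist s s')
    (hsource : MapsTo γ (Icc a b) (extChartAt 𝓘(ℝ, E) x₀).source)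
    (hγU : MapsTo (fun s => extChartAt 𝓘(ℝ, E) x₀ (γ s)) (Icc a b) U)
    (hγW : MapsTo γ (Icc a b) W) : ContMDiffOn 𝓘(ℝ, ℝ) 𝓘(ℝ, E) ∞ γ (Icc a b) := by
  have hγlip : LipschitzOnWith 1 γ (Icc a b) := fun s hs s' hs' => by
    simpa only [ENNReal.coe_one, one_mul] using (hγ s hs s' hs').le
  have hw := hchart.comp hγlip hγW
  have hsmooth := contDiffOn_of_isActionMin_quadratic hab hU
    ((contDiffOn_chartMetric x₀).mono hUt) (chartMetric_symm x₀)
    (fun y hy v hv => chartMetric_pos (hUt hy) hv) hw hγU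
    (isActionMin_extChartAt_comp hab hU hUt hsymm hγ hsource hγU hw)
  exact ((contMDiffOn_extChartAt_symm x₀).comp hsmooth.contMDiffOn fun s hs => hUt (hγU hs)).congr
    fun s hs => ((extChartAt 𝓘(ℝ, E) x₀).left_inv (hsource hs)).symm

theorem contMDiffOn_of_edist_eq
    (hγ : ∀ s ∈ Icc a b, ∀ s' ∈ Icc a b, edist (γ s) (γ s') = edist s s') :
    ContMDiffOn 𝓘(ℝ, ℝ) 𝓘(ℝ, E) ∞ γ (Icc a b) := by
  intro s₀ hs₀
  have hcont : ContinuousOn γ (Icc a b) := LipschitzOnWith.continuousOn (K := 1)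
    fun s hs s' hs' => by simpa only [ENNReal.coe_one, one_mul] using (hγ s hs s' hs').le
  obtain ⟨K, W, hW, hchart⟩ := exists_lipschitzOnWith_extChartAt (E := E) (γ s₀)
  obtain ⟨K', U, hU, hsymm⟩ := exists_lipschitzOnWith_extChartAt_symm
    (mem_extChartAt_target (I := 𝓘(ℝ, E)) (γ s₀))
  obtain ⟨U', hU'U, hU'o, hγU'⟩ := mem_nhds_iff.1
    (inter_mem hU (extChartAt_target_mem_nhds (I := 𝓘(ℝ, E)) (γ s₀)))
  have hN : W ∩ ((extChartAt 𝓘(ℝ, E) (γ s₀)).source ∩ extChartAt 𝓘(ℝ, E) (γ s₀) ⁻¹' U') ∈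
      𝓝 (γ s₀) := inter_mem hW (inter_mem (extChartAt_source_mem_nhds _)
    ((continuousAt_extChartAt _).preimage_mem_nhds (hU'o.mem_nhds hγU')))
  obtain ⟨N, hNs, hNγ⟩ := mem_nhdsWithin_iff_exists_mem_nhds_inter.1 (hcont s₀ hs₀ hN)
  obtain ⟨c, d, hs₀cd, hcd, hcdN⟩ := exists_Icc_mem_subset_of_mem_nhds hNs
  have hsub : Icc (max c a) (min d b) ⊆ Icc a b ∩ N := by
    rw [← Icc_inter_Icc, inter_comm]
    exact inter_subset_inter_right _ hcdN
  have hs₀' : s₀ ∈ Icc (max c a) (min d b) := Icc_inter_Icc (a₁ := c) ▸ ⟨hs₀cd, hs₀⟩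
  have hmem (s) (hs : s ∈ Icc (max c a) (min d b)) := hNγ ⟨(hsub hs).2, (hsub hs).1⟩
  have hsmooth := contMDiffOn_of_edist_eq_of_mapsTo (hs₀'.1.trans hs₀'.2) hU'o
    (hU'U.trans inter_subset_right) (hsymm.mono (hU'U.trans inter_subset_left)) hchart
    (fun s hs s' hs' => hγ s (hsub hs).1 s' (hsub hs').1) (fun s hs => (hmem s hs).2.1)
    (fun s hs => (hmem s hs).2.2) (fun s hs => (hmem s hs).1)
  refine (hsmooth s₀ hs₀').mono_of_mem_nhdsWithin ?_
  rw [← Icc_inter_Icc]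
  exact inter_mem (mem_nhdsWithin_of_mem_nhds hcd) self_mem_nhdsWithin

end IsometricCurves

section ShortCurves

open Metric

/-- Points at distance less than `T` are joined by a `1`-Lipschitz curve of duration `T`; this holds
in every length space. -/
def HasShortCurves (X : Type*) [PseudoEMetricSpace X] : Prop :=
  ∀ ⦃p q : X⦄ ⦃T : ℝ⦄, edist p q < ENNReal.ofReal T →
    ∃ c : ℝ → X, LipschitzWith 1 c ∧ c 0 = p ∧ c T = q

section Lipschitz

variable {X : Type*} [PseudoEMetricSpace X] {K : Set X}

lemma edist_le_ofReal_of_abs_sub_le {c : ℝ → X} (hc : LipschitzWith 1 c) {s s' δ : ℝ}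
    (h : |s - s'| ≤ δ) : edist (c s) (c s') ≤ ENNReal.ofReal δ := by
  refine (hc s s').trans ?_
  rw [ENNReal.coe_one, one_mul, edist_dist, Real.dist_eq]
  exact ENNReal.ofReal_le_ofReal h

lemma mem_cthickening_of_lipschitzWith_one {c : ℝ → X} (hc : LipschitzWith 1 c) (h₀ : c 0 ∈ K)
    {s : ℝ} (hs : 0 ≤ s) : c s ∈ cthickening s K :=
  mem_cthickening_of_edist_le _ _ _ _ h₀
    (edist_le_ofReal_of_abs_sub_le hc (by rw [sub_zero, abs_of_nonneg hs]))

lemma edist_eq_of_forall_ofReal_le {γ : ℝ → X} {I : Set ℝ} (hI : ∀ s ∈ I, 0 ≤ s) (h₀ : 0 ∈ I)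
    (hγ : LipschitzOnWith 1 γ I) (hmin : ∀ s ∈ I, ENNReal.ofReal s ≤ edist (γ 0) (γ s)) :
    ∀ s ∈ I, ∀ s' ∈ I, edist (γ s) (γ s') = edist s s' := by
  have hlip {s s' : ℝ} (hs : s ∈ I) (hs' : s' ∈ I) : edist (γ s) (γ s') ≤ edist s s' := by
    simpa only [ENNReal.coe_one, one_mul] using hγ hs hs'
  intro s hs s' hs'
  wlog hss : s ≤ s' generalizing s s'
  · rw [edist_comm, this s' hs' s hs (le_of_not_ge hss), edist_comm]
  refine (hlip hs hs').antisymm ?_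
  have hs₀ : edist 0 s = ENNReal.ofReal s := by
    rw [edist_dist, dist_comm, Real.dist_0_eq_abs, abs_of_nonneg (hI s hs)]
  calc edist s s' = ENNReal.ofReal s' - ENNReal.ofReal s := by
        rw [← ENNReal.ofReal_sub _ (hI s hs), edist_dist, dist_comm, Real.dist_eq,
          abs_of_nonneg (sub_nonneg.2 hss)]
    _ ≤ edist (γ s) (γ s') := tsub_le_iff_left.2 <|
        calc ENNReal.ofReal s' ≤ edist (γ 0) (γ s') := hmin s' hs'
          _ ≤ edist (γ 0) (γ s) + edist (γ s) (γ s') := edist_triangle _ _ _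
          _ ≤ ENNReal.ofReal s + edist (γ s) (γ s') := by grw [hlip h₀ hs, hs₀]

lemma exists_tendsto_of_forall_lipschitzOnWith {ι α : Type*} [PseudoEMetricSpace α]
    {F : Ultrafilter ι} {c : ι → α → X} {L : NNReal} {I : Set α}
    (hc : ∀ i, LipschitzOnWith L (c i) I) {C : α → Set X} (hC : ∀ s ∈ I, IsCompact (C s))
    (hmem : ∀ i, ∀ s ∈ I, c i s ∈ C s) :
    ∃ γ : α → X, (∀ s ∈ I, γ s ∈ C s ∧ Tendsto (fun i => c i s) F (𝓝 (γ s))) ∧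
      LipschitzOnWith L γ I := by
  have hlim (s : α) : ∃ x, s ∈ I → x ∈ C s ∧ Tendsto (fun i => c i s) F (𝓝 x) := by
    by_cases hs : s ∈ I
    · obtain ⟨x, hx, hle⟩ := (hC s hs).ultrafilter_le_nhds (F.map fun i => c i s)
        (le_principal_iff.2 (show ∀ᶠ i in F, c i s ∈ C s from .of_forall fun i => hmem i s hs))
      exact ⟨x, fun _ => ⟨hx, hle⟩⟩
    · obtain ⟨i, -⟩ := F.neBot.nonempty_of_mem univ_mem
      exact ⟨c i s, fun h => absurd h hs⟩
  choose γ hγ using hlim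
  exact ⟨γ, hγ, fun s hs s' hs' => le_of_tendsto ((hγ s hs).2.edist (hγ s' hs').2)
    (Eventually.of_forall fun i => hc i hs hs')⟩

lemma totallyBounded_of_forall_subset_cthickening {A : Set X}
    (h : ∀ δ > 0, ∃ B, TotallyBounded B ∧ A ⊆ cthickening δ B) : TotallyBounded A := by
  refine EMetric.totallyBounded_iff.2 fun ε hε => ?_
  obtain ⟨ρ, -, hρ₀, hρ⟩ := ENNReal.lt_iff_exists_real_btwn.1 hε
  have hρ₀ : 0 < ρ := ENNReal.ofReal_pos.1 hρ₀
  obtain ⟨B, hB, hAB⟩ := h (ρ / 3) (by positivity)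
  obtain ⟨t, ht, hcov⟩ := EMetric.totallyBounded_iff.1 hB (ENNReal.ofReal (ρ / 2))
    (ENNReal.ofReal_pos.2 (by positivity))
  refine ⟨t, ht, fun x hx => ?_⟩
  obtain ⟨y, hy, hxy⟩ := infEDist_lt_iff.1 ((mem_cthickening_iff.1 (hAB hx)).trans_lt
    ((ENNReal.ofReal_lt_ofReal_iff (q := ρ / 2) (by positivity)).2 (by linarith)))
  obtain ⟨z, hz, hyz⟩ := mem_iUnion₂.1 (hcov hy)
  refine mem_iUnion₂.2 ⟨z, hz, ?_⟩
  calc edist x z ≤ edist x y + edist y z := edist_triangle _ _ _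
    _ < ENNReal.ofReal (ρ / 2) + ENNReal.ofReal (ρ / 2) := ENNReal.add_lt_add hxy hyz
    _ = ENNReal.ofReal ρ := by rw [← ENNReal.ofReal_add (by positivity) (by positivity), add_halves]
    _ < ε := hρ

lemma exists_forall_not_tendsto_hyperfilter {A : Set X} (hA : IsClosed A) (h : ¬ IsComplete A) :
    ∃ u : ℕ → X, (∀ n, u n ∈ A) ∧ ∀ q, ¬ Tendsto u (hyperfilter ℕ) (𝓝 q) := by
  contrapose! h
  refine completeSpace_coe_iff_isComplete.1
    (UniformSpace.complete_of_cauchySeq_tendsto fun u hu => ?_)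
  obtain ⟨q, hq⟩ := h (fun n => u n) fun n => (u n).2
  have hlim : Tendsto (fun n => (u n : X)) atTop (𝓝 q) :=
    le_nhds_of_cauchy_adhp (hu.map uniformContinuous_subtype_val)
      ((ClusterPt.of_le_nhds hq).mono (map_mono Nat.hyperfilter_le_atTop))
  exact ⟨⟨q, hA.mem_of_tendsto hlim (Eventually.of_forall fun n => (u n).2)⟩,
    tendsto_subtype_rng.2 hlim⟩

lemma isCompact_cthickening_mono {s t : ℝ} (hst : s ≤ t) (h : IsCompact (cthickening t K)) :
    IsCompact (cthickening s K) :=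
  h.of_isClosed_subset isClosed_cthickening (cthickening_mono hst K)

end Lipschitz

namespace HasShortCurves

section PseudoEMetricSpace

variable {X : Type*} [PseudoEMetricSpace X] {K : Set X}

lemma exists_of_infEDist_lt (hX : HasShortCurves X) {x : X} {T : ℝ}
    (hx : infEDist x K < ENNReal.ofReal T) :
    ∃ c : ℝ → X, LipschitzWith 1 c ∧ c 0 ∈ K ∧ c T = x := by
  obtain ⟨q, hq, hlt⟩ := infEDist_lt_iff.1 hx
  obtain ⟨c, hc, rfl, hcT⟩ := hX (edist_comm x q ▸ hlt)
  exact ⟨c, hc, hq, hcT⟩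

lemma exists_of_mem_cthickening (hX : HasShortCurves X) {x : X} {r T : ℝ}
    (hx : x ∈ cthickening r K) (hr : 0 ≤ r) (hrT : r < T) :
    ∃ c : ℝ → X, LipschitzWith 1 c ∧ c 0 ∈ K ∧ c T = x :=
  hX.exists_of_infEDist_lt ((mem_cthickening_iff.1 hx).trans_lt
    ((ENNReal.ofReal_lt_ofReal_iff_of_nonneg hr).2 hrT))

lemma cthickening_add_subset (hX : HasShortCurves X) {t ε : ℝ} (ht : 0 ≤ t) (hε : 0 ≤ ε) :
    cthickening (t + ε) K ⊆ cthickening ε (cthickening t K) := by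
  rw [cthickening_eq_iInter_cthickening (δ := ε)]
  refine fun x hx => mem_iInter₂.2 fun δ hδ => ?_
  obtain ⟨c, hc, hc₀, rfl⟩ := hX.exists_of_mem_cthickening hx (by positivity)
    (show t + ε < t + δ from add_lt_add_right hδ t)
  refine mem_cthickening_of_edist_le _ _ _ _ (mem_cthickening_of_lipschitzWith_one hc hc₀ ht)
    (edist_le_ofReal_of_abs_sub_le hc ?_)
  rw [add_sub_cancel_left, abs_of_nonneg (hε.trans hδ.le)]

lemma cthickening_subset_closure_thickening (hX : HasShortCurves X) {t : ℝ} (ht : 0 < t) :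
    cthickening t K ⊆ closure (thickening t K) := by
  intro x hx
  rw [← cthickening_zero, cthickening_eq_iInter_cthickening]
  refine mem_iInter₂.2 fun δ hδ => ?_
  have hδ' : 0 < min (δ / 2) t := lt_min (half_pos hδ) ht
  have hr : 0 ≤ t - min (δ / 2) t := sub_nonneg.2 (min_le_right _ _)
  have hmem := hX.cthickening_add_subset hr hδ'.le (by rwa [sub_add_cancel])
  have hsub := cthickening_subset_thickening' ht (sub_lt_self t hδ') K
  exact cthickening_mono ((min_le_left _ _).trans (half_le_self hδ.le)) _
    (cthickening_subset_of_subset _ hsub hmem)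

lemma exists_isCompact_cthickening_add (hX : HasShortCurves X) [LocallyCompactSpace X] {t : ℝ}
    (ht : 0 ≤ t) (hK : IsCompact (cthickening t K)) :
    ∃ ε > 0, IsCompact (cthickening (t + ε) K) := by
  obtain ⟨ε, hε, h⟩ := hK.exists_isCompact_cthickening
  exact ⟨ε, hε, h.of_isClosed_subset isClosed_cthickening (hX.cthickening_add_subset ht hε.le)⟩

lemma isCompact_cthickening_of_isComplete (hX : HasShortCurves X) {R : ℝ} (hR : 0 < R)
    (h : ∀ s < R, IsCompact (cthickening s K)) (hc : IsComplete (cthickening R K)) :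
    IsCompact (cthickening R K) := by
  refine isCompact_iff_totallyBounded_isComplete.2
    ⟨totallyBounded_of_forall_subset_cthickening fun δ hδ => ?_, hc⟩
  have hmin : 0 < min δ R := lt_min hδ hR
  refine ⟨_, (h (R - min δ R) (sub_lt_self R hmin)).totallyBounded, ?_⟩
  calc cthickening R K = cthickening (R - min δ R + min δ R) K := by rw [sub_add_cancel]
    _ ⊆ cthickening (min δ R) (cthickening (R - min δ R) K) :=
      hX.cthickening_add_subset (sub_nonneg.2 (min_le_right _ _)) hmin.le
    _ ⊆ cthickening δ (cthickening (R - min δ R) K) := cthickening_mono (min_le_left _ _) _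

end PseudoEMetricSpace

variable {X : Type*} [EMetricSpace X] {K : Set X}

lemma exists_minimal_not_isCompact_cthickening (hX : HasShortCurves X) [LocallyCompactSpace X]
    (hK : IsCompact K) {t : ℝ} (ht : ¬ IsCompact (cthickening t K)) :
    ∃ R ∈ Ioc 0 t, ¬ IsCompact (cthickening R K) ∧ ∀ s < R, IsCompact (cthickening s K) := by
  have h₀ : IsCompact (cthickening 0 K) := by rwa [cthickening_zero, hK.isClosed.closure_eq]
  set B := {s : ℝ | ¬ IsCompact (cthickening s K)}
  have hB₀ (s : ℝ) (hs : s ∈ B) : 0 ≤ s :=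
    le_of_lt (not_le.1 fun h => hs (isCompact_cthickening_mono h h₀))
  have hlt (s : ℝ) (hs : s < sInf B) : IsCompact (cthickening s K) :=
    not_not.1 fun h => (csInf_le ⟨0, hB₀⟩ h).not_gt hs
  have hR : ¬ IsCompact (cthickening (sInf B) K) := fun hcpt => by
    obtain ⟨ε, hε, h⟩ := hX.exists_isCompact_cthickening_add (le_csInf ⟨t, ht⟩ hB₀) hcpt
    obtain ⟨s, hs, hslt⟩ := exists_lt_of_csInf_lt ⟨t, ht⟩ (lt_add_of_pos_right (sInf B) hε)
    exact hs (isCompact_cthickening_mono hslt.le h)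
  have hpos : 0 < sInf B := not_le.1 fun h => hR (isCompact_cthickening_mono h h₀)
  exact ⟨sInf B, ⟨hpos, csInf_le ⟨0, hB₀⟩ ht⟩, hR, hlt⟩

lemma isCompact_cthickening (hX : HasShortCurves X) [LocallyCompactSpace X] [CompleteSpace X]
    (hK : IsCompact K) (t : ℝ) : IsCompact (cthickening t K) := by
  by_contra ht
  obtain ⟨R, hR, hnc, hlt⟩ := hX.exists_minimal_not_isCompact_cthickening hK ht
  exact hnc (hX.isCompact_cthickening_of_isComplete hR.1 hlt isClosed_cthickening.isComplete)

/-- The isometric curve is the limit, along a nonprincipal ultrafilter, of `1`-Lipschitz curves of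
duration `R + 1 / (n + 1)` from `K` to `y n`. -/
lemma exists_isometric_of_tendsto_infEDist (hX : HasShortCurves X) (hK : IsCompact K) {R : ℝ}
    (hR : 0 ≤ R) {I : Set ℝ} (hI : I ⊆ Icc 0 R) (h₀ : 0 ∈ I)
    (hC : ∀ s ∈ I, IsCompact (cthickening s K)) {y : ℕ → X} (hyR : ∀ n, y n ∈ cthickening R K)
    (hy : Tendsto (fun n => infEDist (y n) K) (hyperfilter ℕ) (𝓝 (ENNReal.ofReal R))) :
    ∃ γ : ℝ → X, γ 0 ∈ K ∧ (∀ s ∈ I, γ s ∈ cthickening s K) ∧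
      (∀ s ∈ I, ∀ s' ∈ I, edist (γ s) (γ s') = edist s s') ∧
      ∀ s ∈ I, ∀ δ > R - s, ∀ᶠ n in hyperfilter ℕ, edist (y n) (γ s) < ENNReal.ofReal δ := by
  have hT (n : ℕ) : R < R + 1 / ((n : ℝ) + 1) := lt_add_of_pos_right _ (by positivity)
  choose c hc hc₀ hcy using fun n => hX.exists_of_mem_cthickening (hyR n) hR (hT n)
  obtain ⟨γ, hγ, hγlip⟩ := exists_tendsto_of_forall_lipschitzOnWith (F := hyperfilter ℕ)
    (fun n => (hc n).lipschitzOnWith (s := I)) hC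
    fun n s hs => mem_cthickening_of_lipschitzWith_one (hc n) (hc₀ n) (hI hs).1
  have hdist (n : ℕ) {s : ℝ} (hs : s ∈ I) :
      edist (y n) (c n s) ≤ ENNReal.ofReal (R + 1 / ((n : ℝ) + 1) - s) := by
    rw [← hcy n]
    exact edist_le_ofReal_of_abs_sub_le (hc n)
      (abs_of_nonneg (by linarith [hT n, (hI hs).2])).le
  have hlim (s : ℝ) : Tendsto (fun n : ℕ => ENNReal.ofReal (R + 1 / ((n : ℝ) + 1) - s))
      (hyperfilter ℕ) (𝓝 (ENNReal.ofReal (R - s))) := by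
    refine ENNReal.tendsto_ofReal (Tendsto.sub_const ?_ s)
    simpa only [add_zero] using (tendsto_one_div_add_atTop_nhds_zero_nat.const_add R).mono_left
      Nat.hyperfilter_le_atTop
  have hmin (s : ℝ) (hs : s ∈ I) : ENNReal.ofReal s ≤ edist (γ 0) (γ s) := by
    have hle : ENNReal.ofReal R ≤ ENNReal.ofReal (R - s) + edist (γ s) (γ 0) := by
      refine le_of_tendsto_of_tendsto hy ((hlim s).add ((hγ s hs).2.edist (hγ 0 h₀).2))
        (Eventually.of_forall fun n => ?_)
      calc infEDist (y n) K ≤ edist (y n) (c n 0) := infEDist_le_edist_of_mem (hc₀ n)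
        _ ≤ edist (y n) (c n s) + edist (c n s) (c n 0) := edist_triangle _ _ _
        _ ≤ _ := by grw [hdist n hs]
    rw [edist_comm]
    calc ENNReal.ofReal s = ENNReal.ofReal R - ENNReal.ofReal (R - s) := by
          rw [← ENNReal.ofReal_sub _ (sub_nonneg.2 (hI hs).2), sub_sub_cancel]
      _ ≤ _ := tsub_le_iff_left.2 hle
  refine ⟨γ, hK.isClosed.mem_of_tendsto (hγ 0 h₀).2 (Eventually.of_forall hc₀),
    fun s hs => (hγ s hs).1,
    edist_eq_of_forall_ofReal_le (fun s hs => (hI hs).1) h₀ hγlip hmin, fun s hs δ hδ => ?_⟩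
  have hδ₀ : 0 < δ := (sub_nonneg.2 (hI hs).2).trans_lt hδ
  have hsum := (hlim s).add ((hγ s hs).2.edist (tendsto_const_nhds (x := γ s)))
  rw [edist_self, add_zero] at hsum
  filter_upwards [hsum.eventually_lt_const ((ENNReal.ofReal_lt_ofReal_iff hδ₀).2 hδ)] with n hn
  exact ((edist_triangle _ _ _).trans (by grw [hdist n hs])).trans_lt hn

lemma exists_isometric_of_infEDist_eq (hX : HasShortCurves X) (hK : IsCompact K) {r : ℝ}
    (hr : 0 ≤ r) (hC : IsCompact (cthickening r K)) {x : X}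
    (hx : infEDist x K = ENNReal.ofReal r) :
    ∃ γ : ℝ → X, γ 0 ∈ K ∧ γ r = x ∧
      ∀ s ∈ Icc 0 r, ∀ s' ∈ Icc 0 r, edist (γ s) (γ s') = edist s s' := by
  obtain ⟨γ, h₀, -, hγ, hlim⟩ := hX.exists_isometric_of_tendsto_infEDist hK hr Subset.rfl
    (left_mem_Icc.2 hr) (fun s hs => isCompact_cthickening_mono hs.2 hC) (y := fun _ => x)
    (fun _ => hx.le) (by simpa only [hx] using tendsto_const_nhds)
  refine ⟨γ, h₀, ?_, hγ⟩
  refine (edist_le_zero.1 (ENNReal.le_of_forall_pos_le_add fun δ hδ _ => ?_)).symm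
  rw [zero_add, ← ENNReal.ofReal_coe_nnreal]
  obtain ⟨-, hn⟩ := (hlim r (right_mem_Icc.2 hr) δ (by simpa using hδ)).exists
  exact hn.le

lemma exists_isometric_ray (hX : HasShortCurves X) (hK : IsCompact K) {R : ℝ} (hR : 0 < R)
    (hnc : ¬ IsCompact (cthickening R K)) (hlt : ∀ s < R, IsCompact (cthickening s K)) :
    ∃ γ : ℝ → X, γ 0 ∈ K ∧ (∀ s ∈ Ico 0 R, γ s ∈ cthickening s K) ∧
      (∀ s ∈ Ico 0 R, ∀ s' ∈ Ico 0 R, edist (γ s) (γ s') = edist s s') ∧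
      ¬ ∃ q, Tendsto γ (𝓝[<] R) (𝓝 q) := by
  obtain ⟨y, hyR, hy⟩ := exists_forall_not_tendsto_hyperfilter isClosed_cthickening
    (mt (hX.isCompact_cthickening_of_isComplete hR hlt) hnc)
  have hescape (s : ℝ) (hs : s < R) : ∀ᶠ n in hyperfilter ℕ, y n ∉ cthickening s K := by
    refine Ultrafilter.eventually_not.2 fun hmem => ?_
    obtain ⟨q, -, hq⟩ := (hlt s hs).ultrafilter_le_nhds ((hyperfilter ℕ).map y)
      (le_principal_iff.2 hmem)
    exact hy q hq
  have hinf : Tendsto (fun n => infEDist (y n) K) (hyperfilter ℕ) (𝓝 (ENNReal.ofReal R)) := by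
    refine tendsto_order.2 ⟨fun a ha => ?_, fun a ha =>
      Eventually.of_forall fun n => (mem_cthickening_iff.1 (hyR n)).trans_lt ha⟩
    obtain ⟨s, -, has, hs⟩ := ENNReal.lt_iff_exists_real_btwn.1 ha
    filter_upwards [hescape s ((ENNReal.ofReal_lt_ofReal_iff hR).1 hs)] with n hn
    exact has.trans (not_le.1 hn)
  obtain ⟨γ, h₀, hmem, hγ, hlim⟩ := hX.exists_isometric_of_tendsto_infEDist hK hR.le
    Ico_subset_Icc_self (left_mem_Ico.2 hR) (fun s hs => hlt s hs.2) hyR hinf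
  refine ⟨γ, h₀, hmem, hγ, fun ⟨q, hq⟩ => hy q (EMetric.tendsto_nhds.2 fun ε hε => ?_)⟩
  obtain ⟨ρ, -, hρ₀, hρ⟩ := ENNReal.lt_iff_exists_real_btwn.1 hε
  have hρ₀ : 0 < ρ := ENNReal.ofReal_pos.1 hρ₀
  have hnear : ∀ᶠ s in 𝓝[<] R, s ∈ Ico 0 R ∧ R - s < ρ / 2 := by
    filter_upwards [Ioo_mem_nhdsLT hR, Ioo_mem_nhdsLT (sub_lt_self R (half_pos hρ₀))]
      with s hs hs' using ⟨Ioo_subset_Ico_self hs, by linarith [hs'.1]⟩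
  obtain ⟨s, ⟨hs, hsR⟩, hsq⟩ := (hnear.and
    (EMetric.tendsto_nhds.1 hq _ (ENNReal.ofReal_pos.2 (half_pos hρ₀)))).exists
  filter_upwards [hlim s hs _ hsR] with n hn
  calc edist (y n) q ≤ edist (y n) (γ s) + edist (γ s) q := edist_triangle _ _ _
    _ < ENNReal.ofReal (ρ / 2) + ENNReal.ofReal (ρ / 2) := ENNReal.add_lt_add hn hsq
    _ = ENNReal.ofReal ρ := by rw [← ENNReal.ofReal_add (by positivity) (by positivity), add_halves]
    _ < ε := hρ

end HasShortCurves

end ShortCurves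

section RiemannianCurves

variable {E : Type*} [NormedAddCommGroup E] [NormedSpace ℝ E] [FiniteDimensional ℝ E]
  {S : Type*} [PseudoEMetricSpace S] [ChartedSpace E S] [IsManifold 𝓘(ℝ, E) ∞ S]
  [RiemannianBundle (fun x : S => TangentSpace 𝓘(ℝ, E) x)]
  [IsContMDiffRiemannianBundle 𝓘(ℝ, E) ∞ E (fun x : S => TangentSpace 𝓘(ℝ, E) x)]
  [IsRiemannianManifold 𝓘(ℝ, E) S]

lemma exists_contMDiff_lipschitzWith_of_edist_lt {p q : S} {T : ℝ}
    (h : edist p q < ENNReal.ofReal T) :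
    ∃ c : ℝ → S, ContMDiff 𝓘(ℝ, ℝ) 𝓘(ℝ, E) ∞ c ∧ LipschitzWith 1 c ∧ c 0 = p ∧ c T = q := by
  obtain ⟨c, hc, hc₀, ⟨T', hT', hcT⟩, hspeed⟩ := smoothReach_of_edist_lt (E := E) h
  refine ⟨c, hc, fun s s' => ?_, hc₀ 0 le_rfl, hcT T hT'.2.le⟩
  rw [ENNReal.coe_one, one_mul]
  wlog hs : s ≤ s' generalizing s s'
  · simpa only [edist_comm] using this s' s (le_of_not_ge hs)
  · rw [edist_comm s, edist_dist, Real.dist_eq, abs_of_nonneg (sub_nonneg.2 hs)]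
    exact edist_le_of_curveSpeed_le_one (hc.of_le (by simp)) hs fun u _ => hspeed u

lemma contMDiffOn_Ico_of_edist_eq {γ : ℝ → S} {a b : ℝ}
    (hγ : ∀ s ∈ Ico a b, ∀ s' ∈ Ico a b, edist (γ s) (γ s') = edist s s') :
    ContMDiffOn 𝓘(ℝ, ℝ) 𝓘(ℝ, E) ∞ γ (Ico a b) := by
  intro s hs
  obtain ⟨r, hsr, hrb⟩ := exists_between hs.2
  have hr := contMDiffOn_of_edist_eq (E := E) (γ := γ) fun u hu u' hu' =>
    hγ u (Icc_subset_Ico_right hrb hu) u' (Icc_subset_Ico_right hrb hu')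
  refine (hr s ⟨hs.1, hsr.le⟩).mono_of_mem_nhdsWithin ?_
  filter_upwards [self_mem_nhdsWithin, mem_nhdsWithin_of_mem_nhds (Iio_mem_nhds hsr)]
    with u hu hur using ⟨hu.1, hur.le⟩

end RiemannianCurves

namespace StandardStaticSpacetime

variable {E : Type*} [NormedAddCommGroup E] [NormedSpace ℝ E]
  {S : Type*} [TopologicalSpace S] [ChartedSpace E S] [IsManifold 𝓘(ℝ, E) ∞ S]
  (M : StandardStaticSpacetime E S)

section ConformalMetric

/-- The metric `V⁻² h`, as the Riemannian structure on the tangent bundle of `S`. -/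
noncomputable abbrev riemannianBundle : RiemannianBundle (fun x : S => TangentSpace 𝓘(ℝ, E) x) :=
  ⟨M.conformalMetric.toRiemannianMetric⟩

lemma isContMDiffRiemannianBundle :
    letI := M.riemannianBundle
    IsContMDiffRiemannianBundle 𝓘(ℝ, E) ∞ E (fun x : S => TangentSpace 𝓘(ℝ, E) x) :=
  letI := M.riemannianBundle
  ⟨M.conformalMetric.inner, M.conformalMetric.contMDiff, fun _ _ _ => rfl⟩

lemma conformalMetric_inner_self {x : S} (v : TangentSpace 𝓘(ℝ, E) x) :
    letI := M.riemannianBundle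
    M.conformalMetric.inner x v v = ‖v‖ ^ 2 :=
  letI := M.riemannianBundle
  real_inner_self_eq_norm_sq v

lemma dist_self (x : S) : M.dist x x = 0 :=
  letI := M.riemannianBundle
  riemannianEDist_self

lemma dist_comm (x y : S) : M.dist x y = M.dist y x :=
  letI := M.riemannianBundle
  riemannianEDist_comm

variable [T3Space S]

/-- The distance of `V⁻² h`, as an extended metric inducing the topology of `S`. -/
@[reducible] noncomputable def toEMetricSpace : EMetricSpace S :=
  letI := M.riemannianBundle
  haveI : IsManifold 𝓘(ℝ, E) 1 S := IsManifold.of_le (n := ∞) (by simp)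
  haveI : IsContinuousRiemannianBundle E (fun x : S => TangentSpace 𝓘(ℝ, E) x) :=
    ⟨M.conformalMetric.inner, M.conformalMetric.contMDiff.continuous, fun _ _ _ => rfl⟩
  EMetricSpace.ofRiemannianMetric 𝓘(ℝ, E) S

lemma isRiemannianManifold :
    letI := M.riemannianBundle
    letI := M.toEMetricSpace
    IsRiemannianManifold 𝓘(ℝ, E) S :=
  letI := M.riemannianBundle
  letI := M.toEMetricSpace
  ⟨fun _ _ => rfl⟩

lemma hasShortCurves [FiniteDimensional ℝ E] :
    letI := M.toEMetricSpace
    HasShortCurves S := by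
  let _ := M.riemannianBundle
  let _ := M.toEMetricSpace
  have := M.isContMDiffRiemannianBundle
  have := M.isRiemannianManifold
  intro p q T h
  obtain ⟨c, -, hc⟩ := exists_contMDiff_lipschitzWith_of_edist_lt (E := E) h
  exact ⟨c, hc⟩

end ConformalMetric

section CausalCurves

variable {E : Type*} [NormedAddCommGroup E] [NormedSpace ℝ E]
  {S : Type*} [TopologicalSpace S] [ChartedSpace E S]

lemma dtime_timeField (p : ℝ × S) : dtime (timeField E p) = 1 := by
  have hγ : HasMFDerivAt 𝓘(ℝ, ℝ) (𝓘(ℝ, ℝ).prod 𝓘(ℝ, E)) (fun t : ℝ => (t, p.2)) p.1 _ :=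
    (hasMFDerivAt_id p.1).prodMk (hasMFDerivAt_const p.2 p.1)
  rw [timeField, dtime, (hasMFDerivAt_fst p).mfderiv]
  exact congrArg (fun L : ℝ →L[ℝ] ℝ × E => (L 1).1) hγ.mfderiv

lemma dspace_timeField (p : ℝ × S) : dspace (timeField E p) = 0 := by
  have hγ : HasMFDerivAt 𝓘(ℝ, ℝ) (𝓘(ℝ, ℝ).prod 𝓘(ℝ, E)) (fun t : ℝ => (t, p.2)) p.1 _ :=
    (hasMFDerivAt_id p.1).prodMk (hasMFDerivAt_const p.2 p.1)
  rw [timeField, dspace, (hasMFDerivAt_snd p).mfderiv]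
  exact congrArg (fun L : ℝ →L[ℝ] ℝ × E => (L 1).2) hγ.mfderiv

lemma dtime_velocity {γ : ℝ → ℝ × S} {I : Set ℝ} {s : ℝ}
    (hγ : MDifferentiableWithinAt 𝓘(ℝ, ℝ) (𝓘(ℝ, ℝ).prod 𝓘(ℝ, E)) γ I s)
    (hI : UniqueDiffWithinAt ℝ I s) :
    dtime (velocity E γ I s) = derivWithin (fun s => (γ s).1) I s := by
  have hfst : HasMFDerivWithinAt 𝓘(ℝ, ℝ) 𝓘(ℝ, ℝ) (Prod.fst ∘ γ) I s _ :=
    (mdifferentiableAt_fst (x := γ s)).hasMFDerivAt.comp_hasMFDerivWithinAt s hγ.hasMFDerivWithinAt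
  refine (congrArg (fun L : ℝ →L[ℝ] ℝ => L 1)
    (hfst.mfderivWithin hI.uniqueMDiffWithinAt)).symm.trans ?_
  rw [mfderivWithin_eq_fderivWithin]
  rfl

lemma dspace_velocity {γ : ℝ → ℝ × S} {I : Set ℝ} {s : ℝ}
    (hγ : MDifferentiableWithinAt 𝓘(ℝ, ℝ) (𝓘(ℝ, ℝ).prod 𝓘(ℝ, E)) γ I s)
    (hI : UniqueDiffWithinAt ℝ I s) :
    dspace (velocity E γ I s) =
      mfderivWithin 𝓘(ℝ, ℝ) 𝓘(ℝ, E) (fun s => (γ s).2) I s (1 : ℝ) := by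
  have hsnd : HasMFDerivWithinAt 𝓘(ℝ, ℝ) 𝓘(ℝ, E) (Prod.snd ∘ γ) I s _ :=
    (mdifferentiableAt_snd (x := γ s)).hasMFDerivAt.comp_hasMFDerivWithinAt s hγ.hasMFDerivWithinAt
  exact (congrArg (fun L : ℝ →L[ℝ] E => L 1) (hsnd.mfderivWithin hI.uniqueMDiffWithinAt)).symm

variable [IsManifold 𝓘(ℝ, E) ∞ S] {M : StandardStaticSpacetime E S}

lemma isFutureCausal_iff {p : ℝ × S} (v : Tangent E p) : M.IsFutureCausal v ↔
    0 < dtime v ∧ M.conformalMetric.inner p.2 (dspace v) (dspace v) ≤ dtime v ^ 2 := by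
  have hV : 0 < M.V p.2 ^ 2 := pow_pos (M.V_pos p.2) 2
  have htime : M.g p v (timeField E p) = M.V p.2 ^ 2 * dtime v := by
    rw [g, dtime_timeField, dspace_timeField, map_zero, mul_one, sub_zero]
  have hself : M.g p v v = M.V p.2 ^ 2 *
      (dtime v ^ 2 - M.conformalMetric.inner p.2 (dspace v) (dspace v)) := by
    change _ = M.V p.2 ^ 2 *
      (dtime v ^ 2 - (M.V p.2 ^ 2)⁻¹ * M.h.inner p.2 (dspace v) (dspace v))
    rw [mul_sub, mul_inv_cancel_left₀ hV.ne', g, ← sq]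
  rw [IsFutureCausal, htime, hself, mul_nonneg_iff_of_pos_left hV, mul_pos_iff_of_pos_left hV,
    sub_nonneg]
  refine ⟨fun h => ⟨h.2.2, h.2.1⟩, fun h => ⟨?_, h.2, h.1⟩⟩
  rintro rfl
  exact h.1.ne' (map_zero _)

lemma isFutureCausal_velocity_iff {γ : ℝ → ℝ × S} {I : Set ℝ} {s : ℝ}
    (hγ : MDifferentiableWithinAt 𝓘(ℝ, ℝ) (𝓘(ℝ, ℝ).prod 𝓘(ℝ, E)) γ I s)
    (hI : UniqueDiffWithinAt ℝ I s) :
    letI := M.riemannianBundle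
    M.IsFutureCausal (velocity E γ I s) ↔
      curveSpeed E (fun s => (γ s).2) I s ≤ derivWithin (fun s => (γ s).1) I s ∧
        0 < derivWithin (fun s => (γ s).1) I s := by
  let _ := M.riemannianBundle
  rw [isFutureCausal_iff, dtime_velocity hγ hI, dspace_velocity hγ hI, conformalMetric_inner_self,
    and_comm]
  exact and_congr_left fun h => pow_le_pow_iff_left₀ (curveSpeed_nonneg _ _ _) h.le two_ne_zero

lemma isFutureCausalCurveOn_graph [FiniteDimensional ℝ E] [T3Space S] {x : ℝ → S} {I : Set ℝ}
    (hI : I.OrdConnected) (hI' : UniqueDiffOn ℝ I) (hx : ContMDiffOn 𝓘(ℝ, ℝ) 𝓘(ℝ, E) ∞ x I)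
    (hlip : ∀ s ∈ I, ∀ s' ∈ I, M.dist (x s) (x s') ≤ edist s s') :
    M.IsFutureCausalCurveOn (fun s => (s, x s)) I := by
  let _ := M.riemannianBundle
  let _ := M.toEMetricSpace
  have := M.isContMDiffRiemannianBundle
  have := M.isRiemannianManifold
  have hγ : ContMDiffOn 𝓘(ℝ, ℝ) (𝓘(ℝ, ℝ).prod 𝓘(ℝ, E)) ∞ (fun s => (s, x s)) I :=
    contMDiffOn_id.prodMk hx
  have hxlip : LipschitzOnWith 1 x I := fun s hs s' hs' =>
    (hlip s hs s' hs').trans_eq (by rw [ENNReal.coe_one, one_mul])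
  refine ⟨hI, hγ, fun s hs => ?_⟩
  rw [isFutureCausal_velocity_iff ((hγ s hs).mdifferentiableWithinAt (by simp)) (hI' s hs),
    show derivWithin (fun s : ℝ => s) I s = 1 from derivWithin_id' _ _ (hI' s hs)]
  exact ⟨curveSpeed_le_of_lipschitzOnWith hxlip hs (hI' s hs)
    ((hx s hs).mdifferentiableWithinAt (by simp)), one_pos⟩

namespace IsFutureCausalCurveOn

variable {γ : ℝ → ℝ × S} {I : Set ℝ} {a b : ℝ}

lemma mdifferentiableWithinAt (h : M.IsFutureCausalCurveOn γ I) {s : ℝ} (hs : s ∈ I) :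
    MDifferentiableWithinAt 𝓘(ℝ, ℝ) (𝓘(ℝ, ℝ).prod 𝓘(ℝ, E)) γ I s :=
  (h.2.1 s hs).mdifferentiableWithinAt (by simp)

lemma contDiffOn_fst (h : M.IsFutureCausalCurveOn γ I) : ContDiffOn ℝ ∞ (fun s => (γ s).1) I :=
  (contMDiff_fst.comp_contMDiffOn h.2.1).contDiffOn

lemma mono (h : M.IsFutureCausalCurveOn γ I) {J : Set ℝ} (hJI : J ⊆ I) (hJ : J.OrdConnected)
    (hJ' : UniqueDiffOn ℝ J) : M.IsFutureCausalCurveOn γ J := by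
  refine ⟨hJ, h.2.1.mono hJI, fun s hs => ?_⟩
  rw [velocity, mfderivWithin_subset hJI (hJ' s hs).uniqueMDiffWithinAt
    (h.mdifferentiableWithinAt (hJI hs))]
  exact h.2.2 s (hJI hs)

lemma strictMonoOn_fst (h : M.IsFutureCausalCurveOn γ I) : StrictMonoOn (fun s => (γ s).1) I := by
  refine strictMonoOn_of_deriv_pos h.1.convex h.contDiffOn_fst.continuousOn fun s hs => ?_
  have hI : I ∈ 𝓝 s := mem_interior_iff_mem_nhds.1 hs
  rw [← derivWithin_of_mem_nhds hI]
  exact ((isFutureCausal_velocity_iff (h.mdifferentiableWithinAt (interior_subset hs))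
    (uniqueDiffWithinAt_of_mem_nhds hI)).1 (h.2.2 s (interior_subset hs))).2

lemma dist_le (h : M.IsFutureCausalCurveOn γ I) (ha : a ∈ I) (hb : b ∈ I) (hab : a ≤ b) :
    M.dist (γ a).2 (γ b).2 ≤ ENNReal.ofReal ((γ b).1 - (γ a).1) := by
  let _ := M.riemannianBundle
  rcases hab.eq_or_lt with rfl | hab
  · exact (M.dist_self _).trans_le zero_le
  · have hJ := h.mono (h.1.out ha hb) ordConnected_Icc (uniqueDiffOn_Icc hab)
    refine riemannianEDist_le_of_curveSpeed_le_deriv (c := fun s => (γ s).2) hab.le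
      ((contMDiff_snd.comp_contMDiffOn hJ.2.1).of_le (by simp))
      (fun s hs => (hJ.contDiffOn_fst.differentiableOn (by simp) s hs).hasDerivWithinAt)
      fun s hs => ?_
    exact ((isFutureCausal_velocity_iff (hJ.mdifferentiableWithinAt hs)
      (uniqueDiffOn_Icc hab s hs)).1 (hJ.2.2 s hs)).1

end IsFutureCausalCurveOn

end CausalCurves

section CausalFuture

variable {E : Type*} [NormedAddCommGroup E] [NormedSpace ℝ E]
  {S : Type*} [TopologicalSpace S] [ChartedSpace E S] [IsManifold 𝓘(ℝ, E) ∞ S]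
  {M : StandardStaticSpacetime E S} {A : Set (ℝ × S)} {L : Set S} {p q : ℝ × S} {x y : S} {t : ℝ}

lemma exists_dist_le_of_mem_Jplus (h : q ∈ M.Jplus A) :
    ∃ p ∈ A, p.1 ≤ q.1 ∧ M.dist p.2 q.2 ≤ ENNReal.ofReal (q.1 - p.1) := by
  rcases h with hq | ⟨a, b, γ, hab, hγ, ha, rfl⟩
  · exact ⟨q, hq, le_rfl, (M.dist_self _).trans_le zero_le⟩
  · have haI := left_mem_Icc.2 hab.le
    have hbI := right_mem_Icc.2 hab.le
    exact ⟨γ a, ha, (hγ.strictMonoOn_fst haI hbI hab).le, hγ.dist_le haI hbI hab.le⟩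

lemma exists_dist_le_of_mem_Jminus (h : p ∈ M.Jminus A) :
    ∃ q ∈ A, p.1 ≤ q.1 ∧ M.dist p.2 q.2 ≤ ENNReal.ofReal (q.1 - p.1) := by
  rcases h with hp | ⟨a, b, γ, hab, hγ, hb, rfl⟩
  · exact ⟨p, hp, le_rfl, (M.dist_self _).trans_le zero_le⟩
  · have haI := left_mem_Icc.2 hab.le
    have hbI := right_mem_Icc.2 hab.le
    exact ⟨γ b, hb, (hγ.strictMonoOn_fst haI hbI hab).le, hγ.dist_le haI hbI hab.le⟩

lemma mem_closedThickening_of_dist_le (hx : x ∈ L) (h : M.dist y x ≤ ENNReal.ofReal t) :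
    y ∈ M.closedThickening L t :=
  (iInf₂_le (f := fun x (_ : x ∈ L) => M.dist y x) x hx).trans h

lemma mem_closedThickening_of_mem_J (h : (t, y) ∈ M.J ({0} ×ˢ L)) :
    y ∈ M.closedThickening L |t| := by
  rcases h with h | h
  · obtain ⟨⟨_, x⟩, ⟨rfl, hx⟩, h₀, hle⟩ := exists_dist_le_of_mem_Jplus h
    refine mem_closedThickening_of_dist_le hx ?_
    rwa [M.dist_comm, abs_of_nonneg h₀, ← sub_zero t]
  · obtain ⟨⟨_, x⟩, ⟨rfl, hx⟩, h₀, hle⟩ := exists_dist_le_of_mem_Jminus h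
    refine mem_closedThickening_of_dist_le hx ?_
    rwa [abs_of_nonpos h₀, ← zero_sub]

variable [T3Space S]

lemma Jplus_inter_slice (ht : 0 ≤ t) :
    M.Jplus ({0} ×ˢ L) ∩ slice S t = M.J ({0} ×ˢ L) ∩ slice S t := by
  let _ := M.toEMetricSpace
  refine subset_antisymm (inter_subset_inter_left _ subset_union_left) ?_
  rintro ⟨_, y⟩ ⟨h | h, rfl⟩
  · exact ⟨h, rfl⟩
  · obtain ⟨⟨_, x⟩, ⟨rfl, hx⟩, h₀, hle⟩ := exists_dist_le_of_mem_Jminus h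
    obtain rfl := ht.antisymm h₀
    have hyx : M.dist y x ≤ 0 := by simpa using hle
    obtain rfl : y = x := edist_le_zero.1 hyx
    exact ⟨Or.inl ⟨rfl, hx⟩, rfl⟩

variable [FiniteDimensional ℝ E]

lemma mem_Jplus_of_graph {c : ℝ → S} {a b : ℝ} (hab : a ≤ b)
    (hc : ContMDiffOn 𝓘(ℝ, ℝ) 𝓘(ℝ, E) ∞ c (Icc a b))
    (hlip : ∀ s ∈ Icc a b, ∀ s' ∈ Icc a b, M.dist (c s) (c s') ≤ edist s s')
    (ha : (a, c a) ∈ A) : (b, c b) ∈ M.Jplus A := by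
  rcases hab.eq_or_lt with rfl | hab
  · exact Or.inl ha
  · exact Or.inr ⟨a, b, _, hab, isFutureCausalCurveOn_graph ordConnected_Icc (uniqueDiffOn_Icc hab)
      hc hlip, ha, rfl⟩

lemma mem_Jminus_of_graph {c : ℝ → S} {a b : ℝ} (hab : a ≤ b)
    (hc : ContMDiffOn 𝓘(ℝ, ℝ) 𝓘(ℝ, E) ∞ c (Icc a b))
    (hlip : ∀ s ∈ Icc a b, ∀ s' ∈ Icc a b, M.dist (c s) (c s') ≤ edist s s')
    (hb : (b, c b) ∈ A) : (a, c a) ∈ M.Jminus A := by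
  rcases hab.eq_or_lt with rfl | hab
  · exact Or.inl hb
  · exact Or.inr ⟨a, b, _, hab, isFutureCausalCurveOn_graph ordConnected_Icc (uniqueDiffOn_Icc hab)
      hc hlip, hb, rfl⟩

lemma mem_J_of_curve {c : ℝ → S} (hc : ContMDiffOn 𝓘(ℝ, ℝ) 𝓘(ℝ, E) ∞ c (Icc 0 |t|))
    (hlip : ∀ s ∈ Icc 0 |t|, ∀ s' ∈ Icc 0 |t|, M.dist (c s) (c s') ≤ edist s s')
    (h₀ : c 0 ∈ L) : (t, c |t|) ∈ M.J ({0} ×ˢ L) := by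
  rcases le_total 0 t with ht | ht
  · rw [abs_of_nonneg ht] at hc hlip ⊢
    exact Or.inl (mem_Jplus_of_graph ht hc hlip ⟨rfl, h₀⟩)
  · rw [abs_of_nonpos ht] at hc hlip ⊢
    have hneg : MapsTo (fun s : ℝ => -s) (Icc t 0) (Icc 0 (-t)) := fun s hs =>
      ⟨neg_nonneg.2 hs.2, neg_le_neg hs.1⟩
    refine Or.inr (mem_Jminus_of_graph (c := fun s => c (-s)) ht
      (hc.comp contDiff_neg.contMDiff.contMDiffOn hneg) (fun s hs s' hs' => ?_)
      ⟨rfl, by simpa using h₀⟩)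
    simpa only [edist_neg_neg] using hlip _ (hneg hs) _ (hneg hs')

lemma mem_J_of_dist_lt (hx : x ∈ L) (h : M.dist y x < ENNReal.ofReal |t|) :
    (t, y) ∈ M.J ({0} ×ˢ L) := by
  let _ := M.riemannianBundle
  let _ := M.toEMetricSpace
  have := M.isContMDiffRiemannianBundle
  have := M.isRiemannianManifold
  rw [M.dist_comm] at h
  obtain ⟨c, hc, hlip, rfl, rfl⟩ :=
    exists_contMDiff_lipschitzWith_of_edist_lt (E := E) (p := x) (q := y) h
  refine mem_J_of_curve hc.contMDiffOn (fun s _ s' _ => (hlip s s').trans_eq ?_) hx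
  rw [ENNReal.coe_one, one_mul]

lemma mem_J_of_mem_closedThickening {r : ℝ} (hL : IsCompact L) (hr : 0 ≤ r) (hrt : r ≤ |t|)
    (hC : IsCompact (M.closedThickening L r)) (hy : y ∈ M.closedThickening L r) :
    (t, y) ∈ M.J ({0} ×ˢ L) := by
  let _ := M.riemannianBundle
  let _ := M.toEMetricSpace
  have := M.isContMDiffRiemannianBundle
  have := M.isRiemannianManifold
  have hyr : Metric.infEDist y L ≤ ENNReal.ofReal r := hy
  rcases (hyr.trans (ENNReal.ofReal_le_ofReal hrt)).lt_or_eq with hlt | heq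
  · obtain ⟨x, hx, hyx⟩ := Metric.infEDist_lt_iff.1 hlt
    exact mem_J_of_dist_lt hx hyx
  · obtain rfl := hrt.antisymm ((ENNReal.ofReal_le_ofReal_iff hr).1 (heq.symm.trans_le hyr))
    obtain ⟨c, h₀, rfl, hc⟩ := M.hasShortCurves.exists_isometric_of_infEDist_eq hL hr hC heq
    exact mem_J_of_curve (contMDiffOn_of_edist_eq hc) (fun s hs s' hs' => (hc s hs s' hs').le) h₀

lemma J_inter_slice_eq (hL : IsCompact L) (hC : IsCompact (M.closedThickening L |t|)) :
    M.J ({0} ×ˢ L) ∩ slice S t = {t} ×ˢ M.closedThickening L |t| := by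
  ext ⟨s, y⟩
  constructor
  · rintro ⟨h, rfl⟩
    exact ⟨rfl, mem_closedThickening_of_mem_J h⟩
  · rintro ⟨rfl, hy⟩
    exact ⟨mem_J_of_mem_closedThickening hL (abs_nonneg _) le_rfl hC hy, rfl⟩

theorem isCompact_J_inter_slice_iff (hL : IsCompact L) :
    IsCompact (M.J ({0} ×ˢ L) ∩ slice S t) ↔ IsCompact (M.closedThickening L |t|) := by
  let _ := M.toEMetricSpace
  refine ⟨fun h => ?_, fun h => J_inter_slice_eq hL h ▸ isCompact_singleton.prod h⟩
  have hsnd : IsCompact (Prod.snd '' (M.J ({0} ×ˢ L) ∩ slice S t)) := h.image continuous_snd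
  change IsCompact (Metric.cthickening |t| L)
  rcases (abs_nonneg t).eq_or_lt with ht | ht
  · rwa [← ht, Metric.cthickening_zero, hL.isClosed.closure_eq]
  · refine hsnd.of_isClosed_subset Metric.isClosed_cthickening
      ((M.hasShortCurves.cthickening_subset_closure_thickening ht).trans
        (closure_minimal (fun y hy => ?_) hsnd.isClosed))
    obtain ⟨x, hx, hyx⟩ := Metric.infEDist_lt_iff.1 (Metric.mem_thickening_iff_infEDist_lt.1 hy)
    exact ⟨(t, y), ⟨mem_J_of_dist_lt hx hyx, rfl⟩, rfl⟩

lemma isCompact_J_inter_slice_of_abs_le {t' : ℝ} (hL : IsCompact L) (htt' : |t'| ≤ |t|)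
    (h : IsCompact (M.J ({0} ×ˢ L) ∩ slice S t)) :
    IsCompact (M.J ({0} ×ˢ L) ∩ slice S t') := by
  let _ := M.toEMetricSpace
  rw [isCompact_J_inter_slice_iff hL] at h ⊢
  exact isCompact_cthickening_mono htt' h

end CausalFuture

end StandardStaticSpacetime

lemma exists_tendsto_of_edist_le {ι X Y : Type*} [PseudoEMetricSpace X] [PseudoEMetricSpace Y]
    {C : Set X} (hC : IsComplete C) {l : Filter ι} [l.NeBot] {f : ι → X} {g : ι → Y} {A : Set ι}
    (hA : A ∈ l) (hg : Cauchy (map g l)) (hfC : MapsTo f A C)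
    (hfg : ∀ i ∈ A, ∀ j ∈ A, edist (f i) (f j) ≤ edist (g i) (g j)) :
    ∃ q, Tendsto f l (𝓝 q) := by
  have hf : Cauchy (map f l) := by
    refine EMetric.cauchy_iff.2 ⟨(inferInstance : (map f l).NeBot).ne, fun ε hε => ?_⟩
    obtain ⟨t, ht, htε⟩ := (EMetric.cauchy_iff.1 hg).2 ε hε
    refine ⟨f '' (A ∩ g ⁻¹' t), image_mem_map (inter_mem hA ht), ?_⟩
    rintro _ ⟨i, ⟨hi, hit⟩, rfl⟩ _ ⟨j, ⟨hj, hjt⟩, rfl⟩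
    exact (hfg i hi j hj).trans_lt (htε _ hit _ hjt)
  obtain ⟨q, -, hq⟩ := hC _ hf (le_principal_iff.2 (mem_map.2 (mem_of_superset hA hfC)))
  exact ⟨q, hq⟩

namespace StandardStaticSpacetime

lemma pastInextendible_iff {X : Type*} [TopologicalSpace X] {γ : ℝ → X} {I : Set ℝ}
    (hI : I.Nonempty) :
    PastInextendible γ I ↔ ¬ ∃ q, Tendsto (fun s : I => γ s) atBot (𝓝 q) := by
  have := hI.to_subtype
  simp only [PastInextendible, tendsto_def, mem_atBot_sets, Subtype.exists, Subtype.forall,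
    mem_preimage, Subtype.mk_le_mk, exists_prop]

lemma futureInextendible_Ici_of_fst_eq {X : Type*} [TopologicalSpace X] {γ : ℝ → ℝ × X} {t : ℝ}
    (hγ : ∀ s, (γ s).1 = s) : FutureInextendible γ (Ici t) := by
  rintro ⟨q, hq⟩
  obtain ⟨s, hs, hlt⟩ := hq _
    ((isOpen_lt continuous_fst continuous_const).mem_nhds (lt_add_one q.1))
  have := hlt (max s (q.1 + 1)) (le_max_of_le_left (mem_Ici.1 hs)) (le_max_left _ _)
  rw [mem_ofPred_eq, hγ] at this
  exact (le_max_right s (q.1 + 1)).not_gt this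

lemma pastInextendible_reverse_ray {X : Type*} [TopologicalSpace X] {γ : ℝ → X} {R t : ℝ}
    (hlim : ¬ ∃ q, Tendsto γ (𝓝[<] R) (𝓝 q)) :
    PastInextendible (fun s => (s, γ (t - s))) (Ioc (t - R) t) := by
  rintro ⟨q, hq⟩
  refine hlim ⟨q.2, fun U hU => ?_⟩
  obtain ⟨s, hs, hsU⟩ := hq (Prod.snd ⁻¹' U) (continuous_snd.continuousAt hU)
  rw [mem_map]
  filter_upwards [Ioo_mem_nhdsLT (sub_lt_comm.1 hs.1)] with u hu
  simpa using hsU (t - u) ⟨by linarith [hu.2], by linarith [hu.1, hs.2]⟩ (by linarith [hu.1])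

section CauchyDevelopment

variable {E : Type*} [NormedAddCommGroup E] [NormedSpace ℝ E]
  {S : Type*} [TopologicalSpace S] [ChartedSpace E S] [IsManifold 𝓘(ℝ, E) ∞ S]
  {M : StandardStaticSpacetime E S} {L : Set S} {x : S} {τ t : ℝ}

namespace IsFutureCausalCurveOn

variable {γ : ℝ → ℝ × S} {I : Set ℝ} {s₀ : ℝ}

lemma dist_le_edist (h : M.IsFutureCausalCurveOn γ I) {s s' : ℝ} (hs : s ∈ I) (hs' : s' ∈ I) :
    M.dist (γ s).2 (γ s').2 ≤ edist (γ s).1 (γ s').1 := by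
  wlog hss : s ≤ s' generalizing s s'
  · rw [M.dist_comm, edist_comm]
    exact this hs' hs (le_of_not_ge hss)
  · refine (h.dist_le hs hs' hss).trans ?_
    rw [edist_comm, edist_dist, Real.dist_eq]
    exact ENNReal.ofReal_le_ofReal (le_abs_self _)

lemma lt_fst_of_forall_notMem_slice (h : M.IsFutureCausalCurveOn γ I)
    (hτ : ∀ s ∈ I, γ s ∉ slice S τ) (hs₀ : s₀ ∈ I) (hτ₀ : τ < (γ s₀).1) :
    ∀ s ∈ I, τ < (γ s).1 := by
  intro s hs
  by_contra hle
  obtain ⟨u, hu, huτ⟩ := h.1.isPreconnected.intermediate_value hs hs₀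
    h.contDiffOn_fst.continuousOn ⟨not_lt.1 hle, hτ₀.le⟩
  exact hτ u hu huτ

lemma not_pastInextendible [T3Space S] (h : M.IsFutureCausalCurveOn γ I) (hs₀ : s₀ ∈ I)
    (hτ : ∀ s ∈ I, τ ≤ (γ s).1)
    (hC : IsCompact (M.closedThickening {(γ s₀).2} ((γ s₀).1 - τ))) : ¬PastInextendible γ I := by
  let _ := M.toEMetricSpace
  rw [pastInextendible_iff ⟨s₀, hs₀⟩, not_not]
  have : Nonempty I := ⟨⟨s₀, hs₀⟩⟩
  have htime : Tendsto (fun s : I => (γ s).1) atBot (𝓝 (⨅ s : I, (γ s).1)) :=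
    tendsto_atBot_ciInf (fun s s' hs => h.strictMonoOn_fst.monotoneOn s.2 s'.2 hs)
      ⟨τ, forall_mem_range.2 fun s => hτ s s.2⟩
  have hball : MapsTo (fun s : I => (γ s).2) (Iic ⟨s₀, hs₀⟩)
      (M.closedThickening {(γ s₀).2} ((γ s₀).1 - τ)) := fun s hs =>
    mem_closedThickening_of_dist_le rfl ((h.dist_le s.2 hs₀ hs).trans
      (ENNReal.ofReal_le_ofReal (sub_le_sub_left (hτ s s.2) _)))
  obtain ⟨q, hq⟩ := exists_tendsto_of_edist_le hC.isComplete (Iic_mem_atBot _) htime.cauchy_map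
    hball fun s _ s' _ => h.dist_le_edist s.2 s'.2
  exact ⟨_, htime.prodMk_nhds hq⟩

end IsFutureCausalCurveOn

lemma slice_subset_D : slice S τ ⊆ M.D (slice S τ) :=
  fun _ hp => Or.inl fun _ _ _ _ ⟨s, hs, hsp⟩ => ⟨s, hs, hsp ▸ hp⟩

variable [T3Space S]

lemma mem_Dplus_of_isCompact (hτ : τ < t) (hC : IsCompact (M.closedThickening {x} (t - τ))) :
    (t, x) ∈ M.Dplus (slice S τ) := by
  rintro γ I hγ hinext ⟨s₀, hs₀, hp⟩
  by_contra! hmeet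
  have hlow := hγ.lt_fst_of_forall_notMem_slice hmeet hs₀ (hp ▸ hτ)
  exact hγ.not_pastInextendible hs₀ (fun s hs => (hlow s hs).le) (by rwa [hp]) hinext

lemma closedThickening_singleton_subset {y : S} {r s : ℝ} (hr : 0 ≤ r) (hs : 0 ≤ s)
    (hy : y ∈ M.closedThickening L r) :
    M.closedThickening {y} s ⊆ M.closedThickening L (r + s) := by
  let _ := M.toEMetricSpace
  rw [add_comm]
  exact (Metric.cthickening_subset_of_subset s (singleton_subset_iff.2 hy)).trans
    (Metric.cthickening_cthickening_subset hs hr L)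

variable [FiniteDimensional ℝ E]

lemma notMem_Dminus_slice (hτ : τ < t) : (t, x) ∉ M.Dminus (slice S τ) := by
  intro h
  obtain ⟨s, hs, rfl⟩ := h (fun s => (s, x)) (Ici t)
    (isFutureCausalCurveOn_graph ordConnected_Ici (uniqueDiffOn_Ici t) contMDiffOn_const
      fun _ _ _ _ => (M.dist_self x).trans_le zero_le)
    (futureInextendible_Ici_of_fst_eq fun _ => rfl) ⟨t, self_mem_Ici, rfl⟩
  exact hτ.not_ge hs

lemma isFutureCausalCurveOn_reverse_ray {γ : ℝ → S} {R : ℝ}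
    (hγ : ∀ s ∈ Ico 0 R, ∀ s' ∈ Ico 0 R, M.dist (γ s) (γ s') = edist s s') :
    M.IsFutureCausalCurveOn (fun s => (s, γ (t - s))) (Ioc (t - R) t) := by
  let _ := M.riemannianBundle
  let _ := M.toEMetricSpace
  have := M.isContMDiffRiemannianBundle
  have := M.isRiemannianManifold
  have hmaps : MapsTo (fun s : ℝ => t - s) (Ioc (t - R) t) (Ico 0 R) := fun s hs =>
    ⟨sub_nonneg.2 hs.2, sub_lt_comm.1 hs.1⟩
  refine isFutureCausalCurveOn_graph ordConnected_Ioc (uniqueDiffOn_Ioc _ _)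
    ((contMDiffOn_Ico_of_edist_eq hγ).comp (contDiff_const.sub contDiff_id).contMDiff.contMDiffOn
      hmaps) fun s hs s' hs' => ?_
  rw [hγ _ (hmaps hs) _ (hmaps hs'), edist_sub_left]

lemma isCompact_of_mem_Dplus [LocallyCompactSpace S] (h : (t, x) ∈ M.Dplus (slice S τ)) :
    IsCompact (M.closedThickening {x} (t - τ)) := by
  let _ := M.toEMetricSpace
  by_contra hnc
  obtain ⟨R, ⟨hR, hRt⟩, hncR, hlt⟩ :=
    M.hasShortCurves.exists_minimal_not_isCompact_cthickening isCompact_singleton hnc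
  obtain ⟨γ, rfl, -, hγ, hlim⟩ :=
    M.hasShortCurves.exists_isometric_ray isCompact_singleton hR hncR hlt
  obtain ⟨s, hs, rfl⟩ := h _ _ (isFutureCausalCurveOn_reverse_ray hγ)
    (pastInextendible_reverse_ray hlim) ⟨t, ⟨sub_lt_self t hR, le_rfl⟩, by rw [sub_self]⟩
  linarith [hs.1]

theorem mem_D_slice_iff [LocallyCompactSpace S] (hτ : τ < t) :
    (t, x) ∈ M.D (slice S τ) ↔ IsCompact (M.closedThickening {x} (t - τ)) :=
  ⟨fun h => h.elim isCompact_of_mem_Dplus fun h => absurd h (notMem_Dminus_slice hτ),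
    fun h => Or.inl (mem_Dplus_of_isCompact hτ h)⟩

lemma J_inter_slice_subset_D [LocallyCompactSpace S] (hτ : 0 ≤ τ) (hτt : τ ≤ t)
    (hC : IsCompact (M.closedThickening L (2 * t - τ))) :
    M.J ({0} ×ˢ L) ∩ slice S t ⊆ M.D (slice S τ) := by
  let _ := M.toEMetricSpace
  rcases hτt.eq_or_lt with rfl | hτt
  · exact inter_subset_right.trans slice_subset_D
  rintro ⟨s, y⟩ ⟨hJ, hs⟩
  obtain rfl : t = s := hs.symm
  refine (mem_D_slice_iff hτt).2 (hC.of_isClosed_subset Metric.isClosed_cthickening ?_)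
  have hy := mem_closedThickening_of_mem_J hJ
  rw [abs_of_pos (hτ.trans_lt hτt)] at hy
  rw [two_mul, add_sub_assoc]
  exact closedThickening_singleton_subset (hτ.trans hτt.le) (sub_nonneg.2 hτt.le) hy

lemma isCompact_of_J_inter_slice_subset_D [LocallyCompactSpace S] (hL : IsCompact L) (hτ : 0 ≤ τ)
    (hCτ : IsCompact (M.closedThickening L τ))
    (h : M.J ({0} ×ˢ L) ∩ slice S t ⊆ M.D (slice S τ)) :
    IsCompact (M.closedThickening L (2 * t - τ)) := by
  let _ := M.toEMetricSpace
  by_contra hnc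
  obtain ⟨R, ⟨hR, hRt⟩, hncR, hlt⟩ :=
    M.hasShortCurves.exists_minimal_not_isCompact_cthickening hL hnc
  obtain ⟨γ, -, hmem, hγ, hlim⟩ := M.hasShortCurves.exists_isometric_ray hL hR hncR hlt
  have hτR : τ < R := not_le.1 fun hle => hncR (isCompact_cthickening_mono hle hCτ)
  have hτt : τ < t := by linarith
  obtain ⟨s, hs₀, hst, hsR, hRs⟩ : ∃ s, 0 ≤ s ∧ s ≤ t ∧ s < R ∧ R - s ≤ t - τ :=
    ⟨max 0 (R - (t - τ)), le_max_left _ _, max_le (by linarith) (by linarith),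
      max_lt hR (by linarith), by linarith [le_max_right 0 (R - (t - τ))]⟩
  have hJ : (t, γ s) ∈ M.J ({0} ×ˢ L) := mem_J_of_mem_closedThickening hL hs₀
    (hst.trans (le_abs_self t)) (hlt s hsR) (hmem s ⟨hs₀, hsR⟩)
  have hball : IsCompact (M.closedThickening {γ s} (t - τ)) :=
    (mem_D_slice_iff hτt).1 (h ⟨hJ, rfl⟩)
  have htail : MapsTo γ (Ioo s R) (M.closedThickening {γ s} (t - τ)) := fun u hu =>
    mem_closedThickening_of_dist_le rfl
      ((hγ u ⟨hs₀.trans hu.1.le, hu.2⟩ s ⟨hs₀, hsR⟩).trans_le (by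
        rw [edist_dist, Real.dist_eq, abs_of_pos (sub_pos.2 hu.1)]
        exact ENNReal.ofReal_le_ofReal (by linarith [hu.2])))
  exact hlim (exists_tendsto_of_edist_le hball.isComplete (g := id) (Ioo_mem_nhdsLT hsR)
    (cauchy_nhds.mono nhdsWithin_le_nhds) htail fun u hu v hv =>
      (hγ u ⟨hs₀.trans hu.1.le, hu.2⟩ v ⟨hs₀.trans hv.1.le, hv.2⟩).le)

theorem J_inter_slice_subset_D_iff [LocallyCompactSpace S] (hL : IsCompact L) (hτ : 0 ≤ τ)
    (hτt : τ ≤ t) (hCτ : IsCompact (M.closedThickening L τ)) :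
    M.J ({0} ×ˢ L) ∩ slice S t ⊆ M.D (slice S τ) ↔
      IsCompact (M.closedThickening L (2 * t - τ)) :=
  ⟨isCompact_of_J_inter_slice_subset_D hL hτ hCτ, J_inter_slice_subset_D hτ hτt⟩

end CauchyDevelopment

end StandardStaticSpacetime

section ENNReal

variable {a b : ℝ≥0∞}

lemma left_lt_half_add (h : a < b) : a < (a + b) / 2 := by
  rw [ENNReal.lt_div_iff_mul_lt (.inl two_ne_zero) (.inl ENNReal.ofNat_ne_top), mul_two,
    ENNReal.add_lt_add_iff_left h.ne_top]
  exact h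

lemma half_add_lt_right (h : a < b) (hb : b ≠ ⊤) : (a + b) / 2 < b := by
  rw [ENNReal.div_lt_iff (.inl two_ne_zero) (.inl ENNReal.ofNat_ne_top), mul_two,
    ENNReal.add_lt_add_iff_right hb]
  exact h

lemma ofReal_two_mul_sub_lt_iff {τ t : ℝ} (hτ : 0 ≤ τ) (hτt : τ ≤ t) :
    ENNReal.ofReal (2 * t - τ) < b ↔ ENNReal.ofReal t < (ENNReal.ofReal τ + b) / 2 := by
  rw [ENNReal.lt_div_iff_mul_lt (.inl two_ne_zero) (.inl ENNReal.ofNat_ne_top),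
    ← ENNReal.add_lt_add_iff_left (ENNReal.ofReal_ne_top (r := τ)),
    ← ENNReal.ofReal_add hτ (by linarith), add_sub_cancel, ENNReal.ofReal_mul zero_le_two,
    ENNReal.ofReal_ofNat, mul_comm]

lemma sSup_image_ofReal_eq {A : Set ℝ} {τ : ℝ} (hτ : ENNReal.ofReal τ < b)
    (hA : ∀ t, τ ≤ t → (t ∈ A ↔ ENNReal.ofReal t < b)) : sSup (ENNReal.ofReal '' A) = b := by
  refine le_antisymm (sSup_le ?_) (le_of_forall_lt fun c hc => ?_)
  · rintro _ ⟨t, ht, rfl⟩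
    rcases le_total τ t with hτt | htτ
    · exact ((hA t hτt).1 ht).le
    · exact (ENNReal.ofReal_le_ofReal htτ).trans hτ.le
  · obtain ⟨t, -, hct, htb⟩ := ENNReal.lt_iff_exists_real_btwn.1 hc
    have hmem : max τ t ∈ A := (hA _ (le_max_left _ _)).2 (by
      rw [ENNReal.ofReal_max]
      exact max_lt hτ htb)
    exact hct.trans_le ((ENNReal.ofReal_le_ofReal (le_max_right τ t)).trans
      (le_sSup (mem_image_of_mem _ hmem)))

lemma ofReal_one_sub_one_div_two_pow_succ (n : ℕ) :
    ENNReal.ofReal (1 - 1 / 2 ^ (n + 1)) = (ENNReal.ofReal (1 - 1 / 2 ^ n) + 1) / 2 := by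
  have hn : (0 : ℝ) ≤ 1 - 1 / 2 ^ n :=
    sub_nonneg.2 ((div_le_one (by positivity)).2 (one_le_pow₀ one_le_two))
  rw [← ENNReal.ofReal_one, ← ENNReal.ofReal_add hn zero_le_one, ← ENNReal.ofReal_ofNat 2,
    ← ENNReal.ofReal_div_of_pos two_pos]
  congr 1
  field_simp
  ring

lemma tendsto_ofReal_one_sub_one_div_two_pow :
    Tendsto (fun n : ℕ => ENNReal.ofReal (1 - 1 / 2 ^ n)) atTop (𝓝 1) := by
  have h : Tendsto (fun n : ℕ => (1 / 2 ^ n : ℝ)) atTop (𝓝 0) := by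
    simpa using tendsto_pow_atTop_nhds_zero_of_lt_one (r := (2⁻¹ : ℝ)) (by norm_num) (by norm_num)
  simpa using ENNReal.tendsto_ofReal (h.const_sub 1)

end ENNReal

namespace StandardStaticSpacetime

section Times

variable {E : Type*} [NormedAddCommGroup E] [NormedSpace ℝ E]
  {S : Type*} [TopologicalSpace S] [ChartedSpace E S] [IsManifold 𝓘(ℝ, E) ∞ S]
  {M : StandardStaticSpacetime E S} {L : Set S} {τ t : ℝ} {n : ℕ} [T3Space S]

lemma dist_lt_top [ConnectedSpace S] (x y : S) : M.dist x y < ⊤ := by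
  let _ := M.toEMetricSpace
  have hclopen : IsClopen (Metric.eball y ⊤) := ⟨Metric.isClosed_eball_top, Metric.isOpen_eball⟩
  exact (hclopen.eq_univ ⟨y, Metric.mem_eball_self ENNReal.zero_lt_top⟩).ge (mem_univ x)

lemma isComplete_of_forall_isCompact (h : ∀ x, IsCompact (M.closedThickening {x} 1)) :
    M.IsComplete := by
  let _ := M.toEMetricSpace
  intro u hu
  obtain ⟨N, hN⟩ := hu 1 one_pos
  have htail : ∀ᶠ n in atTop, u n ∈ M.closedThickening {u N} 1 := by
    filter_upwards [eventually_ge_atTop N] with n hn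
    exact mem_closedThickening_of_dist_le rfl ((hN n hn N le_rfl).le.trans_eq
      ENNReal.ofReal_one.symm)
  obtain ⟨x, -, hx⟩ := (h (u N)).isComplete (map u atTop) (EMetric.cauchySeq_iff.2 hu)
    (le_principal_iff.2 htail)
  exact ⟨x, tendsto_iff_edist_tendsto_0.1 hx⟩

variable [FiniteDimensional ℝ E] [LocallyCompactSpace S]

lemma isCompact_closedThickening_iff_lt_tInfty (hL : IsCompact L) (ht : 0 ≤ t) :
    IsCompact (M.closedThickening L t) ↔ ENNReal.ofReal t < M.tInfty ({0} ×ˢ L) := by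
  let _ := M.toEMetricSpace
  have hset : {t : ℝ | 0 ≤ t ∧ IsCompact (M.Jplus ({0} ×ˢ L) ∩ slice S t)} =
      {t : ℝ | 0 ≤ t ∧ IsCompact (M.closedThickening L t)} := by
    ext u
    refine and_congr_right fun hu => ?_
    rw [Jplus_inter_slice hu, isCompact_J_inter_slice_iff hL, abs_of_nonneg hu]
  rw [tInfty, hset]
  constructor
  · intro h
    obtain ⟨ε, hε, hC⟩ := M.hasShortCurves.exists_isCompact_cthickening_add ht h
    have htε : 0 < t + ε := add_pos_of_nonneg_of_pos ht hε
    exact ((ENNReal.ofReal_lt_ofReal_iff htε).2 (lt_add_of_pos_right t hε)).trans_le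
      (le_sSup ⟨t + ε, ⟨htε.le, hC⟩, rfl⟩)
  · intro h
    obtain ⟨_, ⟨u, ⟨-, hu⟩, rfl⟩, htu⟩ := lt_sSup_iff.1 h
    exact isCompact_cthickening_mono (ENNReal.ofReal_lt_ofReal_iff'.1 htu).1.le hu

theorem isCompact_J_inter_slice_iff_lt_tInfty (hL : IsCompact L) :
    IsCompact (M.J ({0} ×ˢ L) ∩ slice S t) ↔ ENNReal.ofReal |t| < M.tInfty ({0} ×ˢ L) := by
  rw [isCompact_J_inter_slice_iff hL, isCompact_closedThickening_iff_lt_tInfty hL (abs_nonneg t)]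

lemma tInfty_pos (hL : IsCompact L) : 0 < M.tInfty ({0} ×ˢ L) := by
  let _ := M.toEMetricSpace
  have hL₀ : IsCompact (Metric.cthickening 0 L) := by
    rwa [Metric.cthickening_zero, hL.isClosed.closure_eq]
  simpa using (isCompact_closedThickening_iff_lt_tInfty hL le_rfl).1 hL₀

section Completeness

lemma IsComplete.isCompact_closedThickening (h : M.IsComplete) (hL : IsCompact L) (t : ℝ) :
    IsCompact (M.closedThickening L t) := by
  let _ := M.toEMetricSpace
  have : CompleteSpace S := EMetric.complete_of_cauchySeq_tendsto fun u hu => by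
    obtain ⟨x, hx⟩ := h u (EMetric.cauchySeq_iff.1 hu)
    exact ⟨x, tendsto_iff_edist_tendsto_0.2 hx⟩
  exact M.hasShortCurves.isCompact_cthickening hL t

lemma tInfty_eq_top_iff (hL : IsCompact L) :
    M.tInfty ({0} ×ˢ L) = ⊤ ↔ ∀ t : ℝ, 0 ≤ t → IsCompact (M.closedThickening L t) := by
  refine ⟨fun h t ht => ?_, fun h => ENNReal.eq_top_of_forall_nnreal_le fun r => ?_⟩
  · rw [isCompact_closedThickening_iff_lt_tInfty hL ht, h]
    exact ENNReal.ofReal_lt_top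
  · rw [← ENNReal.ofReal_coe_nnreal]
    exact ((isCompact_closedThickening_iff_lt_tInfty hL r.2).1 (h r r.2)).le

lemma IsComplete.tInfty_eq_top (h : M.IsComplete) (hL : IsCompact L) :
    M.tInfty ({0} ×ˢ L) = ⊤ :=
  (tInfty_eq_top_iff hL).2 fun t _ => h.isCompact_closedThickening hL t

lemma isComplete_of_forall_tInfty_eq_top (h : ∀ x : S, M.tInfty ({0} ×ˢ {x}) = ⊤) :
    M.IsComplete :=
  isComplete_of_forall_isCompact fun x =>
    (tInfty_eq_top_iff isCompact_singleton).1 (h x) 1 zero_le_one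

lemma isComplete_of_tInfty_eq_top [ConnectedSpace S] (hL : IsCompact L) (hne : L.Nonempty)
    (h : M.tInfty ({0} ×ˢ L) = ⊤) : M.IsComplete := by
  let _ := M.toEMetricSpace
  obtain ⟨y, hy⟩ := hne
  refine isComplete_of_forall_isCompact fun x => ?_
  have hx : x ∈ M.closedThickening L (M.dist x y).toReal :=
    mem_closedThickening_of_dist_le hy (ENNReal.ofReal_toReal (dist_lt_top x y).ne).ge
  exact ((tInfty_eq_top_iff hL).1 h _ (by positivity)).of_isClosed_subset
    Metric.isClosed_cthickening
    (closedThickening_singleton_subset ENNReal.toReal_nonneg zero_le_one hx)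

end Completeness

theorem J_inter_slice_subset_D_iff_lt (hL : IsCompact L) (hτ : 0 ≤ τ) (hτt : τ ≤ t)
    (hτT : ENNReal.ofReal τ < M.tInfty ({0} ×ˢ L)) :
    M.J ({0} ×ˢ L) ∩ slice S t ⊆ M.D (slice S τ) ↔
      ENNReal.ofReal t < (ENNReal.ofReal τ + M.tInfty ({0} ×ˢ L)) / 2 := by
  rw [J_inter_slice_subset_D_iff hL hτ hτt
    ((isCompact_closedThickening_iff_lt_tInfty hL hτ).2 hτT),
    isCompact_closedThickening_iff_lt_tInfty hL (by linarith), ofReal_two_mul_sub_lt_iff hτ hτt]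

lemma J_inter_slice_subset_D_slice_zero_iff (hL : IsCompact L) (ht : 0 ≤ t) :
    M.J ({0} ×ˢ L) ∩ slice S t ⊆ M.D (slice S 0) ↔
      ENNReal.ofReal t < M.tInfty ({0} ×ˢ L) / 2 := by
  simpa using J_inter_slice_subset_D_iff_lt hL le_rfl ht (by simpa using tInfty_pos hL)

lemma tSeq_succ_of_lt (hL : IsCompact L) (h : M.tSeq ({0} ×ˢ L) n < M.tInfty ({0} ×ˢ L)) :
    M.tSeq ({0} ×ˢ L) (n + 1) = (M.tSeq ({0} ×ˢ L) n + M.tInfty ({0} ×ˢ L)) / 2 := by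
  have hτ := ENNReal.ofReal_toReal h.ne_top
  rw [tSeq, if_neg h.ne_top]
  refine sSup_image_ofReal_eq (hτ.trans_lt (left_lt_half_add h)) fun t ht => ?_
  have ht₀ : 0 ≤ t := ENNReal.toReal_nonneg.trans ht
  rw [mem_ofPred_eq, and_iff_right ht₀, Jplus_inter_slice ht₀,
    J_inter_slice_subset_D_iff_lt hL ENNReal.toReal_nonneg ht (hτ.trans_lt h), hτ]

lemma tSeq_lt_tInfty (hL : IsCompact L) (hn : M.tSeq ({0} ×ˢ L) n ≠ ⊤) :
    M.tSeq ({0} ×ˢ L) n < M.tInfty ({0} ×ˢ L) := by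
  induction n with
  | zero => exact tInfty_pos hL
  | succ n ih =>
    have hlt := ih fun htop => hn (if_pos htop)
    rw [tSeq_succ_of_lt hL hlt] at hn ⊢
    refine half_add_lt_right hlt fun htop => hn ?_
    rw [htop, add_top, ENNReal.top_div_of_ne_top ENNReal.ofNat_ne_top]

theorem tSeq_succ (hL : IsCompact L) (n : ℕ) :
    M.tSeq ({0} ×ˢ L) (n + 1) = (M.tSeq ({0} ×ˢ L) n + M.tInfty ({0} ×ˢ L)) / 2 := by
  by_cases htop : M.tSeq ({0} ×ˢ L) n = ⊤
  · rw [tSeq, if_pos htop, htop, top_add, ENNReal.top_div_of_ne_top ENNReal.ofNat_ne_top]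
  · exact tSeq_succ_of_lt hL (tSeq_lt_tInfty hL htop)

lemma tSeq_one (hL : IsCompact L) : M.tSeq ({0} ×ˢ L) 1 = M.tInfty ({0} ×ˢ L) / 2 := by
  rw [tSeq_succ hL, tSeq, zero_add]

theorem tSeq_eq (hL : IsCompact L) (n : ℕ) :
    M.tSeq ({0} ×ˢ L) n = ENNReal.ofReal (1 - 1 / 2 ^ n) * M.tInfty ({0} ×ˢ L) := by
  induction n with
  | zero => simp [tSeq]
  | succ n ih =>
    rw [tSeq_succ hL, ih, ofReal_one_sub_one_div_two_pow_succ, ENNReal.mul_div_right_comm.symm,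
      add_mul, one_mul]

theorem J_inter_slice_subset_D_tSeq_iff (hL : IsCompact L) (ht₀ : 0 ≤ t)
    (ht : M.tSeq ({0} ×ˢ L) n ≤ ENNReal.ofReal t) :
    M.J ({0} ×ˢ L) ∩ slice S t ⊆ M.D (slice S (M.tSeq ({0} ×ˢ L) n).toReal) ↔
      ENNReal.ofReal t < ENNReal.ofReal (1 - 1 / 2 ^ (n + 1)) * M.tInfty ({0} ×ˢ L) := by
  have htop : M.tSeq ({0} ×ˢ L) n ≠ ⊤ := (ht.trans_lt ENNReal.ofReal_lt_top).ne
  have hτ := ENNReal.ofReal_toReal htop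
  rw [J_inter_slice_subset_D_iff_lt hL ENNReal.toReal_nonneg
    (ENNReal.toReal_le_of_le_ofReal ht₀ ht) (hτ.trans_lt (tSeq_lt_tInfty hL htop)), hτ,
    ← tSeq_succ hL, tSeq_eq hL]

lemma tSeq_lt_tSeq_succ (hL : IsCompact L) (hn : M.tSeq ({0} ×ˢ L) n ≠ ⊤) :
    M.tSeq ({0} ×ˢ L) n < M.tSeq ({0} ×ˢ L) (n + 1) := by
  rw [tSeq_succ hL]
  exact left_lt_half_add (tSeq_lt_tInfty hL hn)

lemma monotone_tSeq (hL : IsCompact L) : Monotone (M.tSeq ({0} ×ˢ L)) :=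
  monotone_nat_of_le_succ fun n => by
    by_cases htop : M.tSeq ({0} ×ˢ L) n = ⊤
    · exact le_top.trans_eq (if_pos htop).symm
    · exact (tSeq_lt_tSeq_succ hL htop).le

lemma strictMono_tSeq (hL : IsCompact L) (hT : M.tInfty ({0} ×ˢ L) ≠ ⊤) :
    StrictMono (M.tSeq ({0} ×ˢ L)) :=
  strictMono_nat_of_lt_succ fun n => tSeq_lt_tSeq_succ hL (by
    rw [tSeq_eq hL]
    exact ENNReal.mul_ne_top ENNReal.ofReal_ne_top hT)

lemma tendsto_tSeq (hL : IsCompact L) :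
    Tendsto (M.tSeq ({0} ×ˢ L)) atTop (𝓝 (M.tInfty ({0} ×ˢ L))) := by
  have h := ENNReal.Tendsto.mul_const (b := M.tInfty ({0} ×ˢ L))
    tendsto_ofReal_one_sub_one_div_two_pow (.inl one_ne_zero)
  rw [one_mul] at h
  exact h.congr fun n => (tSeq_eq hL n).symm

end Times

lemma exists_eq_singleton_prod {S : Type*} [TopologicalSpace S] {K : Set (ℝ × S)} {t : ℝ}
    (hK : IsCompact K) (hKt : K ⊆ slice S t) : ∃ L, IsCompact L ∧ K = {t} ×ˢ L := by
  refine ⟨_, hK.image continuous_snd, ?_⟩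
  ext ⟨s, x⟩
  constructor
  · exact fun h => ⟨hKt h, _, h, rfl⟩
  · rintro ⟨rfl, ⟨s', _⟩, h, rfl⟩
    obtain rfl : s' = s := hKt h
    exact h

end StandardStaticSpacetime

open StandardStaticSpacetime

theorem mainTheorem9
    {E : Type*} [NormedAddCommGroup E] [NormedSpace ℝ E] [FiniteDimensional ℝ E]
    {S : Type*} [TopologicalSpace S] [T2Space S] [SecondCountableTopology S]
    [ChartedSpace E S] [IsManifold 𝓘(ℝ, E) ∞ S]
    (M : StandardStaticSpacetime E S) :
    -- the statements about a fixed compact subset `K` of `Σ_0`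
    (∀ K : Set (ℝ × S), IsCompact K → K ⊆ StandardStaticSpacetime.slice S 0 →
      -- compactness of `J(K) ∩ Σ_t` passes to times of smaller absolute value
      (∀ t t' : ℝ, |t'| ≤ |t| → IsCompact (M.J K ∩ StandardStaticSpacetime.slice S t) →
        IsCompact (M.J K ∩ StandardStaticSpacetime.slice S t')) ∧
      -- `t^∞(K) ∈ (0, ∞]`
      0 < M.tInfty K ∧
      -- `J(K) ∩ Σ_t` is compact exactly for `|t| < t^∞(K)`
      (∀ t : ℝ, IsCompact (M.J K ∩ StandardStaticSpacetime.slice S t) ↔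
        ENNReal.ofReal |t| < M.tInfty K) ∧
      -- completeness implies that all `C(K, t)` are compact and that `t^∞(K) = ∞`
      (M.IsComplete →
        (∀ t : ℝ, 0 ≤ t → IsCompact (M.closedThickening (Prod.snd '' K) t)) ∧
        M.tInfty K = ⊤) ∧
      -- the converse, for one non-empty `K`, if `S` is connected
      (ConnectedSpace S → K.Nonempty → M.tInfty K = ⊤ → M.IsComplete) ∧
      -- `J(K) ∩ Σ_t ⊆ D(Σ_0)` exactly for `t < t^∞(K) / 2`, and `t_1(K) = t^∞(K) / 2`
      (∀ t : ℝ, 0 ≤ t →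
        (M.J K ∩ StandardStaticSpacetime.slice S t ⊆ M.D (StandardStaticSpacetime.slice S 0) ↔
          ENNReal.ofReal t < M.tInfty K / 2)) ∧
      M.tSeq K 1 = M.tInfty K / 2 ∧
      -- for `t ≥ t_n(K)`: `J(K) ∩ Σ_t ⊆ D(Σ_{t_n(K)})` exactly for `t < (1 - 2⁻⁽ⁿ⁺¹⁾) t^∞(K)`
      (∀ (n : ℕ) (t : ℝ), 0 ≤ t → M.tSeq K n ≤ ENNReal.ofReal t →
        (M.J K ∩ StandardStaticSpacetime.slice S t ⊆
            M.D (StandardStaticSpacetime.slice S (M.tSeq K n).toReal) ↔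
          ENNReal.ofReal t < ENNReal.ofReal (1 - 1 / 2 ^ (n + 1)) * M.tInfty K)) ∧
      -- `t_n(K) = (1 - 2⁻ⁿ) t^∞(K)`, which increases to `t^∞(K)`
      (∀ n : ℕ, M.tSeq K n = ENNReal.ofReal (1 - 1 / 2 ^ n) * M.tInfty K) ∧
      Monotone (M.tSeq K) ∧
      (M.tInfty K ≠ ⊤ → StrictMono (M.tSeq K)) ∧
      Tendsto (M.tSeq K) atTop (𝓝 (M.tInfty K))) ∧
    -- the converse without connectedness, from all non-empty compact subsets of `Σ_0`
    ((∀ K : Set (ℝ × S), IsCompact K → K ⊆ StandardStaticSpacetime.slice S 0 → K.Nonempty →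
      M.tInfty K = ⊤) → M.IsComplete) := by
  have : LocallyCompactSpace S := Manifold.locallyCompact_of_finiteDimensional 𝓘(ℝ, E)
  refine ⟨fun K hK hK₀ => ?_, fun h => isComplete_of_forall_tInfty_eq_top fun x =>
    h _ (isCompact_singleton.prod isCompact_singleton) (fun _ hp => hp.1)
      ((singleton_nonempty _).prod (singleton_nonempty _))⟩
  obtain ⟨L, hL, rfl⟩ := exists_eq_singleton_prod hK hK₀
  rw [snd_image_prod (singleton_nonempty _)]
  exact ⟨fun _ _ => isCompact_J_inter_slice_of_abs_le hL, tInfty_pos hL,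
    fun _ => isCompact_J_inter_slice_iff_lt_tInfty hL,
    fun h => ⟨fun t _ => h.isCompact_closedThickening hL t, h.tInfty_eq_top hL⟩,
    fun _ hne => isComplete_of_tInfty_eq_top hL hne.snd,
    fun _ => J_inter_slice_subset_D_slice_zero_iff hL, tSeq_one hL,
    fun _ _ => J_inter_slice_subset_D_tSeq_iff hL,
    tSeq_eq hL, monotone_tSeq hL, strictMono_tSeq hL, tendsto_tSeq hL⟩
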